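/- Let $H$ be a Hamiltonian on $n$ qubits with spectrum contained in $[\eta,\pi-\eta]$, $\eta>0$, whose ground-state energy $\lambda_0$ is non-degenerate and separated from the rest of the spectrum by a gap of at least $\Delta>0$; let $|\psi_0\rangle$ be its normalized ground state. $H$ is accessed only through black-box queries to the (possibly controlled) unitary $U=e^{-iH}$ and its inverse. Let $U_I$ be a black-box $n$-qubit unitary, which may be queried together with its inverse, such that $|\phi_0\rangle=U_I|0^n\rangle$ satisfies $|\langle\phi_0|\psi_0\rangle|\ge\gamma$, where $0<\gamma\le 1$. Let $0<\varepsilon,\vartheta<1$. Then there is a quantum algorithm, which consists of one- and two-qubit gates, queries, single-qubit measurements, classical control and re-initializations of all qubits to $|0\rangle$, and which depends only on $n,\eta,\gamma,\Delta,\varepsilon,\vartheta$ (in particular no upper bound on $\lambda_0$ is known in advance), that for every such $H$ and $U_I$ outputs, with probability at least $1-\vartheta$, an $n$-qubit pure state $|\tilde\psi_0\rangle$ with $|\langle\psi_0|\tilde\psi_0\rangle|\ge 1-\varepsilon$, at the following cost in the worst case over all measurement outcomes: 1. $\widetilde{\mathcal O}\big(\Delta^{-1}\gamma^{-1}\,\mathrm{polylog}(\varepsilon^{-1}\vartheta^{-1})\big)$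 queries to (controlled) $U$, and $\mathcal O\big(\gamma^{-1}\,\mathrm{polylog}(\Delta^{-1}\varepsilon^{-1}\vartheta^{-1})\big)$ queries to $U_I$; 2. three ancilla qubits; 3. $\widetilde{\mathcal O}\big(n\gamma^{-1}\log(\Delta^{-1}\varepsilon^{-1}\vartheta^{-1})+\Delta^{-1}\gamma^{-1}\log(\varepsilon^{-1}\vartheta^{-1})\big)$ additional one- and two-qubit gates; 4. query depth $\widetilde{\mathcal O}\big(\Delta^{-1}\gamma^{-1}\,\mathrm{polylog}(\varepsilon^{-1}\vartheta^{-1})\big)$, i.e. at most this many queries to (controlled) $U$ between two consecutive re-initializations. Here $\widetilde{\mathcal O}(g)$ means $\mathcal O(g\,\mathrm{polylog}(g))$, all implied constants and exponents are absolute, and $\log(x)$ in the bounds is understood as $\log(2+x)$, so that the bounds hold in the whole parameter range. -/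

import Mathlib

/-! Adaptive quantum programs with black-box access to a time evolution `U` and to a state
preparation oracle `U_I`, their semantics, and their costs. -/

noncomputable section

/-- The qubits of a register: `n` system qubits and `m` ancilla qubits. -/
abbrev Qubit (n m : ℕ) : Type := Fin n ⊕ Fin m

/-- Computational basis labels of the `n` system qubits. -/
abbrev SysBasis (n : ℕ) : Type := Fin n → Bool

/-- Computational basis labels of all the qubits. -/
abbrev RegBasis (n m : ℕ) : Type := Qubit n m → Bool

/-- The Hilbert space of the system, of dimension `2 ^ n`. -/
abbrev SysState (n : ℕ) : Type := EuclideanSpace ℂ (SysBasis n)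

/-- The Hilbert space of system and ancillas, of dimension `2 ^ (n + m)`. -/
abbrev RegState (n m : ℕ) : Type := EuclideanSpace ℂ (RegBasis n m)

/-- The system part of a basis label. -/
def sysPart {n m : ℕ} (x : RegBasis n m) : SysBasis n := fun i => x (Sum.inl i)

/-- The ancilla part of a basis label. -/
def ancPart {n m : ℕ} (x : RegBasis n m) : Fin m → Bool := fun j => x (Sum.inr j)

/-- A matrix applied to a vector of a finite-dimensional Hilbert space. -/
def applyMat {ι : Type*} [Fintype ι] (A : Matrix ι ι ℂ) (v : EuclideanSpace ℂ ι) :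
    EuclideanSpace ℂ ι :=
  WithLp.toLp 2 (A.mulVec v.ofLp)

/-- The system state `|0ⁿ⟩`. -/
def ketZeroSys (n : ℕ) : SysState n := EuclideanSpace.single (fun _ => false) 1

/-- The register state `|0ⁿ⟩ |0ᵐ⟩`. -/
def ketZero (n m : ℕ) : RegState n m := EuclideanSpace.single (fun _ => false) 1

/-- The register state in which the system is in state `w` and all ancillas are in `|0⟩`. -/
def withZeroAncillas {n : ℕ} (m : ℕ) (w : SysState n) : RegState n m :=
  WithLp.toLp 2 fun x => if ancPart x = (fun _ => false) then w.ofLp (sysPart x) else 0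

/-- A one-qubit gate `g` acting on qubit `q` of the register. -/
def liftOne {n m : ℕ} (q : Qubit n m) (g : Matrix Bool Bool ℂ) :
    Matrix (RegBasis n m) (RegBasis n m) ℂ :=
  fun x y => if ∀ r, r ≠ q → x r = y r then g (x q) (y q) else 0

/-- A two-qubit gate `g` acting on the qubits `p` and `q` of the register. -/
def liftTwo {n m : ℕ} (p q : Qubit n m) (g : Matrix (Bool × Bool) (Bool × Bool) ℂ) :
    Matrix (RegBasis n m) (RegBasis n m) ℂ :=
  fun x y => if ∀ r, r ≠ p → r ≠ q → x r = y r then g (x p, x q) (y p, y q) else 0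

/-- An `n`-qubit operator acting on the system, tensored with the identity on the ancillas. -/
def liftSys {n : ℕ} (m : ℕ) (A : Matrix (SysBasis n) (SysBasis n) ℂ) :
    Matrix (RegBasis n m) (RegBasis n m) ℂ :=
  fun x y => if ancPart x = ancPart y then A (sysPart x) (sysPart y) else 0

/-- An `n`-qubit operator acting on the system, controlled by the ancilla `c`
(applied when that ancilla is in state `|1⟩`). -/
def controlledSys {n m : ℕ} (c : Fin m) (A : Matrix (SysBasis n) (SysBasis n) ℂ) :
    Matrix (RegBasis n m) (RegBasis n m) ℂ :=
  fun x y => if x (Sum.inr c) = true then liftSys m A x y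
    else (1 : Matrix (RegBasis n m) (RegBasis n m) ℂ) x y

/-- The projector onto the subspace where qubit `q` has value `b`. -/
def projQubit {n m : ℕ} (q : Qubit n m) (b : Bool) :
    Matrix (RegBasis n m) (RegBasis n m) ℂ :=
  Matrix.diagonal fun x => if x q = b then 1 else 0

/-- Adaptive quantum programs on `n` system qubits and `m` ancilla qubits, with classical control:
what is done after a measurement may depend on its outcome. The oracles `U` and `U_I`
are only referred to by name, so that a program cannot depend on them. -/
inductive QProg (n m : ℕ) : Type
  /-- Stop; the output state is the current state of the system. -/
  | done : QProg n m
  /-- Discard the current state and start a new coherent run with all qubits in `|0⟩`. -/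
  | restart (next : QProg n m) : QProg n m
  /-- An arbitrary one-qubit gate. -/
  | gateOne (q : Qubit n m) (g : Matrix.unitaryGroup Bool ℂ) (next : QProg n m) : QProg n m
  /-- An arbitrary two-qubit gate. -/
  | gateTwo (p q : Qubit n m) (hpq : p ≠ q) (g : Matrix.unitaryGroup (Bool × Bool) ℂ)
      (next : QProg n m) : QProg n m
  /-- One query to `U` (or to its inverse, if `inv` is true), possibly controlled by an ancilla. -/
  | queryU (ctrl : Option (Fin m)) (inv : Bool) (next : QProg n m) : QProg n m
  /-- One query to `U_I` (or to its inverse, if `inv` is true). -/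
  | queryInit (inv : Bool) (next : QProg n m) : QProg n m
  /-- Measure qubit `q` in the computational basis and continue according to the outcome. -/
  | measure (q : Qubit n m) (next : Bool → QProg n m) : QProg n m

namespace QProg

variable {n m : ℕ}

/-- The number of queries to (controlled) `U` and its inverse, in the worst case over the
measurement outcomes. -/
def queriesU : QProg n m → ℕ
  | done => 0
  | restart p => p.queriesU
  | gateOne _ _ p => p.queriesU
  | gateTwo _ _ _ _ p => p.queriesU
  | queryU _ _ p => p.queriesU + 1
  | queryInit _ p => p.queriesU
  | measure _ f => max (f false).queriesU (f true).queriesU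

/-- The number of queries to `U_I` and its inverse, in the worst case over the measurement
outcomes. -/
def queriesInit : QProg n m → ℕ
  | done => 0
  | restart p => p.queriesInit
  | gateOne _ _ p => p.queriesInit
  | gateTwo _ _ _ _ p => p.queriesInit
  | queryU _ _ p => p.queriesInit
  | queryInit _ p => p.queriesInit + 1
  | measure _ f => max (f false).queriesInit (f true).queriesInit

/-- The number of one- and two-qubit gates, in the worst case over the measurement outcomes. -/
def gateCount : QProg n m → ℕ
  | done => 0
  | restart p => p.gateCount
  | gateOne _ _ p => p.gateCount + 1
  | gateTwo _ _ _ _ p => p.gateCount + 1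
  | queryU _ _ p => p.gateCount
  | queryInit _ p => p.gateCount
  | measure _ f => max (f false).gateCount (f true).gateCount

/-- Auxiliary to `queryDepth`: the largest number of queries to `U` in one coherent run, when
`k` queries have already been made in the current run. -/
def queryDepthFrom : QProg n m → ℕ → ℕ
  | done, k => k
  | restart p, k => max k (p.queryDepthFrom 0)
  | gateOne _ _ p, k => p.queryDepthFrom k
  | gateTwo _ _ _ _ p, k => p.queryDepthFrom k
  | queryU _ _ p, k => p.queryDepthFrom (k + 1)
  | queryInit _ p, k => p.queryDepthFrom k
  | measure _ f, k => max ((f false).queryDepthFrom k) ((f true).queryDepthFrom k)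

/-- The query depth: the largest number of queries to `U` in one coherent run. -/
def queryDepth (p : QProg n m) : ℕ := p.queryDepthFrom 0

open Classical in
/-- The probability that the program, with the oracles `U` and `UI`, ends in a state with
property `good`. The vector argument is the current state, conditioned on the past measurement
outcomes and scaled so that its squared norm is the probability of these outcomes. -/
def probFrom (U UI : Matrix (SysBasis n) (SysBasis n) ℂ) (good : RegState n m → Prop) :
    QProg n m → RegState n m → ℝ
  | done, v => if good v then ‖v‖ ^ 2 else 0
  | restart p, v => probFrom U UI good p ((‖v‖ : ℂ) • ketZero n m)
  | gateOne q g p, v => probFrom U UI good p (applyMat (liftOne q g) v)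
  | gateTwo q r _ g p, v => probFrom U UI good p (applyMat (liftTwo q r g) v)
  | queryU none inv p, v =>
      probFrom U UI good p (applyMat (liftSys m (if inv then U.conjTranspose else U)) v)
  | queryU (some c) inv p, v =>
      probFrom U UI good p (applyMat (controlledSys c (if inv then U.conjTranspose else U)) v)
  | queryInit inv p, v =>
      probFrom U UI good p (applyMat (liftSys m (if inv then UI.conjTranspose else UI)) v)
  | measure q f, v =>
      probFrom U UI good (f false) (applyMat (projQubit q false) v) +
        probFrom U UI good (f true) (applyMat (projQubit q true) v)

/-- The (possibly unnormalised) final state `v` consists of ancillas in `|0⟩` and a system state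
proportional to a unit vector whose overlap with `ψ₀` has modulus at least `1 - ε`. -/
def IsGoodOutput (m : ℕ) (ψ₀ : SysState n) (ε : ℝ) (v : RegState n m) : Prop :=
  ∃ w : SysState n, v = withZeroAncillas m w ∧ (1 - ε) * ‖w‖ ≤ ‖inner ℂ ψ₀ w‖

/-- The probability that the program, started with all qubits in `|0⟩`, outputs a pure system
state whose overlap with `ψ₀` has modulus at least `1 - ε`. -/
def prepProb (p : QProg n m) (U UI : Matrix (SysBasis n) (SysBasis n) ℂ) (ψ₀ : SysState n)
    (ε : ℝ) : ℝ :=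
  probFrom U UI (IsGoodOutput m ψ₀ ε) p (ketZero n m)

end QProg

/-- The time evolution `exp(-i H)`. -/
def evolution {n : ℕ} (H : Matrix (SysBasis n) (SysBasis n) ℂ) :
    Matrix (SysBasis n) (SysBasis n) ℂ :=
  NormedSpace.exp (-Complex.I • H)

/-- `ψ₀` is the (normalised, non-degenerate) ground state of `H`, with energy `E₀`, separated from
the rest of the spectrum by a gap of at least `Δ` (where `0 < Δ`). -/
structure IsGappedGroundState {n : ℕ} (H : Matrix (SysBasis n) (SysBasis n) ℂ) (Δ E₀ : ℝ)
    (ψ₀ : SysState n) : Prop where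
  norm_eq : ‖ψ₀‖ = 1
  eigen : applyMat H ψ₀ = (E₀ : ℂ) • ψ₀
  nondegenerate : ∀ v : SysState n, applyMat H v = (E₀ : ℂ) • v → ∃ c : ℂ, v = c • ψ₀
  gap : ∀ E ∈ spectrum ℝ H, E ≠ E₀ → E₀ + Δ ≤ E

/-- An instance of the ground-state preparation problem: a Hamiltonian `H` on `n` qubits with
spectrum in `[η, π - η]`, its ground state `ψ₀` with a gap of at least `Δ`, and a unitary `UI` that
prepares an initial guess `UI |0ⁿ⟩` of overlap at least `γ` with the ground state. -/
structure IsGroundStateInstance {n : ℕ} (η γ Δ : ℝ) (H : Matrix (SysBasis n) (SysBasis n) ℂ)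
    (E₀ : ℝ) (ψ₀ : SysState n) (UI : Matrix (SysBasis n) (SysBasis n) ℂ) : Prop where
  hermitian : H.IsHermitian
  spectrum_subset : spectrum ℝ H ⊆ Set.Icc η (Real.pi - η)
  ground : IsGappedGroundState H Δ E₀ ψ₀
  unitary : UI ∈ Matrix.unitaryGroup (SysBasis n) ℂ
  overlap : γ ≤ ‖inner ℂ (applyMat UI (ketZeroSys n)) ψ₀‖

/-- A logarithm that is bounded away from zero on the nonnegative reals, for use in asymptotic
bounds: `log (2 + x)`. -/
def slog (x : ℝ) : ℝ := Real.log (2 + x)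

/-- The bound `C * g * polylog g` of soft-O notation, with the constant and the exponent of the
logarithm written out. -/
def softO (C : ℝ) (k : ℕ) (g : ℝ) : ℝ := C * (g * slog g ^ k)

end

/-! The algorithm locates the ground-state energy by a noisy binary search and then prepares the
state by repeated measurement of a spectral filter. Everything is built from one primitive: for
polynomials P, Q of degree d with |P|² + |Q|² = 1 on the unit circle, a circuit on one flag ancilla
sends |0⟩w to |0⟩P(U)w + |1⟩Q(U)w with d controlled queries (`exists_filter_circuit`). Since
arbitrary one-qubit gates are allowed, the circuit is found by peeling off one degree at a time
(`exists_layer`), with no parity or reality condition on P.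

Filters. The powers |D_M|^(2r) of the Dirichlet kernel, rotated by all N-th roots of unity, have a
constant sum because their degree is below N. Keeping only the rotations in an arc and normalizing
gives an approximate indicator S with values in [0, 1]. Fejér–Riesz, applied to κ + (1 - 2κ)S and to
its complement, yields P and Q (`exists_step_filter`). The degree is about Δ⁻¹ times logarithms of
Δ⁻¹ and γ⁻¹, and it does not involve ε.

Deciding on which side of a threshold the energy lies amounts to deciding whether the flag-0
amplitude of the filtered guess is at least of order γ or far below it. Tripling amplification turns
an amplitude sin θ into ± sin(3^i θ) (`actList_amplify`). As the amplitude is unknown, `schedule`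
tries all levels up to 3^r ≈ 1/γ, eight times over; the total cost is a geometric sum of order 1/γ.
A majority vote makes each decision reliable. Near the threshold either answer is acceptable because
the intervals of the search overlap (`probFrom_energySearch_le`).

Preparation. The search ends with a threshold inside the gap. A filter accurate to ε there would
bring an extra factor log(1/ε) in the degree, on top of the number of repetitions, while the gate
bound has room for a single factor log(1/(εϑ)). The filter is therefore kept at accuracy of order γ²
and measured many times, in a walk whose height goes up when P is observed and down when Q is
observed; at height 0 a fresh state is prepared. The potential 2^(-h)|⟨ψ₀, w⟩|² + 2^h‖w_⊥‖², summed
over branches, shrinks by 7/8 in every step, and on bad final states it dominates √ε‖w‖² at every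
height. So the failure probability is at most ε^(-1/2)(7/8)^T, and T of order log(1/(εϑ)) steps
suffice (`probFrom_filterWalk_le`).

Three ancillas are enough: one is the flag, and the other two serve the reflection about the
all-zero state. That reflection is a multiply controlled gate of linear size using only borrowed
qubits (`zeroReflection`). -/

noncomputable section

open Polynomial ComplexConjugate

/-! ### Polynomials on the unit circle -/

/-- The conjugate reciprocal `z ^ d * conj (P (1 / conj z))` of a polynomial of degree at most
`d`. -/
def conjReflect (d : ℕ) (P : ℂ[X]) : ℂ[X] := reflect d (P.map (starRingEnd ℂ))

lemma natDegree_conjReflect_le {d : ℕ} {P : ℂ[X]} (hP : P.natDegree ≤ d) :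
    (conjReflect d P).natDegree ≤ d :=
  (natDegree_reflect_le ..).trans (by simp [natDegree_map, hP])

lemma eval_conjReflect {d : ℕ} {P : ℂ[X]} (hP : P.natDegree ≤ d) {z : ℂ} (hz : z ≠ 0) :
    (conjReflect d P).eval z = z ^ d * conj (P.eval (conj z)⁻¹) := by
  have hz' : z⁻¹ ≠ 0 := inv_ne_zero hz
  let _ := invertibleOfNonzero hz'
  have h := eval₂_reflect_mul_pow (RingHom.id ℂ) z⁻¹ d (P.map (starRingEnd ℂ))
    (by simpa [natDegree_map] using hP)
  have h1 : (⅟(z⁻¹) : ℂ) = z := by simp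
  rw [h1] at h
  have h2 : (P.map (starRingEnd ℂ)).eval z⁻¹ = conj (P.eval (conj z)⁻¹) := by
    have := Polynomial.hom_eval₂ P (RingHom.id ℂ) (starRingEnd ℂ) (conj z)⁻¹
    rw [eval_map]
    simpa [eval₂_id] using this.symm
  rw [← eval₂_id] at h2
  have h3 : z⁻¹ ^ d * z ^ d = 1 := by rw [← mul_pow, inv_mul_cancel₀ hz, one_pow]
  rw [← h2, ← h, conjReflect, ← eval₂_id]
  linear_combination (-eval₂ (RingHom.id ℂ) z (reflect d (P.map (starRingEnd ℂ)))) * h3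

lemma conj_inv_of_norm_one {z : ℂ} (hz : ‖z‖ = 1) : (conj z)⁻¹ = z := by
  rw [Complex.inv_def, Complex.normSq_conj, Complex.normSq_eq_norm_sq, hz]; simp

lemma ne_zero_of_norm_one {z : ℂ} (hz : ‖z‖ = 1) : z ≠ 0 := by
  rintro rfl; simp at hz

lemma eval_conjReflect_circle {d : ℕ} {P : ℂ[X]} (hP : P.natDegree ≤ d) {z : ℂ} (hz : ‖z‖ = 1) :
    (conjReflect d P).eval z = z ^ d * conj (P.eval z) := by
  rw [eval_conjReflect hP (ne_zero_of_norm_one hz), conj_inv_of_norm_one hz]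

/-- On the circle the conjugate reciprocal is z^d times the conjugate, so |P|² becomes an honest
polynomial up to the factor z^d. Trigonometric polynomials are encoded this way throughout. -/
lemma eval_mul_conjReflect {d : ℕ} {P : ℂ[X]} (hP : P.natDegree ≤ d) {z : ℂ} (hz : ‖z‖ = 1) :
    (P * conjReflect d P).eval z = ((‖P.eval z‖ ^ 2 : ℝ) : ℂ) * z ^ d := by
  rw [eval_mul, eval_conjReflect_circle hP hz]
  push_cast
  rw [← Complex.mul_conj']
  ring

lemma conjReflect_coeff_zero (d : ℕ) (P : ℂ[X]) :
    (conjReflect d P).coeff 0 = conj (P.coeff d) := by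
  simp [conjReflect, coeff_reflect]

lemma infinite_circle : {z : ℂ | ‖z‖ = 1}.Infinite := by
  have h : IsPreconnected (Metric.sphere (0 : ℂ) 1) :=
    isPreconnected_sphere (by simp [Complex.rank_real_complex]) _ _
  have h2 : (Metric.sphere (0 : ℂ) 1).Nontrivial :=
    ⟨1, by simp, -1, by simp, by norm_num [Complex.ext_iff]⟩
  have := h.infinite_of_nontrivial h2
  convert this using 1
  ext; simp

lemma eq_of_eval_circle {P Q : ℂ[X]} (h : ∀ z : ℂ, ‖z‖ = 1 → P.eval z = Q.eval z) : P = Q :=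
  eq_of_infinite_eval_eq P Q (infinite_circle.mono fun z hz => h z hz)

/-- **Fejér–Riesz**: a strictly positive trigonometric polynomial is the squared modulus of a
polynomial. -/
theorem exists_normSq_eq_of_pos_on_circle (d : ℕ) : ∀ F : ℂ[X], F.natDegree ≤ 2 * d →
    (∀ z : ℂ, ‖z‖ = 1 → ∃ t : ℝ, 0 < t ∧ F.eval z = t * z ^ d) →
    ∃ Q : ℂ[X], Q.natDegree ≤ d ∧
      ∀ z : ℂ, ‖z‖ = 1 → F.eval z = ((‖Q.eval z‖ ^ 2 : ℝ) : ℂ) * z ^ d := by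
  induction d with
  | zero =>
    intro F hF h
    obtain ⟨t, ht, h1⟩ := h 1 (by simp)
    rw [eq_C_of_natDegree_le_zero (p := F) (by simpa using hF)] at h1 ⊢
    refine ⟨C ((Real.sqrt t : ℝ) : ℂ), by simp, fun z hz => ?_⟩
    simp only [eval_C] at h1 ⊢
    rw [h1, Complex.norm_real, Real.norm_eq_abs, sq_abs, Real.sq_sqrt ht.le]
    simp
  | succ d ih =>
    intro F hF h
    -- Being real after division by z^(d+1) is the same as being self-reciprocal, so nonzero roots
    -- come in pairs r, 1/conj r.
    have hself : conjReflect (2 * (d + 1)) F = F := by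
      apply eq_of_eval_circle
      intro z hz
      obtain ⟨t, ht, h1⟩ := h z hz
      rw [eval_conjReflect_circle hF hz, h1]
      simp only [map_mul, Complex.conj_ofReal, map_pow]
      have : z * conj z = 1 := by
        rw [Complex.mul_conj, Complex.normSq_eq_norm_sq, hz]; simp
      calc z ^ (2 * (d + 1)) * ((t : ℂ) * conj z ^ (d + 1))
          = t * z ^ (d + 1) * (z * conj z) ^ (d + 1) := by ring
        _ = _ := by rw [this]; simp
    -- A vanishing constant coefficient forces the top one to vanish too; then F / X satisfies the
    -- hypotheses for d. Otherwise 0 is not a root and the degree is exactly 2(d + 1).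
    by_cases h0 : F.coeff 0 = 0
    · have htop : F.coeff (2 * (d + 1)) = 0 := by
        rw [← hself, conjReflect_coeff_zero] at h0
        simpa using h0
      obtain ⟨G, rfl⟩ := X_dvd_iff.mpr h0
      have hG : G.natDegree ≤ 2 * d := by
        rw [natDegree_le_iff_coeff_eq_zero]
        intro N hN
        rcases Nat.lt_or_ge N (2 * d + 2) with h' | h'
        · have : N = 2 * d + 1 := by omega
          subst this
          rwa [show 2 * (d + 1) = (2 * d + 1) + 1 by ring, coeff_X_mul] at htop
        · rw [← coeff_X_mul]
          exact coeff_eq_zero_of_natDegree_lt (by omega)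
      obtain ⟨Q, hQ, hQ'⟩ := ih G hG (by
        intro z hz
        obtain ⟨t, ht, h1⟩ := h z hz
        refine ⟨t, ht, mul_left_cancel₀ (ne_zero_of_norm_one hz) ?_⟩
        rw [eval_mul, eval_X] at h1
        rw [h1]; ring)
      refine ⟨Q, by omega, fun z hz => ?_⟩
      rw [eval_mul, hQ' z hz, eval_X]; ring
    · have htop : F.coeff (2 * (d + 1)) ≠ 0 := by
        intro h'
        apply h0
        rw [← hself, conjReflect_coeff_zero, h', map_zero]
      have hdeg : F.natDegree = 2 * (d + 1) :=
        le_antisymm hF (le_natDegree_of_ne_zero htop)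
      obtain ⟨r, hr⟩ := Complex.exists_root (f := F)
        (natDegree_pos_iff_degree_pos.mp (by omega))
      have hr0 : r ≠ 0 := by
        rintro rfl
        exact h0 (by simpa [IsRoot, coeff_zero_eq_eval_zero] using hr)
      have hr1 : ‖r‖ ≠ 1 := by
        intro h'
        obtain ⟨t, ht, h1⟩ := h r h'
        rw [hr.eq_zero] at h1
        have := mul_ne_zero (Complex.ofReal_ne_zero.mpr ht.ne') (pow_ne_zero (d + 1) hr0)
        exact this h1.symm
      have hc0 : conj r ≠ 0 := by simpa using hr0
      set s : ℂ := (conj r)⁻¹ with hs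
      have hs0 : s ≠ 0 := inv_ne_zero hc0
      have hsr : F.IsRoot s := by
        have h1 := eval_conjReflect hF hs0
        rw [hself] at h1
        rw [IsRoot, h1]
        have : (conj s)⁻¹ = r := by simp [hs]
        rw [this, hr.eq_zero]; simp
      have hne : s ≠ r := by
        intro h'
        apply hr1
        have h2 : conj r * r = 1 := by
          calc conj r * r = conj r * s := by rw [h']
            _ = 1 := by rw [hs, mul_inv_cancel₀ hc0]
        have h3 : ‖r‖ * ‖r‖ = 1 := by
          have := congrArg norm h2
          simpa using this
        nlinarith [norm_nonneg r]
      obtain ⟨G, hG⟩ := dvd_iff_isRoot.mpr hr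
      have hGs : G.IsRoot s := by
        have h1 := hsr.eq_zero
        rw [hG, eval_mul, eval_sub, eval_X, eval_C] at h1
        exact (mul_eq_zero.mp h1).resolve_left (sub_ne_zero.mpr hne)
      obtain ⟨K, hK⟩ := dvd_iff_isRoot.mpr hGs
      have hF0 : F ≠ 0 := by rintro rfl; simp at h0
      have hK0 : K ≠ 0 := by rintro rfl; simp [hK] at hG; exact hF0 hG
      have hG0 : G ≠ 0 := by rintro rfl; simp at hG; exact hF0 hG
      have hKdeg : K.natDegree = 2 * d := by
        have h1 : F.natDegree = 1 + G.natDegree := by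
          rw [hG, natDegree_mul (X_sub_C_ne_zero r) hG0, natDegree_X_sub_C]
        have h2 : G.natDegree = 1 + K.natDegree := by
          rw [hK, natDegree_mul (X_sub_C_ne_zero s) hK0, natDegree_X_sub_C]
        omega
      -- For s = 1/conj r and |z| = 1, (z - r)(z - s) = -s z |z - r|². The pair of roots thus
      -- contributes a positive factor, and -s is absorbed into the quotient, which stays positive.
      have key : ∀ z : ℂ, ‖z‖ = 1 →
          F.eval z = z * ((‖z - r‖ ^ 2 : ℝ) : ℂ) * (C (-s) * K).eval z := by
        intro z hz
        have hzz : z * conj z = 1 := by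
          rw [Complex.mul_conj, Complex.normSq_eq_norm_sq, hz]; simp
        have hsc : s * conj r = 1 := by rw [hs]; field_simp
        rw [hG, hK]
        push_cast
        rw [← Complex.mul_conj']
        simp only [eval_mul, eval_sub, eval_X, eval_C, map_sub]
        linear_combination ((z - r) * eval z K * s) * hzz - (z - r) * z * eval z K * hsc
      obtain ⟨Q, hQ, hQ'⟩ := ih (C (-s) * K)
        ((natDegree_C_mul_le _ _).trans hKdeg.le) (by
          intro z hz
          obtain ⟨t, ht, h1⟩ := h z hz
          have hzr : 0 < ‖z - r‖ := norm_pos_iff.mpr (sub_ne_zero.mpr (by rintro rfl; exact hr1 hz))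
          refine ⟨t / ‖z - r‖ ^ 2, by positivity, ?_⟩
          rw [key z hz] at h1
          have hz0 := ne_zero_of_norm_one hz
          have hzr' : ((‖z - r‖ : ℝ) : ℂ) ≠ 0 := by exact_mod_cast hzr.ne'
          push_cast at h1 ⊢
          field_simp
          apply mul_left_cancel₀ hz0
          rw [pow_succ] at h1
          linear_combination h1)
      refine ⟨(X - C r) * Q, ?_, fun z hz => ?_⟩
      · refine natDegree_mul_le.trans ?_
        rw [natDegree_X_sub_C]; omega
      · rw [key z hz, hQ' z hz]
        simp only [eval_mul, eval_sub, eval_X, eval_C, norm_mul]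
        push_cast
        ring

/-- A pair of complementary polynomials realizing a damped version of a trigonometric polynomial
with values in `[0, 1]`. -/
lemma exists_complementary_polynomials {d : ℕ} {F : ℂ[X]} (hF : F.natDegree ≤ 2 * d) {S : ℂ → ℝ}
    (hFS : ∀ z : ℂ, ‖z‖ = 1 → F.eval z = S z * z ^ d)
    (hS : ∀ z : ℂ, ‖z‖ = 1 → 0 ≤ S z ∧ S z ≤ 1) {κ : ℝ} (hκ : 0 < κ) (hκ' : κ < 1 / 2) :
    ∃ P Q : ℂ[X], P.natDegree ≤ d ∧ Q.natDegree ≤ d ∧ ∀ z : ℂ, ‖z‖ = 1 →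
      ‖P.eval z‖ ^ 2 = κ + (1 - 2 * κ) * S z ∧ ‖P.eval z‖ ^ 2 + ‖Q.eval z‖ ^ 2 = 1 := by
  have hX : ((X : ℂ[X]) ^ d).natDegree ≤ 2 * d := by rw [natDegree_X_pow]; omega
  -- The affine map takes [0, 1] into [κ, 1 - κ]. Both it and its complement are then strictly
  -- positive, as Fejér–Riesz is available only in the strict case.
  have e1 : ∀ z : ℂ, ‖z‖ = 1 → (C (κ : ℂ) * X ^ d + C ((1 - 2 * κ : ℝ) : ℂ) * F).eval z
      = ((κ + (1 - 2 * κ) * S z : ℝ) : ℂ) * z ^ d := by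
    intro z hz
    simp only [eval_add, eval_mul, eval_C, eval_pow, eval_X, hFS z hz]
    push_cast; ring
  have e2 : ∀ z : ℂ, ‖z‖ = 1 → (C ((1 - κ : ℝ) : ℂ) * X ^ d - C ((1 - 2 * κ : ℝ) : ℂ) * F).eval z
      = ((1 - (κ + (1 - 2 * κ) * S z) : ℝ) : ℂ) * z ^ d := by
    intro z hz
    simp only [eval_sub, eval_mul, eval_C, eval_pow, eval_X, hFS z hz]
    push_cast; ring
  obtain ⟨P, hP, hP'⟩ := exists_normSq_eq_of_pos_on_circle d
    (C (κ : ℂ) * X ^ d + C ((1 - 2 * κ : ℝ) : ℂ) * F)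
    ((natDegree_add_le _ _).trans (max_le ((natDegree_C_mul_le _ _).trans hX)
      ((natDegree_C_mul_le _ _).trans hF)))
    (fun z hz => ⟨_, by
      have := hS z hz
      have : 0 ≤ (1 - 2 * κ) * S z := mul_nonneg (by linarith) this.1
      linarith, e1 z hz⟩)
  obtain ⟨Q, hQ, hQ'⟩ := exists_normSq_eq_of_pos_on_circle d
    (C ((1 - κ : ℝ) : ℂ) * X ^ d - C ((1 - 2 * κ : ℝ) : ℂ) * F)
    ((natDegree_sub_le _ _).trans (max_le ((natDegree_C_mul_le _ _).trans hX)
      ((natDegree_C_mul_le _ _).trans hF)))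
    (fun z hz => ⟨_, by
      have := hS z hz
      nlinarith, e2 z hz⟩)
  refine ⟨P, Q, hP, hQ, fun z hz => ?_⟩
  have hz0 : z ^ d ≠ 0 := pow_ne_zero _ (ne_zero_of_norm_one hz)
  have h1 : ‖P.eval z‖ ^ 2 = κ + (1 - 2 * κ) * S z := by
    have := mul_right_cancel₀ hz0 ((e1 z hz).symm.trans (hP' z hz))
    exact_mod_cast this.symm
  have h2 : ‖Q.eval z‖ ^ 2 = 1 - (κ + (1 - 2 * κ) * S z) := by
    have := mul_right_cancel₀ hz0 ((e2 z hz).symm.trans (hQ' z hz))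
    exact_mod_cast this.symm
  exact ⟨h1, by linarith⟩

/-! ### Rotated Dirichlet kernels and spectral step filters -/

lemma sum_pow_mul_conj_pow_of_isPrimitiveRoot {N : ℕ} {ω : ℂ} (hω : IsPrimitiveRoot ω N)
    (hN : ‖ω‖ = 1) {k l : ℕ} (hk : k < N) (hl : l < N) :
    ∑ j ∈ Finset.range N, (ω ^ j) ^ k * conj ((ω ^ j) ^ l) = if k = l then (N : ℂ) else 0 := by
  have hc : conj ω = ω⁻¹ := by
    rw [Complex.inv_def, Complex.normSq_eq_norm_sq, hN]; simp
  have hω0 := ne_zero_of_norm_one hN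
  have : ∀ j, (ω ^ j) ^ k * conj ((ω ^ j) ^ l) = (ω ^ k * (ω⁻¹) ^ l) ^ j := by
    intro j
    rw [map_pow, map_pow, hc, mul_pow, ← pow_mul, ← pow_mul, ← pow_mul, ← pow_mul, mul_comm j k,
      mul_comm j l]
  simp_rw [this]
  split_ifs with h
  · subst h
    simp [hω0]
  · have hne : ω ^ k * (ω⁻¹) ^ l ≠ 1 := by
      intro h'
      apply h
      refine hω.pow_inj hk hl ?_
      rw [inv_pow] at h'
      have := pow_ne_zero l hω0
      field_simp at h'
      exact h'
    -- Off the diagonal the sum is geometric, with ratio an N-th root of unity different from 1.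
    have h1 := geom_sum_mul (ω ^ k * (ω⁻¹) ^ l) N
    have h2 : (ω ^ k * (ω⁻¹) ^ l) ^ N = 1 := by
      rw [mul_pow, ← pow_mul, ← pow_mul, mul_comm k, mul_comm l, pow_mul, pow_mul, hω.pow_eq_one,
        inv_pow, hω.pow_eq_one]
      simp
    rw [h2, sub_self] at h1
    exact (mul_eq_zero.mp h1).resolve_right (sub_ne_zero.mpr hne)

/-- Sampling the squared modulus of a polynomial at sufficiently many rotated points gives a sum
that does not depend on the base point. -/
lemma sum_normSq_eval_rotate {p : ℂ[X]} {N : ℕ} (hp : p.natDegree < N) {ω : ℂ}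
    (hω : IsPrimitiveRoot ω N) (hN : ‖ω‖ = 1) {z : ℂ} (hz : ‖z‖ = 1) :
    ∑ j ∈ Finset.range N, ‖p.eval (ω ^ j * z)‖ ^ 2
      = N * ∑ k ∈ Finset.range N, ‖p.coeff k‖ ^ 2 := by
  have hzz : z * conj z = 1 := by
    rw [Complex.mul_conj, Complex.normSq_eq_norm_sq, hz]; simp
  apply Complex.ofReal_injective
  push_cast
  -- All exponents in the double expansion are below N, so orthogonality of the characters leaves
  -- only k = l, where z^k cancels against its conjugate.
  have h1 : ∀ j, ((‖p.eval (ω ^ j * z)‖ : ℝ) : ℂ) ^ 2 =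
      ∑ k ∈ Finset.range N, ∑ l ∈ Finset.range N, (p.coeff k * conj (p.coeff l) *
        (z ^ k * conj (z ^ l))) * ((ω ^ j) ^ k * conj ((ω ^ j) ^ l)) := by
    intro j
    rw [← Complex.mul_conj', eval_eq_sum_range' hp, map_sum, Finset.sum_mul_sum]
    refine Finset.sum_congr rfl fun k _ => Finset.sum_congr rfl fun l _ => ?_
    simp only [map_mul, map_pow, mul_pow]
    ring
  simp_rw [h1]
  rw [Finset.sum_comm, Finset.mul_sum]
  refine Finset.sum_congr rfl fun k hk => ?_
  rw [Finset.sum_comm]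
  rw [Finset.sum_eq_single k]
  · rw [← Finset.mul_sum, sum_pow_mul_conj_pow_of_isPrimitiveRoot hω hN (by simpa using hk)
      (by simpa using hk), if_pos rfl, ← Complex.mul_conj', map_pow, ← mul_pow, hzz]
    ring
  · intro l hl hlk
    rw [← Finset.mul_sum, sum_pow_mul_conj_pow_of_isPrimitiveRoot hω hN (by simpa using hk)
      (by simpa using hl), if_neg hlk.symm, mul_zero]
  · intro h; exact absurd hk h

/-- A power of the Dirichlet kernel, as a polynomial. -/
def dirichletPow (M r : ℕ) : ℂ[X] := (∑ i ∈ Finset.range M, X ^ i) ^ r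

lemma natDegree_dirichletPow_le (M r : ℕ) : (dirichletPow M r).natDegree ≤ r * (M - 1) := by
  refine natDegree_pow_le.trans (Nat.mul_le_mul_left _ ?_)
  refine natDegree_sum_le_of_forall_le _ _ fun i hi => ?_
  rw [natDegree_X_pow]
  have := Finset.mem_range.mp hi
  omega

lemma eval_dirichletPow_one (M r : ℕ) : (dirichletPow M r).eval 1 = (M : ℂ) ^ r := by
  simp [dirichletPow, eval_finsetSum]

/-- The geometric sum is (z^M - 1)/(z - 1), whose numerator has modulus at most 2. The bound does
not depend on M, while the peak at z = 1 is M^r. -/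
lemma norm_eval_dirichletPow_le {M r : ℕ} {δ : ℝ} (hδ : 0 < δ) {z : ℂ} (hz : ‖z‖ = 1)
    (h : δ ≤ ‖z - 1‖) : ‖(dirichletPow M r).eval z‖ ≤ (2 / δ) ^ r := by
  rw [dirichletPow, eval_pow, norm_pow]
  refine pow_le_pow_left₀ (norm_nonneg _) ?_ r
  rw [le_div_iff₀ hδ]
  have h1 := geom_sum_mul z M
  calc ‖eval z (∑ i ∈ Finset.range M, X ^ i)‖ * δ
      ≤ ‖eval z (∑ i ∈ Finset.range M, X ^ i)‖ * ‖z - 1‖ := by gcongr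
    _ = ‖z ^ M - 1‖ := by
      rw [← norm_mul, eval_finsetSum]
      simp only [eval_pow, eval_X, h1]
    _ ≤ ‖z ^ M‖ + ‖(1 : ℂ)‖ := norm_sub_le _ _
    _ = 2 := by rw [norm_pow, hz]; norm_num

/-- The chord is 2 sin(φ/2); Jordan's inequality sin t ≥ 2t/π is used from whichever end of the arc
is closer. -/
lemma le_norm_exp_sub_one {h φ : ℝ} (h0 : 0 ≤ h) (h1 : h ≤ φ) (h2 : φ ≤ 2 * Real.pi - h) :
    2 * h / Real.pi ≤ ‖Complex.exp (Complex.I * φ) - 1‖ := by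
  have hpi := Real.pi_pos
  rw [Complex.norm_exp_I_mul_ofReal_sub_one, Real.norm_eq_abs]
  have key : 2 / Real.pi * (h / 2) ≤ Real.sin (φ / 2) := by
    rcases le_total φ Real.pi with h' | h'
    · refine le_trans ?_ (Real.mul_le_sin (x := φ / 2) (by linarith) (by linarith))
      gcongr
    · rw [← Real.sin_pi_sub]
      refine le_trans ?_ (Real.mul_le_sin (x := Real.pi - φ / 2) (by linarith) (by linarith))
      gcongr
      linarith
  refine le_trans ?_ (le_abs_self _)
  calc 2 * h / Real.pi = 2 * (2 / Real.pi * (h / 2)) := by ring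
    _ ≤ _ := by linarith

lemma le_norm_exp_neg_sub_one {h φ : ℝ} (h0 : 0 ≤ h) (h1 : φ ≤ -h) (h2 : -(2 * Real.pi - h) ≤ φ) :
    2 * h / Real.pi ≤ ‖Complex.exp (Complex.I * φ) - 1‖ := by
  have := le_norm_exp_sub_one (φ := -φ) h0 (by linarith) (by linarith)
  rw [Complex.norm_exp_I_mul_ofReal_sub_one] at this ⊢
  rw [show -φ / 2 = -(φ / 2) by ring, Real.sin_neg] at this
  simpa using this

/-- The point `exp(-i λ)` of the unit circle. -/
def phasePoint (x : ℝ) : ℂ := Complex.exp (-Complex.I * x)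

lemma norm_phasePoint (x : ℝ) : ‖phasePoint x‖ = 1 := by
  rw [phasePoint, show -Complex.I * (x : ℂ) = ((-x : ℝ) : ℂ) * Complex.I by push_cast; ring,
    Complex.norm_exp_ofReal_mul_I]

/-- **Spectral step filters.** Complementary polynomials `P`, `Q` of degree
`r * (M - 1)` such that `P` is large on the phases below `μ - h` and small on those above
`μ + h`. -/
theorem exists_step_filter {h μ κ : ℝ} {M r : ℕ} (hh : 0 < h) (hh' : h ≤ Real.pi / 2)
    (hμ : 0 ≤ μ) (hκ : 0 < κ) (hκ' : κ < 1 / 2) (hr : 1 ≤ r) (hM : 2 * Real.pi ≤ h * M)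
    (hMr : (M : ℝ) ≤ κ * 2 ^ r) :
    ∃ P Q : ℂ[X], P.natDegree ≤ r * (M - 1) ∧ Q.natDegree ≤ r * (M - 1) ∧
      (∀ z : ℂ, ‖z‖ = 1 → ‖P.eval z‖ ^ 2 + ‖Q.eval z‖ ^ 2 = 1) ∧
      (∀ x : ℝ, 0 ≤ x → x ≤ μ - h → 1 - 2 * κ ≤ ‖P.eval (phasePoint x)‖ ^ 2) ∧
      (∀ x : ℝ, μ + h ≤ x → x ≤ Real.pi → ‖P.eval (phasePoint x)‖ ^ 2 ≤ 2 * κ) := by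
  have hpi := Real.pi_pos
  have hM0 : 1 ≤ M := by
    rcases Nat.eq_zero_or_pos M with h' | h'
    · subst h'; simp at hM; linarith
    · exact h'
  set d := r * (M - 1) with hd
  set N := d + 1 with hN
  set p := dirichletPow M r with hp
  have hpd : p.natDegree ≤ d := natDegree_dirichletPow_le M r
  set ω : ℂ := Complex.exp (2 * Real.pi * Complex.I / N) with hωdef
  have hω : IsPrimitiveRoot ω N := Complex.isPrimitiveRoot_exp N (by omega)
  have hωn : ‖ω‖ = 1 := hω.norm'_eq_one (by omega)
  -- The constant value of the full sum over rotations. The peak of a single kernel already gives A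
  -- ≥ M^(2r).
  set A : ℝ := N * ∑ k ∈ Finset.range N, ‖p.coeff k‖ ^ 2 with hA
  have hsum : ∀ z : ℂ, ‖z‖ = 1 → ∑ j ∈ Finset.range N, ‖p.eval (ω ^ j * z)‖ ^ 2 = A :=
    fun z hz => sum_normSq_eval_rotate (by omega) hω hωn hz
  have hAM : ((M : ℝ) ^ r) ^ 2 ≤ A := by
    rw [← hsum 1 (by simp)]
    have : ((M : ℝ) ^ r) ^ 2 = ‖p.eval (ω ^ 0 * 1)‖ ^ 2 := by
      rw [pow_zero, one_mul, hp, eval_dirichletPow_one]; simp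
    rw [this]
    exact Finset.single_le_sum (f := fun j => ‖p.eval (ω ^ j * 1)‖ ^ 2)
      (fun j _ => by positivity) (by simp [hN])
  have hMpos : (0 : ℝ) < M := by exact_mod_cast hM0
  have hA0 : 0 < A := lt_of_lt_of_le (by positivity) hAM
  set θ : ℕ → ℝ := fun j => 2 * Real.pi * j / N with hθ
  have hN0 : (0 : ℝ) < N := by rw [hN]; positivity
  -- Since `ω ^ j * phasePoint x` has angle θ j - x, the kernel with index j peaks at x = θ j. The
  -- arc below μ continues through 0 back to 3π/2. This cutoff is at distance at least π/2 ≥ h from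
  -- [0, π], so the arc has no second edge near the spectrum.
  set J := (Finset.range N).filter fun j => θ j ≤ μ ∨ 3 * Real.pi / 2 ≤ θ j with hJ
  set S : ℂ → ℝ := fun z => (∑ j ∈ J, ‖p.eval (ω ^ j * z)‖ ^ 2) / A with hS
  have hS1 : ∀ z : ℂ, ‖z‖ = 1 →
      1 - S z = (∑ j ∈ (Finset.range N).filter (fun j => ¬ (θ j ≤ μ ∨ 3 * Real.pi / 2 ≤ θ j)),
        ‖p.eval (ω ^ j * z)‖ ^ 2) / A := by
    intro z hz
    rw [eq_div_iff hA0.ne', sub_mul, one_mul, hS]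
    simp only
    rw [div_mul_cancel₀ _ hA0.ne', sub_eq_iff_eq_add', ← hsum z hz, hJ]
    exact (Finset.sum_filter_add_sum_filter_not _ _ _).symm
  -- the tail bound
  have htail : ∀ (x : ℝ) (I : Finset ℕ), I ⊆ Finset.range N →
      (∀ j ∈ I, 2 * h / Real.pi ≤ ‖Complex.exp (Complex.I * ((θ j - x : ℝ) : ℂ)) - 1‖) →
      (∑ j ∈ I, ‖p.eval (ω ^ j * phasePoint x)‖ ^ 2) / A ≤ κ := by
    intro x I hI hfar
    have hδ : 0 < 2 * h / Real.pi := by positivity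
    have hpt : ∀ j, ω ^ j * phasePoint x = Complex.exp (Complex.I * ((θ j - x : ℝ) : ℂ)) := by
      intro j
      rw [hωdef, phasePoint, ← Complex.exp_nat_mul, ← Complex.exp_add]
      congr 1
      simp only [hθ]
      push_cast
      ring
    have hb : ∀ j ∈ I, ‖p.eval (ω ^ j * phasePoint x)‖ ^ 2 ≤ (((M : ℝ) / 2) ^ r) ^ 2 := by
      intro j hj
      refine pow_le_pow_left₀ (norm_nonneg _) ?_ 2
      refine (norm_eval_dirichletPow_le hδ ?_ (by rw [hpt]; exact hfar j hj)).trans ?_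
      · rw [norm_mul, norm_pow, hωn, norm_phasePoint]; simp
      · refine pow_le_pow_left₀ (by positivity) ?_ r
        rw [div_le_div_iff₀ hδ (by norm_num)]
        have : 2 * 2 * Real.pi ≤ 2 * (h * M) := by linarith
        rw [mul_div_assoc', le_div_iff₀ hpi]
        linarith
    have hcard : ((Finset.card I : ℕ) : ℝ) ≤ M * 2 ^ r := by
      have h1 : I.card ≤ N := by simpa using Finset.card_le_card hI
      have h2 : N ≤ M * r := by
        rw [hN, hd]
        obtain ⟨M', rfl⟩ : ∃ M', M = M' + 1 := ⟨M - 1, by omega⟩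
        simp only [Nat.add_sub_cancel]
        nlinarith
      have h3 : r ≤ 2 ^ r := Nat.lt_two_pow_self.le
      calc (I.card : ℝ) ≤ (M * r : ℕ) := by exact_mod_cast h1.trans h2
        _ ≤ (M * 2 ^ r : ℕ) := by exact_mod_cast Nat.mul_le_mul_left M h3
        _ = _ := by push_cast; ring
    -- There are at most M 2^r far kernels, each at most (M/2)^(2r). With M ≤ κ 2^r the total is at
    -- most κ M^(2r) ≤ κ A.
    rw [div_le_iff₀ hA0]
    calc ∑ j ∈ I, ‖p.eval (ω ^ j * phasePoint x)‖ ^ 2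
        ≤ ∑ j ∈ I, (((M : ℝ) / 2) ^ r) ^ 2 := Finset.sum_le_sum hb
      _ = I.card * (((M : ℝ) / 2) ^ r) ^ 2 := by simp
      _ ≤ M * 2 ^ r * (((M : ℝ) / 2) ^ r) ^ 2 := by gcongr
      _ ≤ (κ * 2 ^ r) * 2 ^ r * (((M : ℝ) / 2) ^ r) ^ 2 := by gcongr
      _ = κ * ((M : ℝ) ^ r) ^ 2 := by rw [div_pow]; field_simp
      _ ≤ κ * A := by gcongr
  have hS01 : ∀ z : ℂ, ‖z‖ = 1 → 0 ≤ S z ∧ S z ≤ 1 := by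
    intro z hz
    refine ⟨by positivity, ?_⟩
    have : 0 ≤ 1 - S z := by rw [hS1 z hz]; positivity
    linarith
  -- the polynomial representing `S`
  have hcomp : ∀ j : ℕ, (p.comp (C (ω ^ j) * X)).natDegree ≤ d := by
    intro j
    refine natDegree_comp_le.trans ?_
    calc p.natDegree * (C (ω ^ j) * X).natDegree ≤ d * 1 :=
          Nat.mul_le_mul hpd ((natDegree_C_mul_le _ _).trans natDegree_X.le)
      _ = d := mul_one d
  set F : ℂ[X] := C ((A : ℂ)⁻¹) *
    ∑ j ∈ J, p.comp (C (ω ^ j) * X) * conjReflect d (p.comp (C (ω ^ j) * X)) with hF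
  have hFdeg : F.natDegree ≤ 2 * d := by
    refine (natDegree_C_mul_le _ _).trans (natDegree_sum_le_of_forall_le _ _ fun j _ => ?_)
    refine natDegree_mul_le.trans ?_
    have := hcomp j
    have := natDegree_conjReflect_le (hcomp j)
    omega
  have hFS : ∀ z : ℂ, ‖z‖ = 1 → F.eval z = S z * z ^ d := by
    intro z hz
    rw [hF, eval_mul, eval_C, eval_finsetSum, hS]
    simp_rw [eval_mul_conjReflect (hcomp _) hz]
    rw [← Finset.sum_mul]
    simp only [eval_comp, eval_mul, eval_C, eval_X]
    push_cast
    rw [div_eq_inv_mul]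
    ring
  obtain ⟨P, Q, hP, hQ, hPQ⟩ := exists_complementary_polynomials hFdeg hFS hS01 hκ hκ'
  have hθnn : ∀ j, 0 ≤ θ j := fun j => by simp only [hθ]; positivity
  have hθlt : ∀ j ∈ Finset.range N, θ j < 2 * Real.pi := by
    intro j hj
    have : (j : ℝ) < N := by exact_mod_cast Finset.mem_range.mp hj
    simp only [hθ]
    rw [div_lt_iff₀ hN0]
    gcongr
  refine ⟨P, Q, hP, hQ, fun z hz => (hPQ z hz).2, fun x hx0 hx1 => ?_, fun x hx0 hx1 => ?_⟩
  · rw [(hPQ _ (norm_phasePoint x)).1]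
    have h1 : 1 - S (phasePoint x) ≤ κ := by
      rw [hS1 _ (norm_phasePoint x)]
      refine htail x _ (Finset.filter_subset _ _) fun j hj => ?_
      have hj' := (Finset.mem_filter.mp hj).2
      push Not at hj'
      exact le_norm_exp_sub_one hh.le (by linarith [hj'.1]) (by linarith [hj'.2])
    nlinarith
  · rw [(hPQ _ (norm_phasePoint x)).1]
    have h1 : S (phasePoint x) ≤ κ := by
      refine htail x _ (Finset.filter_subset _ _) fun j hj => ?_
      obtain ⟨hjN, hj'⟩ := Finset.mem_filter.mp hj
      have h2 := hθnn j
      have h3 := hθlt j hjN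
      rcases hj' with hj' | hj'
      · exact le_norm_exp_neg_sub_one hh.le (by linarith) (by linarith)
      · exact le_norm_exp_sub_one hh.le (by linarith) (by linarith)
    have := (hS01 _ (norm_phasePoint x)).1
    nlinarith

/-! ### One layer of quantum signal processing -/

/-- The one-qubit gate with first column `(a, b)`. -/
def columnMatrix (a b : ℂ) : Matrix Bool Bool ℂ :=
  fun i j => if j then (if i then conj a else -conj b) else (if i then b else a)

lemma columnMatrix_mem_unitaryGroup {a b : ℂ} (h : a * conj a + b * conj b = 1) :
    columnMatrix a b ∈ Matrix.unitaryGroup Bool ℂ := by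
  rw [Matrix.mem_unitaryGroup_iff']
  ext i j
  rw [Matrix.mul_apply]
  simp only [Fintype.sum_bool, Matrix.star_apply, columnMatrix, Matrix.one_apply]
  cases i <;> cases j <;> simp <;> first | linear_combination h | ring

/-- Take (a, b) along (p0, q0). The rotation adapted to (a, b) kills the second component of (p0,
q0), and by orthogonality also the first component of (p1, q1). If (p0, q0) vanishes, any unit
vector orthogonal to (p1, q1) does. -/
lemma exists_unit_vector {p0 q0 p1 q1 : ℂ} (h : p0 * conj p1 + q0 * conj q1 = 0) :
    ∃ a b : ℂ, a * conj a + b * conj b = 1 ∧ conj a * p1 + conj b * q1 = 0 ∧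
      -b * p0 + a * q0 = 0 := by
  have aux : ∀ x y : ℂ, (x ≠ 0 ∨ y ≠ 0) → ∃ s : ℝ, (s * x) * conj (s * x) +
      (s * y) * conj (s * y) = 1 := by
    intro x y hxy
    have hpos : 0 < ‖x‖ ^ 2 + ‖y‖ ^ 2 := by
      rcases hxy with h' | h'
      · have := norm_pos_iff.mpr h'; positivity
      · have := norm_pos_iff.mpr h'; positivity
    refine ⟨(Real.sqrt (‖x‖ ^ 2 + ‖y‖ ^ 2))⁻¹, ?_⟩
    rw [Complex.mul_conj', Complex.mul_conj', norm_mul, norm_mul, Complex.norm_real]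
    norm_cast
    rw [mul_pow, mul_pow, ← mul_add, Real.norm_eq_abs, sq_abs, inv_pow, Real.sq_sqrt hpos.le,
      inv_mul_cancel₀ hpos.ne']
  by_cases h0 : p0 ≠ 0 ∨ q0 ≠ 0
  · obtain ⟨s, hs⟩ := aux p0 q0 h0
    refine ⟨s * p0, s * q0, hs, ?_, by ring⟩
    have := congrArg conj h
    simp only [map_add, map_mul, Complex.conj_conj, map_zero, Complex.conj_ofReal] at this ⊢
    linear_combination (s : ℂ) * this
  · push Not at h0
    by_cases h1 : -conj q1 ≠ 0 ∨ conj p1 ≠ 0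
    · obtain ⟨s, hs⟩ := aux _ _ h1
      refine ⟨s * (-conj q1), s * conj p1, hs, ?_, by rw [h0.1, h0.2]; ring⟩
      simp only [map_mul, map_neg, Complex.conj_conj, Complex.conj_ofReal]
      ring
    · push Not at h1
      refine ⟨1, 0, by simp, ?_, by rw [h0.1, h0.2]; ring⟩
      have : p1 = 0 := by simpa using h1.2
      simp [this]

lemma norm_sq_add_norm_sq_eq {a b x y : ℂ} (h : a * conj a + b * conj b = 1) :
    ‖conj a * x + conj b * y‖ ^ 2 + ‖-b * x + a * y‖ ^ 2 = ‖x‖ ^ 2 + ‖y‖ ^ 2 := by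
  apply Complex.ofReal_injective
  push_cast
  rw [← Complex.mul_conj', ← Complex.mul_conj', ← Complex.mul_conj', ← Complex.mul_conj']
  simp only [map_add, map_mul, map_neg, Complex.conj_conj]
  linear_combination (x * conj x + y * conj y) * h

/-- Peeling off one layer of a pair of complementary polynomials. -/
lemma exists_layer {d : ℕ} {P Q : ℂ[X]} (hP : P.natDegree ≤ d + 1) (hQ : Q.natDegree ≤ d + 1)
    (hPQ : ∀ z : ℂ, ‖z‖ = 1 → ‖P.eval z‖ ^ 2 + ‖Q.eval z‖ ^ 2 = 1) :
    ∃ (g : Matrix.unitaryGroup Bool ℂ) (P' Q' : ℂ[X]), P'.natDegree ≤ d ∧ Q'.natDegree ≤ d ∧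
      (∀ z : ℂ, ‖z‖ = 1 → ‖P'.eval z‖ ^ 2 + ‖Q'.eval z‖ ^ 2 = 1) ∧
      P = C (g.1 false false) * P' + C (g.1 false true) * (X * Q') ∧
      Q = C (g.1 true false) * P' + C (g.1 true true) * (X * Q') := by
  -- Complementarity on the circle as a polynomial identity. Its constant coefficient says that the
  -- vectors of lowest and highest coefficients of (P, Q) are orthogonal.
  have hid : P * conjReflect (d + 1) P + Q * conjReflect (d + 1) Q = X ^ (d + 1) := by
    apply eq_of_eval_circle
    intro z hz
    rw [eval_add, eval_mul_conjReflect hP hz, eval_mul_conjReflect hQ hz, ← add_mul]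
    norm_cast
    rw [hPQ z hz]; simp
  have horth : P.coeff 0 * conj (P.coeff (d + 1)) + Q.coeff 0 * conj (Q.coeff (d + 1)) = 0 := by
    have := congrArg (fun R => coeff R 0) hid
    simpa [mul_coeff_zero, conjReflect_coeff_zero] using this
  -- One rotation removes the top coefficient from the first component and makes the second
  -- divisible by X; division by X then lowers both degrees to d.
  obtain ⟨a, b, hab, h1, h0⟩ := exists_unit_vector horth
  have hlow : (C (-b) * P + C a * Q).coeff 0 = 0 := by simpa using h0
  obtain ⟨Q', hQ'⟩ := X_dvd_iff.mpr hlow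
  have hdeg : ∀ {u v : ℂ}, (C u * P + C v * Q).natDegree ≤ d + 1 := fun {u v} =>
    (natDegree_add_le _ _).trans (max_le ((natDegree_C_mul_le _ _).trans hP)
      ((natDegree_C_mul_le _ _).trans hQ))
  refine ⟨⟨columnMatrix a b, columnMatrix_mem_unitaryGroup hab⟩,
    C (conj a) * P + C (conj b) * Q, Q', ?_, ?_, fun z hz => ?_, ?_, ?_⟩
  · rw [natDegree_le_iff_coeff_eq_zero]
    intro k hk
    rcases Nat.lt_or_ge (d + 1) k with h' | h'
    · exact coeff_eq_zero_of_natDegree_lt (hdeg.trans_lt h')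
    · have : k = d + 1 := by omega
      subst this
      simpa using h1
  · rw [natDegree_le_iff_coeff_eq_zero]
    intro k hk
    rw [← coeff_X_mul, ← hQ']
    exact coeff_eq_zero_of_natDegree_lt (hdeg.trans_lt (by omega))
  · have h2 : ‖Q'.eval z‖ = ‖(C (-b) * P + C a * Q).eval z‖ := by
      rw [hQ', eval_mul, norm_mul, eval_X, hz, one_mul]
    rw [h2, ← hPQ z hz]
    simp only [eval_add, eval_mul, eval_C]
    exact norm_sq_add_norm_sq_eq hab
  · rw [← hQ']
    have : C a * C (conj a) + C b * C (conj b) = (1 : ℂ[X]) := by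
      rw [← C_mul, ← C_mul, ← C_add, hab, C_1]
    simp only [columnMatrix, Bool.false_eq_true, if_false, if_true, C_neg]
    linear_combination (-P) * this
  · rw [← hQ']
    have : C a * C (conj a) + C b * C (conj b) = (1 : ℂ[X]) := by
      rw [← C_mul, ← C_mul, ← C_add, hab, C_1]
    simp only [columnMatrix, Bool.false_eq_true, if_false, if_true, C_neg]
    linear_combination (-Q) * this

lemma exists_base_gate {P Q : ℂ[X]} (hP : P.natDegree ≤ 0) (hQ : Q.natDegree ≤ 0)
    (hPQ : ∀ z : ℂ, ‖z‖ = 1 → ‖P.eval z‖ ^ 2 + ‖Q.eval z‖ ^ 2 = 1) :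
    ∃ g : Matrix.unitaryGroup Bool ℂ, P = C (g.1 false false) ∧ Q = C (g.1 true false) := by
  have h := hPQ 1 (by simp)
  rw [eq_C_of_natDegree_le_zero hP, eq_C_of_natDegree_le_zero hQ, eval_C, eval_C] at h
  refine ⟨⟨columnMatrix (P.coeff 0) (Q.coeff 0), columnMatrix_mem_unitaryGroup ?_⟩, ?_, ?_⟩
  · rw [Complex.mul_conj', Complex.mul_conj']
    exact_mod_cast h
  · simpa [columnMatrix] using eq_C_of_natDegree_le_zero hP
  · simpa [columnMatrix] using eq_C_of_natDegree_le_zero hQ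

/-! ### Matrices acting on vectors -/

section ApplyMat

variable {ι : Type*} [Fintype ι]

lemma applyMat_apply (A : Matrix ι ι ℂ) (v : EuclideanSpace ℂ ι) (x : ι) :
    applyMat A v x = ∑ y, A x y * v y := rfl

lemma applyMat_sub (A : Matrix ι ι ℂ) (v w : EuclideanSpace ℂ ι) :
    applyMat A (v - w) = applyMat A v - applyMat A w := by
  ext x; simp [applyMat, Matrix.mulVec_sub]

lemma applyMat_smul (A : Matrix ι ι ℂ) (c : ℂ) (v : EuclideanSpace ℂ ι) :
    applyMat A (c • v) = c • applyMat A v := by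
  ext x; simp [applyMat, Matrix.mulVec_smul]

lemma applyMat_zero (A : Matrix ι ι ℂ) : applyMat A 0 = 0 := by
  ext x; simp [applyMat]

lemma add_applyMat (A B : Matrix ι ι ℂ) (v : EuclideanSpace ℂ ι) :
    applyMat (A + B) v = applyMat A v + applyMat B v := by
  ext x; simp [applyMat, Matrix.add_mulVec]

lemma smul_applyMat (c : ℂ) (A : Matrix ι ι ℂ) (v : EuclideanSpace ℂ ι) :
    applyMat (c • A) v = c • applyMat A v := by
  ext x; simp [applyMat, Matrix.smul_mulVec]

lemma mul_applyMat (A B : Matrix ι ι ℂ) (v : EuclideanSpace ℂ ι) :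
    applyMat (A * B) v = applyMat A (applyMat B v) := by
  ext x; simp [applyMat, Matrix.mulVec_mulVec]

lemma one_applyMat [DecidableEq ι] (v : EuclideanSpace ℂ ι) :
    applyMat (1 : Matrix ι ι ℂ) v = v := by
  ext x; simp [applyMat]

lemma inner_applyMat_left (A : Matrix ι ι ℂ) (v w : EuclideanSpace ℂ ι) :
    inner ℂ (applyMat A v) w = inner ℂ v (applyMat A.conjTranspose w) := by
  simp only [EuclideanSpace.inner_eq_star_dotProduct, applyMat]
  rw [Matrix.star_mulVec, dotProduct_comm, ← Matrix.dotProduct_mulVec, dotProduct_comm]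

lemma inner_applyMat_unitary [DecidableEq ι] {A : Matrix ι ι ℂ} (hA : A ∈ Matrix.unitaryGroup ι ℂ)
    (v w : EuclideanSpace ℂ ι) : inner ℂ (applyMat A v) (applyMat A w) = inner ℂ v w := by
  rw [inner_applyMat_left, ← mul_applyMat, ← Matrix.star_eq_conjTranspose,
    Matrix.mem_unitaryGroup_iff'.mp hA, one_applyMat]

lemma norm_applyMat_unitary [DecidableEq ι] {A : Matrix ι ι ℂ} (hA : A ∈ Matrix.unitaryGroup ι ℂ)
    (v : EuclideanSpace ℂ ι) : ‖applyMat A v‖ = ‖v‖ := by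
  rw [@norm_eq_sqrt_re_inner ℂ, @norm_eq_sqrt_re_inner ℂ, inner_applyMat_unitary hA]

end ApplyMat

/-! ### Functions of the time evolution -/

section Spectral

variable {n : ℕ} {H : Matrix (SysBasis n) (SysBasis n) ℂ}

lemma star_eigenvectorUnitary_mul (hH : H.IsHermitian) :
    star (hH.eigenvectorUnitary : Matrix (SysBasis n) (SysBasis n) ℂ) * H =
      Matrix.diagonal (fun j => (hH.eigenvalues j : ℂ)) *
        star (hH.eigenvectorUnitary : Matrix (SysBasis n) (SysBasis n) ℂ) := by
  refine (congrArg (fun A => star hH.eigenvectorUnitary.1 * A) hH.spectral_theorem).trans ?_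
  rw [Unitary.conjStarAlgAut_apply, ← mul_assoc, ← mul_assoc, Unitary.coe_star_mul_self, one_mul]
  rfl

lemma star_eigenvectorUnitary_mul_evolution (hH : H.IsHermitian) :
    star (hH.eigenvectorUnitary : Matrix (SysBasis n) (SysBasis n) ℂ) * evolution H =
      Matrix.diagonal (fun j => phasePoint (hH.eigenvalues j)) *
        star (hH.eigenvectorUnitary : Matrix (SysBasis n) (SysBasis n) ℂ) := by
  set V : Matrix (SysBasis n) (SysBasis n) ℂ := hH.eigenvectorUnitary.1 with hV
  have hVV : star V * V = 1 := Unitary.coe_star_mul_self _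
  have hinv : V⁻¹ = star V := Matrix.inv_eq_left_inv hVV
  have hunit : IsUnit V := by
    rw [Matrix.isUnit_iff_isUnit_det]
    exact Matrix.isUnit_det_of_left_inverse hVV
  have h1 : -Complex.I • H =
      V * Matrix.diagonal (fun j => -Complex.I * (hH.eigenvalues j : ℂ)) * V⁻¹ := by
    refine (congrArg (fun A => -Complex.I • A) hH.spectral_theorem).trans ?_
    rw [Unitary.conjStarAlgAut_apply, hinv, ← Matrix.smul_mul, ← Matrix.mul_smul,
      ← Matrix.diagonal_smul]
    rfl
  have h2 : NormedSpace.exp (fun j => -Complex.I * (hH.eigenvalues j : ℂ)) =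
      fun j => phasePoint (hH.eigenvalues j) := by
    ext j
    rw [Pi.coe_exp, phasePoint, Complex.exp_eq_exp_ℂ]
  rw [evolution, h1, Matrix.exp_conj _ _ hunit, Matrix.exp_diagonal, h2, hinv, ← mul_assoc,
    ← mul_assoc, hVV, one_mul]

lemma inner_eigenvectorBasis (hH : H.IsHermitian) (j : SysBasis n) (w : SysState n) :
    inner ℂ (hH.eigenvectorBasis j) w =
      applyMat (star (hH.eigenvectorUnitary : Matrix (SysBasis n) (SysBasis n) ℂ)) w j := by
  rw [applyMat_apply, PiLp.inner_apply]
  refine Finset.sum_congr rfl fun y _ => ?_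
  rw [Matrix.star_apply, Matrix.IsHermitian.eigenvectorUnitary_apply]
  simp [mul_comm]

lemma inner_eigenvectorBasis_applyMat (hH : H.IsHermitian) (j : SysBasis n) (w : SysState n) :
    inner ℂ (hH.eigenvectorBasis j) (applyMat H w) =
      hH.eigenvalues j * inner ℂ (hH.eigenvectorBasis j) w := by
  rw [inner_eigenvectorBasis, inner_eigenvectorBasis, ← mul_applyMat, star_eigenvectorUnitary_mul,
    mul_applyMat, applyMat_apply]
  simp [Matrix.diagonal_apply]

lemma inner_eigenvectorBasis_evolution (hH : H.IsHermitian) (j : SysBasis n) (w : SysState n) :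
    inner ℂ (hH.eigenvectorBasis j) (applyMat (evolution H) w) =
      phasePoint (hH.eigenvalues j) * inner ℂ (hH.eigenvectorBasis j) w := by
  rw [inner_eigenvectorBasis, inner_eigenvectorBasis, ← mul_applyMat,
    star_eigenvectorUnitary_mul_evolution, mul_applyMat, applyMat_apply]
  simp [Matrix.diagonal_apply]

lemma inner_eigenvectorBasis_aeval (hH : H.IsHermitian) (j : SysBasis n) (P : ℂ[X])
    (w : SysState n) :
    inner ℂ (hH.eigenvectorBasis j) (applyMat (aeval (evolution H) P) w) =
      P.eval (phasePoint (hH.eigenvalues j)) * inner ℂ (hH.eigenvectorBasis j) w := by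
  induction P using Polynomial.induction_on' with
  | add p q hp hq => rw [map_add, add_applyMat, inner_add_right, hp, hq, eval_add, add_mul]
  | monomial k a =>
    rw [← C_mul_X_pow_eq_monomial, map_mul, aeval_C, map_pow, aeval_X, Algebra.algebraMap_eq_smul_one,
      smul_mul_assoc, one_mul, smul_applyMat, inner_smul_right, eval_mul, eval_C, eval_pow, eval_X,
      mul_assoc]
    congr 1
    induction k with
    | zero => rw [pow_zero, pow_zero, one_applyMat, one_mul]
    | succ k ih =>
      rw [pow_succ', mul_applyMat, inner_eigenvectorBasis_evolution, ih, pow_succ']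
      ring

lemma ext_inner_eigenvectorBasis (hH : H.IsHermitian) {v w : SysState n}
    (h : ∀ j, inner ℂ (hH.eigenvectorBasis j) v = inner ℂ (hH.eigenvectorBasis j) w) : v = w := by
  apply hH.eigenvectorBasis.repr.injective
  ext j
  rw [OrthonormalBasis.repr_apply_apply, OrthonormalBasis.repr_apply_apply, h]

lemma norm_sq_eq_sum_inner_eigenvectorBasis (hH : H.IsHermitian) (v : SysState n) :
    ‖v‖ ^ 2 = ∑ j, ‖inner ℂ (hH.eigenvectorBasis j) v‖ ^ 2 :=
  (hH.eigenvectorBasis.sum_sq_norm_inner_right v).symm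

lemma evolution_mem_unitaryGroup (hH : H.IsHermitian) :
    evolution H ∈ Matrix.unitaryGroup (SysBasis n) ℂ := by
  rw [Matrix.mem_unitaryGroup_iff', evolution, Matrix.star_eq_conjTranspose,
    ← Matrix.exp_conjTranspose, ← Matrix.exp_add_of_commute]
  · rw [Matrix.conjTranspose_smul, hH.eq]
    simp
  · rw [Matrix.conjTranspose_smul, hH.eq]
    exact ((Commute.refl H).smul_left _).smul_right _

/-- The component of `w` orthogonal to the unit vector `ψ`. -/
def orthPart (ψ w : SysState n) : SysState n := w - inner ℂ ψ w • ψ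

lemma norm_sq_eq_inner_add_orthPart {ψ : SysState n} (hψ : ‖ψ‖ = 1) (w : SysState n) :
    ‖w‖ ^ 2 = ‖inner ℂ ψ w‖ ^ 2 + ‖orthPart ψ w‖ ^ 2 := by
  have h : inner ℂ (inner ℂ ψ w • ψ) (orthPart ψ w) = 0 := by
    rw [orthPart, inner_smul_left, inner_sub_right, inner_smul_right,
      inner_self_eq_norm_sq_to_K, hψ]
    simp
  have h2 := norm_add_sq_eq_norm_sq_add_norm_sq_of_inner_eq_zero _ _ h
  have h3 : inner ℂ ψ w • ψ + orthPart ψ w = w := by rw [orthPart]; abel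
  rw [h3, norm_smul, hψ, mul_one] at h2
  nlinarith [h2]

/-! ### Spectral consequences of the ground-state hypotheses -/

variable {η γ Δ E₀ : ℝ} {ψ₀ : SysState n} {UI : Matrix (SysBasis n) (SysBasis n) ℂ}

namespace IsGroundStateInstance

lemma inner_basis_ground_eq_zero (hI : IsGroundStateInstance η γ Δ H E₀ ψ₀ UI) {j : SysBasis n}
    (hj : hI.hermitian.eigenvalues j ≠ E₀) :
    inner ℂ (hI.hermitian.eigenvectorBasis j) ψ₀ = 0 := by
  have h := inner_eigenvectorBasis_applyMat hI.hermitian j ψ₀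
  rw [hI.ground.eigen, inner_smul_right] at h
  by_contra h0
  exact hj (by exact_mod_cast (mul_right_cancel₀ h0 h).symm)

/-- By nondegeneracy such a basis vector is a multiple of ψ₀. Hence the orthogonal part has
components only on eigenvalues at least E₀ + Δ. -/
lemma inner_basis_orthPart_eq_zero (hI : IsGroundStateInstance η γ Δ H E₀ ψ₀ UI) {j : SysBasis n}
    (hj : hI.hermitian.eigenvalues j = E₀) (w : SysState n) :
    inner ℂ (hI.hermitian.eigenvectorBasis j) (orthPart ψ₀ w) = 0 := by
  obtain ⟨c, hc⟩ := hI.ground.nondegenerate (hI.hermitian.eigenvectorBasis j) (by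
    have := hI.hermitian.mulVec_eigenvectorBasis j
    ext x
    rw [applyMat, this, hj]
    simp)
  rw [hc, inner_smul_left, orthPart, inner_sub_right, inner_smul_right,
    inner_self_eq_norm_sq_to_K, hI.ground.norm_eq]
  simp

lemma aeval_ground (hI : IsGroundStateInstance η γ Δ H E₀ ψ₀ UI) (P : ℂ[X]) :
    applyMat (aeval (evolution H) P) ψ₀ = P.eval (phasePoint E₀) • ψ₀ := by
  refine ext_inner_eigenvectorBasis hI.hermitian fun j => ?_
  rw [inner_eigenvectorBasis_aeval, inner_smul_right]
  by_cases hj : hI.hermitian.eigenvalues j = E₀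
  · rw [hj]
  · rw [hI.inner_basis_ground_eq_zero hj]; simp

lemma inner_ground_aeval (hI : IsGroundStateInstance η γ Δ H E₀ ψ₀ UI) (P : ℂ[X])
    (w : SysState n) :
    inner ℂ ψ₀ (applyMat (aeval (evolution H) P) w) =
      P.eval (phasePoint E₀) * inner ℂ ψ₀ w := by
  have key : ∀ v : SysState n, inner ℂ ψ₀ v = ∑ j, inner ℂ ψ₀ (hI.hermitian.eigenvectorBasis j) *
      inner ℂ (hI.hermitian.eigenvectorBasis j) v := fun v =>
    (hI.hermitian.eigenvectorBasis.sum_inner_mul_inner ψ₀ v).symm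
  rw [key, key w, Finset.mul_sum]
  refine Finset.sum_congr rfl fun j _ => ?_
  rw [inner_eigenvectorBasis_aeval]
  by_cases hj : hI.hermitian.eigenvalues j = E₀
  · rw [hj]; ring
  · rw [← inner_conj_symm, hI.inner_basis_ground_eq_zero hj]; simp

/-- A function of the evolution has ψ₀ as both a right and a left eigenvector, so it commutes with
the projection away from ψ₀. Ground and excited components can therefore be followed separately. -/
lemma orthPart_aeval (hI : IsGroundStateInstance η γ Δ H E₀ ψ₀ UI) (P : ℂ[X]) (w : SysState n) :
    orthPart ψ₀ (applyMat (aeval (evolution H) P) w) =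
      applyMat (aeval (evolution H) P) (orthPart ψ₀ w) := by
  rw [orthPart, orthPart, applyMat_sub, applyMat_smul, hI.aeval_ground, hI.inner_ground_aeval,
    smul_smul, mul_comm]

lemma eigenvalue_le_pi (hI : IsGroundStateInstance η γ Δ H E₀ ψ₀ UI) (hη : 0 < η)
    (j : SysBasis n) : hI.hermitian.eigenvalues j ≤ Real.pi := by
  have := (hI.spectrum_subset (hI.hermitian.eigenvalues_mem_spectrum_real j)).2
  linarith

/-- If E₀ were not an eigenvalue in the eigenbasis list, ψ₀ would be orthogonal to the whole
eigenbasis. -/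
lemma energy_mem (hI : IsGroundStateInstance η γ Δ H E₀ ψ₀ UI) (hη : 0 < η) :
    0 ≤ E₀ ∧ E₀ ≤ Real.pi := by
  have : ∃ j, hI.hermitian.eigenvalues j = E₀ := by
    by_contra! h
    have : ψ₀ = 0 := ext_inner_eigenvectorBasis hI.hermitian fun j => by
      rw [hI.inner_basis_ground_eq_zero (h j), inner_zero_right]
    have h1 := hI.ground.norm_eq
    simp [this] at h1
  obtain ⟨j, hj⟩ := this
  have := hI.spectrum_subset (hI.hermitian.eigenvalues_mem_spectrum_real j)
  rw [hj] at this
  exact ⟨by linarith [this.1], by linarith [this.2]⟩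

/-- A function of the time evolution that is small above the spectral gap is small on the
orthogonal complement of the ground state. -/
lemma norm_orthPart_aeval_le (hI : IsGroundStateInstance η γ Δ H E₀ ψ₀ UI) (hη : 0 < η)
    {P : ℂ[X]} {κ : ℝ}
    (hP : ∀ x : ℝ, E₀ + Δ ≤ x → x ≤ Real.pi → ‖P.eval (phasePoint x)‖ ^ 2 ≤ κ) (w : SysState n) :
    ‖orthPart ψ₀ (applyMat (aeval (evolution H) P) w)‖ ^ 2 ≤ κ * ‖orthPart ψ₀ w‖ ^ 2 := by
  rw [hI.orthPart_aeval, norm_sq_eq_sum_inner_eigenvectorBasis hI.hermitian,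
    norm_sq_eq_sum_inner_eigenvectorBasis hI.hermitian, Finset.mul_sum]
  refine Finset.sum_le_sum fun j _ => ?_
  rw [inner_eigenvectorBasis_aeval, norm_mul, mul_pow]
  by_cases hj : hI.hermitian.eigenvalues j = E₀
  · rw [hI.inner_basis_orthPart_eq_zero hj]; simp
  · gcongr
    exact hP _ (hI.ground.gap _ (hI.hermitian.eigenvalues_mem_spectrum_real j) hj)
      (hI.eigenvalue_le_pi hη j)

lemma norm_aeval_sq (hI : IsGroundStateInstance η γ Δ H E₀ ψ₀ UI) (P : ℂ[X]) (w : SysState n) :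
    ‖applyMat (aeval (evolution H) P) w‖ ^ 2 =
      ‖P.eval (phasePoint E₀)‖ ^ 2 * ‖inner ℂ ψ₀ w‖ ^ 2 +
        ‖orthPart ψ₀ (applyMat (aeval (evolution H) P) w)‖ ^ 2 := by
  rw [norm_sq_eq_inner_add_orthPart hI.ground.norm_eq, hI.inner_ground_aeval, norm_mul, mul_pow]

/-- Complementary functions of the time evolution split the squared norm of every vector. -/
lemma norm_aeval_add_norm_aeval (hI : IsGroundStateInstance η γ Δ H E₀ ψ₀ UI) {P Q : ℂ[X]}
    (hPQ : ∀ z : ℂ, ‖z‖ = 1 → ‖P.eval z‖ ^ 2 + ‖Q.eval z‖ ^ 2 = 1) (w : SysState n) :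
    ‖applyMat (aeval (evolution H) P) w‖ ^ 2 + ‖applyMat (aeval (evolution H) Q) w‖ ^ 2 =
      ‖w‖ ^ 2 := by
  simp only [norm_sq_eq_sum_inner_eigenvectorBasis hI.hermitian]
  rw [← Finset.sum_add_distrib]
  refine Finset.sum_congr rfl fun j _ => ?_
  rw [inner_eigenvectorBasis_aeval, inner_eigenvectorBasis_aeval, norm_mul, norm_mul, mul_pow,
    mul_pow, ← add_mul, hPQ _ (norm_phasePoint _), one_mul]

end IsGroundStateInstance

end Spectral

/-! ### Action of elementary operations -/

section Lifts

variable {n m : ℕ}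

lemma applyMat_liftOne_apply (q : Qubit n m) (g : Matrix Bool Bool ℂ) (v : RegState n m)
    (x : RegBasis n m) :
    applyMat (liftOne q g) v x = ∑ b, g (x q) b * v (Function.update x q b) := by
  rw [applyMat_apply]
  symm
  refine Fintype.sum_of_injective (fun b => Function.update x q b)
    (Function.update_injective x q) _ _ (fun y hy => ?_) (fun b => ?_)
  · rw [liftOne, if_neg, zero_mul]
    intro h
    apply hy
    refine ⟨y q, funext fun r => ?_⟩
    by_cases hr : r = q
    · subst hr; simp
    · simp [hr, h r hr]
  · rw [liftOne, if_pos]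
    · simp
    · intro r hr; simp [hr]

lemma applyMat_liftTwo_apply {p q : Qubit n m} (hpq : p ≠ q)
    (g : Matrix (Bool × Bool) (Bool × Bool) ℂ) (v : RegState n m) (x : RegBasis n m) :
    applyMat (liftTwo p q g) v x =
      ∑ b, g (x p, x q) b * v (Function.update (Function.update x p b.1) q b.2) := by
  rw [applyMat_apply]
  symm
  refine Fintype.sum_of_injective
    (fun b : Bool × Bool => Function.update (Function.update x p b.1) q b.2) ?_ _ _
    (fun y hy => ?_) (fun b => ?_)
  · intro b c h
    have h1 := congrFun h p
    have h2 := congrFun h q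
    simp [hpq] at h1 h2
    exact Prod.ext h1 h2
  · rw [liftTwo, if_neg, zero_mul]
    intro h
    apply hy
    refine ⟨(y p, y q), funext fun r => ?_⟩
    by_cases hr : r = q
    · subst hr; simp
    · by_cases hr' : r = p
      · subst hr'; simp [hr]
      · simp [hr, hr', h r hr' hr]
  · rw [liftTwo, if_pos]
    · simp [hpq]
    · intro r hr hr'; simp [hr, hr']

/-- The system component of a register state for a fixed ancilla configuration. -/
def slice (v : RegState n m) (a : Fin m → Bool) : SysState n :=
  WithLp.toLp 2 fun s => v (Sum.elim s a)

lemma elim_sysPart_ancPart (x : RegBasis n m) : Sum.elim (sysPart x) (ancPart x) = x := by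
  ext r; cases r <;> rfl

lemma slice_apply (v : RegState n m) (a : Fin m → Bool) (s : SysBasis n) :
    slice v a s = v (Sum.elim s a) := rfl

lemma apply_eq_slice (v : RegState n m) (x : RegBasis n m) :
    v x = slice v (ancPart x) (sysPart x) := by
  rw [slice_apply, elim_sysPart_ancPart]

lemma applyMat_liftSys_apply (A : Matrix (SysBasis n) (SysBasis n) ℂ) (v : RegState n m)
    (x : RegBasis n m) :
    applyMat (liftSys m A) v x = applyMat A (slice v (ancPart x)) (sysPart x) := by
  rw [applyMat_apply, applyMat_apply]
  symm
  refine Fintype.sum_of_injective (fun s : SysBasis n => (Sum.elim s (ancPart x) : RegBasis n m))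
    ?_ _ _ (fun y hy => ?_) (fun b => ?_)
  · intro s t h
    ext i
    exact congrFun h (Sum.inl i)
  · rw [liftSys, if_neg, zero_mul]
    intro h
    refine hy ⟨sysPart y, ?_⟩
    simp only [h]
    exact elim_sysPart_ancPart y
  · have h1 : ancPart x = ancPart (Sum.elim b (ancPart x) : RegBasis n m) := rfl
    change _ = (if _ then _ else _) * _
    rw [if_pos h1]
    rfl

lemma slice_liftSys (A : Matrix (SysBasis n) (SysBasis n) ℂ) (v : RegState n m)
    (a : Fin m → Bool) : slice (applyMat (liftSys m A) v) a = applyMat A (slice v a) := by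
  ext s
  rw [slice_apply, applyMat_liftSys_apply]
  rfl

lemma applyMat_controlledSys_apply (c : Fin m) (A : Matrix (SysBasis n) (SysBasis n) ℂ)
    (v : RegState n m) (x : RegBasis n m) :
    applyMat (controlledSys c A) v x =
      if x (Sum.inr c) = true then applyMat (liftSys m A) v x else v x := by
  split_ifs with h
  · simp only [applyMat_apply, controlledSys, if_pos h]
  · rw [← congrFun (congrArg WithLp.ofLp (one_applyMat v)) x]
    simp only [applyMat_apply, controlledSys, if_neg h]

lemma slice_controlledSys (c : Fin m) (A : Matrix (SysBasis n) (SysBasis n) ℂ) (v : RegState n m)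
    (a : Fin m → Bool) :
    slice (applyMat (controlledSys c A) v) a =
      if a c = true then applyMat A (slice v a) else slice v a := by
  ext s
  rw [slice_apply, applyMat_controlledSys_apply, ← slice_apply, slice_liftSys]
  by_cases h : a c = true
  · rw [if_pos h]; exact if_pos h
  · rw [if_neg h]; exact if_neg h

lemma ext_slice {v w : RegState n m} (h : ∀ a, slice v a = slice w a) : v = w := by
  ext x
  rw [apply_eq_slice, apply_eq_slice w, h]

lemma liftOne_mul (q : Qubit n m) (g h : Matrix Bool Bool ℂ) (v : RegState n m) :
    applyMat (liftOne q g) (applyMat (liftOne q h) v) = applyMat (liftOne q (g * h)) v := by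
  ext x
  simp only [applyMat_liftOne_apply, Matrix.mul_apply, Fintype.sum_bool, Function.update_self,
    Function.update_idem]
  ring

lemma liftOne_one (q : Qubit n m) (v : RegState n m) : applyMat (liftOne q 1) v = v := by
  ext x
  rw [applyMat_liftOne_apply, Finset.sum_eq_single (x q)]
  · simp
  · intro b _ hb; rw [Matrix.one_apply_ne hb.symm, zero_mul]
  · simp

lemma liftTwo_mul {p q : Qubit n m} (hpq : p ≠ q) (g h : Matrix (Bool × Bool) (Bool × Bool) ℂ)
    (v : RegState n m) :
    applyMat (liftTwo p q g) (applyMat (liftTwo p q h) v) = applyMat (liftTwo p q (g * h)) v := by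
  ext x
  simp only [applyMat_liftTwo_apply hpq, Matrix.mul_apply, Finset.sum_mul, Finset.mul_sum]
  rw [Finset.sum_comm]
  refine Finset.sum_congr rfl fun c _ => Finset.sum_congr rfl fun b _ => ?_
  have h1 : Function.update (Function.update x p b.1) q b.2 p = b.1 := by simp [hpq]
  have h2 : Function.update (Function.update (Function.update (Function.update x p b.1) q b.2)
      p c.1) q c.2 = Function.update (Function.update x p c.1) q c.2 := by
    ext r
    by_cases hr : r = q
    · subst hr; simp
    · by_cases hr' : r = p
      · subst hr'; simp [hr]
      · simp [hr, hr']
  rw [h1, Function.update_self, h2]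
  ring

lemma liftTwo_one {p q : Qubit n m} (hpq : p ≠ q) (v : RegState n m) :
    applyMat (liftTwo p q 1) v = v := by
  ext x
  rw [applyMat_liftTwo_apply hpq, Finset.sum_eq_single (x p, x q)]
  · simp
  · intro b _ hb; rw [Matrix.one_apply_ne hb.symm, zero_mul]
  · simp

lemma liftSys_mul (A B : Matrix (SysBasis n) (SysBasis n) ℂ) (v : RegState n m) :
    applyMat (liftSys m A) (applyMat (liftSys m B) v) = applyMat (liftSys m (A * B)) v :=
  ext_slice fun a => by simp only [slice_liftSys, mul_applyMat]

lemma liftSys_one (v : RegState n m) : applyMat (liftSys m 1) v = v :=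
  ext_slice fun a => by rw [slice_liftSys, one_applyMat]

lemma controlledSys_mul (c : Fin m) (A B : Matrix (SysBasis n) (SysBasis n) ℂ) (v : RegState n m) :
    applyMat (controlledSys c A) (applyMat (controlledSys c B) v) =
      applyMat (controlledSys c (A * B)) v :=
  ext_slice fun a => by
    simp only [slice_controlledSys]
    split_ifs
    · rw [mul_applyMat]
    · rfl

lemma controlledSys_one (c : Fin m) (v : RegState n m) : applyMat (controlledSys c 1) v = v :=
  ext_slice fun a => by rw [slice_controlledSys, one_applyMat, ite_self]

lemma conjTranspose_liftOne (q : Qubit n m) (g : Matrix Bool Bool ℂ) :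
    (liftOne q g).conjTranspose = liftOne q g.conjTranspose := by
  ext x y
  simp only [Matrix.conjTranspose_apply, liftOne]
  have : (∀ r, r ≠ q → y r = x r) ↔ (∀ r, r ≠ q → x r = y r) := by simp only [eq_comm]
  simp only [this]
  split_ifs <;> simp

lemma conjTranspose_liftTwo (p q : Qubit n m) (g : Matrix (Bool × Bool) (Bool × Bool) ℂ) :
    (liftTwo p q g).conjTranspose = liftTwo p q g.conjTranspose := by
  ext x y
  simp only [Matrix.conjTranspose_apply, liftTwo]
  have : (∀ r, r ≠ p → r ≠ q → y r = x r) ↔ (∀ r, r ≠ p → r ≠ q → x r = y r) := by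
    simp only [eq_comm]
  simp only [this]
  split_ifs <;> simp

lemma conjTranspose_liftSys (A : Matrix (SysBasis n) (SysBasis n) ℂ) :
    (liftSys m A).conjTranspose = liftSys m A.conjTranspose := by
  ext x y
  simp only [Matrix.conjTranspose_apply, liftSys, eq_comm (a := ancPart y)]
  split_ifs <;> simp

lemma conjTranspose_controlledSys (c : Fin m) (A : Matrix (SysBasis n) (SysBasis n) ℂ) :
    (controlledSys c A).conjTranspose = controlledSys c A.conjTranspose := by
  ext x y
  rw [Matrix.conjTranspose_apply, controlledSys, controlledSys, ← conjTranspose_liftSys,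
    Matrix.conjTranspose_apply]
  by_cases h : ancPart x = ancPart y
  · have : x (Sum.inr c) = y (Sum.inr c) := congrFun h c
    rw [this]
    split_ifs
    · rfl
    · rw [← Matrix.conjTranspose_apply, Matrix.conjTranspose_one]
  · have hxy : x ≠ y := by rintro rfl; exact h rfl
    have h1 : liftSys m A y x = 0 := by rw [liftSys, if_neg (Ne.symm h)]
    rw [h1, Matrix.one_apply_ne hxy, Matrix.one_apply_ne hxy.symm]
    simp

end Lifts

/-! ### Circuits -/

/-- The coherent operations available to a program. -/
inductive QOp (n m : ℕ) : Type
  /-- A one-qubit gate. -/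
  | gateOne (q : Qubit n m) (g : Matrix.unitaryGroup Bool ℂ) : QOp n m
  /-- A two-qubit gate. -/
  | gateTwo (p q : Qubit n m) (hpq : p ≠ q) (g : Matrix.unitaryGroup (Bool × Bool) ℂ) : QOp n m
  /-- A query to the time evolution. -/
  | queryU (ctrl : Option (Fin m)) (inv : Bool) : QOp n m
  /-- A query to the state preparation oracle. -/
  | queryInit (inv : Bool) : QOp n m

namespace QOp

variable {n m : ℕ}

/-- The inverse operation. -/
def inv : QOp n m → QOp n m
  | gateOne q g => gateOne q (star g)
  | gateTwo p q h g => gateTwo p q h (star g)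
  | queryU c i => queryU c (!i)
  | queryInit i => queryInit (!i)

/-- The program that performs an operation and then continues. -/
def cons : QOp n m → QProg n m → QProg n m
  | gateOne q g, p => .gateOne q g p
  | gateTwo q r h g, p => .gateTwo q r h g p
  | queryU c i, p => .queryU c i p
  | queryInit i, p => .queryInit i p

/-- The matrix of an operation. -/
def mat (U UI : Matrix (SysBasis n) (SysBasis n) ℂ) :
    QOp n m → Matrix (RegBasis n m) (RegBasis n m) ℂ
  | gateOne q g => liftOne q g
  | gateTwo q r _ g => liftTwo q r g
  | queryU none i => liftSys m (if i then U.conjTranspose else U)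
  | queryU (some c) i => controlledSys c (if i then U.conjTranspose else U)
  | queryInit i => liftSys m (if i then UI.conjTranspose else UI)

variable {U UI : Matrix (SysBasis n) (SysBasis n) ℂ}

lemma conjTranspose_mat (o : QOp n m) : (o.mat U UI).conjTranspose = o.inv.mat U UI := by
  rcases o with ⟨q, g⟩ | ⟨p, q, h, g⟩ | ⟨_ | c, i⟩ | ⟨i⟩
  · exact conjTranspose_liftOne q g.1
  · exact conjTranspose_liftTwo p q g.1
  · cases i <;> simp [mat, inv, conjTranspose_liftSys]
  · cases i <;> simp [mat, inv, conjTranspose_controlledSys]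
  · cases i <;> simp [mat, inv, conjTranspose_liftSys]

lemma inv_mat_mat (hU : U ∈ Matrix.unitaryGroup (SysBasis n) ℂ)
    (hUI : UI ∈ Matrix.unitaryGroup (SysBasis n) ℂ) (o : QOp n m) (v : RegState n m) :
    applyMat (o.inv.mat U UI) (applyMat (o.mat U UI) v) = v := by
  have h1 : U.conjTranspose * U = 1 := Matrix.mem_unitaryGroup_iff'.mp hU
  have h2 : U * U.conjTranspose = 1 := Matrix.mem_unitaryGroup_iff.mp hU
  have h3 : UI.conjTranspose * UI = 1 := Matrix.mem_unitaryGroup_iff'.mp hUI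
  have h4 : UI * UI.conjTranspose = 1 := Matrix.mem_unitaryGroup_iff.mp hUI
  rcases o with ⟨q, g⟩ | ⟨p, q, h, g⟩ | ⟨_ | c, i⟩ | ⟨i⟩
  · exact (liftOne_mul q _ _ v).trans (by
      rw [show (star g).1 * g.1 = 1 from Matrix.mem_unitaryGroup_iff'.mp g.2, liftOne_one])
  · exact (liftTwo_mul h _ _ v).trans (by
      rw [show (star g).1 * g.1 = 1 from Matrix.mem_unitaryGroup_iff'.mp g.2, liftTwo_one h])
  · cases i <;> simp [mat, inv, liftSys_mul, h1, h2, liftSys_one]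
  · cases i <;> simp [mat, inv, controlledSys_mul, h1, h2, controlledSys_one]
  · cases i <;> simp [mat, inv, liftSys_mul, h3, h4, liftSys_one]

lemma inv_inv (o : QOp n m) : o.inv.inv = o := by
  rcases o with ⟨q, g⟩ | ⟨p, q, h, g⟩ | ⟨c, i⟩ | ⟨i⟩ <;> simp [inv]

end QOp

/-- The action of a circuit on the register. -/
def actList {n m : ℕ} (U UI : Matrix (SysBasis n) (SysBasis n) ℂ) :
    List (QOp n m) → RegState n m → RegState n m
  | [], v => v
  | o :: L, v => actList U UI L (applyMat (o.mat U UI) v)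

/-- The inverse circuit. -/
def invList {n m : ℕ} (L : List (QOp n m)) : List (QOp n m) := (L.map QOp.inv).reverse

/-- The program that runs a circuit and then continues. -/
def runList {n m : ℕ} (L : List (QOp n m)) (p : QProg n m) : QProg n m := L.foldr QOp.cons p

section Circuits

variable {n m : ℕ} {U UI : Matrix (SysBasis n) (SysBasis n) ℂ}

lemma actList_append (L L' : List (QOp n m)) (v : RegState n m) :
    actList U UI (L ++ L') v = actList U UI L' (actList U UI L v) := by
  induction L generalizing v with
  | nil => rfl
  | cons o L ih => exact ih _

lemma actList_sub (L : List (QOp n m)) (v w : RegState n m) :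
    actList U UI L (v - w) = actList U UI L v - actList U UI L w := by
  induction L generalizing v w with
  | nil => rfl
  | cons o L ih => rw [actList, applyMat_sub, ih]; rfl

lemma actList_smul (L : List (QOp n m)) (c : ℂ) (v : RegState n m) :
    actList U UI L (c • v) = c • actList U UI L v := by
  induction L generalizing v with
  | nil => rfl
  | cons o L ih => rw [actList, applyMat_smul, ih]; rfl

lemma invList_cons (o : QOp n m) (L : List (QOp n m)) :
    invList (o :: L) = invList L ++ [o.inv] := by simp [invList]

lemma invList_append (L L' : List (QOp n m)) :
    invList (L ++ L') = invList L' ++ invList L := by simp [invList]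

lemma invList_invList (L : List (QOp n m)) : invList (invList L) = L := by
  simp [invList, List.map_reverse, Function.comp_def, QOp.inv_inv]

lemma actList_invList (hU : U ∈ Matrix.unitaryGroup (SysBasis n) ℂ)
    (hUI : UI ∈ Matrix.unitaryGroup (SysBasis n) ℂ) (L : List (QOp n m)) (v : RegState n m) :
    actList U UI (invList L) (actList U UI L v) = v := by
  induction L generalizing v with
  | nil => rfl
  | cons o L ih =>
    rw [invList_cons, actList_append, actList, actList, actList, ih]
    exact QOp.inv_mat_mat hU hUI o v

lemma actList_actList_inv (hU : U ∈ Matrix.unitaryGroup (SysBasis n) ℂ)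
    (hUI : UI ∈ Matrix.unitaryGroup (SysBasis n) ℂ) (L : List (QOp n m)) (v : RegState n m) :
    actList U UI L (actList U UI (invList L) v) = v := by
  have := actList_invList hU hUI (invList L) v
  rwa [invList_invList] at this

lemma inner_actList (hU : U ∈ Matrix.unitaryGroup (SysBasis n) ℂ)
    (hUI : UI ∈ Matrix.unitaryGroup (SysBasis n) ℂ) (L : List (QOp n m)) (v w : RegState n m) :
    inner ℂ (actList U UI L v) (actList U UI L w) = inner ℂ v w := by
  induction L generalizing v w with
  | nil => rfl
  | cons o L ih =>
    rw [actList, actList, ih, inner_applyMat_left, QOp.conjTranspose_mat,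
      QOp.inv_mat_mat hU hUI]

lemma norm_actList (hU : U ∈ Matrix.unitaryGroup (SysBasis n) ℂ)
    (hUI : UI ∈ Matrix.unitaryGroup (SysBasis n) ℂ) (L : List (QOp n m)) (v : RegState n m) :
    ‖actList U UI L v‖ = ‖v‖ := by
  rw [@norm_eq_sqrt_re_inner ℂ, @norm_eq_sqrt_re_inner ℂ, inner_actList hU hUI]

/-! ### Success and failure probabilities -/

open QProg

lemma probFrom_cons (good : RegState n m → Prop) (o : QOp n m) (p : QProg n m) (v : RegState n m) :
    probFrom U UI good (o.cons p) v = probFrom U UI good p (applyMat (o.mat U UI) v) := by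
  rcases o with ⟨q, g⟩ | ⟨p, q, h, g⟩ | ⟨_ | c, i⟩ | ⟨i⟩ <;> rfl

lemma probFrom_runList (good : RegState n m → Prop) (L : List (QOp n m)) (p : QProg n m)
    (v : RegState n m) :
    probFrom U UI good (runList L p) v = probFrom U UI good p (actList U UI L v) := by
  induction L generalizing v with
  | nil => rfl
  | cons o L ih => exact (probFrom_cons good o _ v).trans (ih _)

lemma applyMat_projQubit_apply (q : Qubit n m) (b : Bool) (v : RegState n m) (x : RegBasis n m) :
    applyMat (projQubit q b) v x = if x q = b then v x else 0 := by
  rw [applyMat_apply]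
  simp [projQubit, Matrix.diagonal_apply]

lemma norm_projQubit_add (q : Qubit n m) (v : RegState n m) :
    ‖applyMat (projQubit q false) v‖ ^ 2 + ‖applyMat (projQubit q true) v‖ ^ 2 = ‖v‖ ^ 2 := by
  simp only [EuclideanSpace.norm_sq_eq, applyMat_projQubit_apply]
  rw [← Finset.sum_add_distrib]
  refine Finset.sum_congr rfl fun x _ => ?_
  cases h : x q <;> simp

lemma norm_ketZero : ‖ketZero n m‖ = 1 := by simp [ketZero]

lemma norm_norm_smul_ketZero (v : RegState n m) : ‖(‖v‖ : ℂ) • ketZero n m‖ = ‖v‖ := by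
  rw [norm_smul, norm_ketZero]; simp

/-- The program and its continuation split into the elementary cases needed for induction. -/
lemma progInduction {motive : QProg n m → Prop} (h1 : motive .done)
    (h2 : ∀ p, motive p → motive (.restart p)) (h3 : ∀ (o : QOp n m) p, motive p → motive (o.cons p))
    (h4 : ∀ q f, motive (f false) → motive (f true) → motive (.measure q f)) (p : QProg n m) :
    motive p := by
  induction p with
  | done => exact h1
  | restart p ih => exact h2 p ih
  | gateOne q g p ih => exact h3 (.gateOne q g) p ih
  | gateTwo q r h g p ih => exact h3 (.gateTwo q r h g) p ih
  | queryU c i p ih => exact h3 (.queryU c i) p ih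
  | queryInit i p ih => exact h3 (.queryInit i) p ih
  | measure q f ih => exact h4 q f (ih false) (ih true)

lemma norm_mat (hU : U ∈ Matrix.unitaryGroup (SysBasis n) ℂ)
    (hUI : UI ∈ Matrix.unitaryGroup (SysBasis n) ℂ) (o : QOp n m) (v : RegState n m) :
    ‖applyMat (o.mat U UI) v‖ = ‖v‖ := norm_actList hU hUI [o] v

/-- All operations are isometric and measurements split the squared norm. This converts upper bounds
on failure, which add up conveniently along a program, into the required lower bound on success. -/
lemma probFrom_add_not (hU : U ∈ Matrix.unitaryGroup (SysBasis n) ℂ)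
    (hUI : UI ∈ Matrix.unitaryGroup (SysBasis n) ℂ) (good : RegState n m → Prop) (p : QProg n m)
    (v : RegState n m) :
    probFrom U UI good p v + probFrom U UI (fun v => ¬ good v) p v = ‖v‖ ^ 2 := by
  induction p using progInduction generalizing v with
  | h1 => by_cases h : good v <;> simp [probFrom, h]
  | h2 p ih => rw [probFrom, probFrom, ih, norm_norm_smul_ketZero]
  | h3 o p ih => rw [probFrom_cons, probFrom_cons, ih, norm_mat hU hUI]
  | h4 q f ih0 ih1 =>
    rw [probFrom, probFrom, ← norm_projQubit_add q v, ← ih0, ← ih1]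
    ring

lemma probFrom_nonneg (good : RegState n m → Prop) (p : QProg n m) (v : RegState n m) :
    0 ≤ probFrom U UI good p v := by
  induction p using progInduction generalizing v with
  | h1 => rw [probFrom]; split_ifs <;> positivity
  | h2 p ih => exact ih _
  | h3 o p ih => rw [probFrom_cons]; exact ih _
  | h4 q f ih0 ih1 => exact add_nonneg (ih0 _) (ih1 _)

lemma probFrom_le (hU : U ∈ Matrix.unitaryGroup (SysBasis n) ℂ)
    (hUI : UI ∈ Matrix.unitaryGroup (SysBasis n) ℂ) (good : RegState n m → Prop) (p : QProg n m)
    (v : RegState n m) : probFrom U UI good p v ≤ ‖v‖ ^ 2 := by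
  have := probFrom_add_not hU hUI good p v
  have := probFrom_nonneg (U := U) (UI := UI) (fun v => ¬ good v) p v
  linarith

/-- Predicates on states that do not depend on the normalisation. -/
def ScaleInvariant (good : RegState n m → Prop) : Prop :=
  ∀ (c : ℂ) (v : RegState n m), c ≠ 0 → (good (c • v) ↔ good v)

/-- Each step is homogeneous: gates, queries and projections are linear, and a restart depends on
the state only through its norm. The factor c = 0 is treated first, as scale invariance says nothing
about it. -/
lemma probFrom_smul (hU : U ∈ Matrix.unitaryGroup (SysBasis n) ℂ)
    (hUI : UI ∈ Matrix.unitaryGroup (SysBasis n) ℂ) {good : RegState n m → Prop}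
    (hgood : ScaleInvariant good) (p : QProg n m) (c : ℂ) (v : RegState n m) :
    probFrom U UI good p (c • v) = ‖c‖ ^ 2 * probFrom U UI good p v := by
  by_cases hc : c = 0
  · subst hc
    have h1 := probFrom_le hU hUI good p ((0 : ℂ) • v)
    have h2 := probFrom_nonneg (U := U) (UI := UI) good p ((0 : ℂ) • v)
    simp only [zero_smul, norm_zero] at h1 h2 ⊢
    nlinarith
  induction p using progInduction generalizing c v with
  | h1 =>
    have := hgood c v hc
    by_cases h : good v
    · rw [probFrom, probFrom, if_pos (this.mpr h), if_pos h, norm_smul]; ring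
    · rw [probFrom, probFrom, if_neg (mt this.mp h), if_neg h, mul_zero]
  | h2 p ih =>
    by_cases hv : v = 0
    · subst hv
      have h1 := probFrom_le hU hUI good p ((0 : RegState n m))
      have h2 := probFrom_nonneg (U := U) (UI := UI) good p (0 : RegState n m)
      have : probFrom U UI good p 0 = 0 := le_antisymm (by simpa using h1) h2
      simp [probFrom, this]
    · have hv' : (‖v‖ : ℂ) ≠ 0 := by simpa using hv
      have hcv : ((‖c • v‖ : ℝ) : ℂ) ≠ 0 := by simp [hc, hv]
      rw [probFrom, probFrom, ih _ _ hcv, ih _ _ hv', norm_smul]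
      simp only [Complex.norm_real, norm_mul, norm_norm]
      ring
  | h3 o p ih => rw [probFrom_cons, probFrom_cons, applyMat_smul, ih _ _ hc]
  | h4 q f ih0 ih1 =>
    rw [probFrom, probFrom, applyMat_smul, applyMat_smul, ih0 _ _ hc, ih1 _ _ hc]
    ring

lemma probFrom_restart (hU : U ∈ Matrix.unitaryGroup (SysBasis n) ℂ)
    (hUI : UI ∈ Matrix.unitaryGroup (SysBasis n) ℂ) {good : RegState n m → Prop}
    (hgood : ScaleInvariant good) (p : QProg n m) (v : RegState n m) :
    probFrom U UI good (.restart p) v = ‖v‖ ^ 2 * probFrom U UI good p (ketZero n m) := by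
  rw [probFrom, probFrom_smul hU hUI hgood, Complex.norm_real, norm_norm]

/-! ### Costs -/

/-- The worst-case cost of a program, when each operation `o` has cost `w o`. -/
def cost (w : QOp n m → ℕ) : QProg n m → ℕ
  | .done => 0
  | .restart p => cost w p
  | .gateOne q g p => cost w p + w (.gateOne q g)
  | .gateTwo q r h g p => cost w p + w (.gateTwo q r h g)
  | .queryU c i p => cost w p + w (.queryU c i)
  | .queryInit i p => cost w p + w (.queryInit i)
  | .measure _ f => max (cost w (f false)) (cost w (f true))

/-- Cost function counting the queries to the time evolution. -/
def QOp.costU : QOp n m → ℕ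
  | .queryU _ _ => 1
  | _ => 0

/-- Cost function counting the queries to the state preparation oracle. -/
def QOp.costInit : QOp n m → ℕ
  | .queryInit _ => 1
  | _ => 0

/-- Cost function counting the gates. -/
def QOp.costGate : QOp n m → ℕ
  | .gateOne _ _ => 1
  | .gateTwo _ _ _ _ => 1
  | _ => 0

lemma queriesU_eq_cost (p : QProg n m) : p.queriesU = cost QOp.costU p := by
  induction p with
  | measure q f ih => rw [QProg.queriesU, ih, ih]; rfl
  | _ => simp_all [QProg.queriesU, cost, QOp.costU]

lemma queriesInit_eq_cost (p : QProg n m) : p.queriesInit = cost QOp.costInit p := by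
  induction p with
  | measure q f ih => rw [QProg.queriesInit, ih, ih]; rfl
  | _ => simp_all [QProg.queriesInit, cost, QOp.costInit]

lemma gateCount_eq_cost (p : QProg n m) : p.gateCount = cost QOp.costGate p := by
  induction p with
  | measure q f ih => rw [QProg.gateCount, ih, ih]; rfl
  | _ => simp_all [QProg.gateCount, cost, QOp.costGate]

lemma queryDepthFrom_le (p : QProg n m) (k : ℕ) : p.queryDepthFrom k ≤ k + p.queriesU := by
  induction p generalizing k with
  | done => simp [queryDepthFrom, queriesU]
  | restart p ih => have := ih 0; simp only [queryDepthFrom, queriesU]; omega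
  | gateOne q g p ih => exact ih k
  | gateTwo q r h g p ih => exact ih k
  | queryU c i p ih => have := ih (k + 1); simp only [queryDepthFrom, queriesU]; omega
  | queryInit i p ih => exact ih k
  | measure q f ih =>
    have := ih false k
    have := ih true k
    simp only [queryDepthFrom, queriesU]; omega

/-- The bound required for the query depth is the one required for the total number of queries, so
no finer count per run is needed. -/
lemma queryDepth_le_queriesU (p : QProg n m) : p.queryDepth ≤ p.queriesU := by
  simpa [queryDepth] using queryDepthFrom_le p 0

/-- The total cost of a circuit. -/
def listCost (w : QOp n m → ℕ) (L : List (QOp n m)) : ℕ := (L.map w).sum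

lemma listCost_append (w : QOp n m → ℕ) (L L' : List (QOp n m)) :
    listCost w (L ++ L') = listCost w L + listCost w L' := by simp [listCost]

lemma listCost_cons (w : QOp n m → ℕ) (o : QOp n m) (L : List (QOp n m)) :
    listCost w (o :: L) = w o + listCost w L := by simp [listCost]

lemma listCost_nil (w : QOp n m → ℕ) : listCost w [] = 0 := rfl

lemma listCost_invList {w : QOp n m → ℕ} (hw : ∀ o, w o.inv = w o) (L : List (QOp n m)) :
    listCost w (invList L) = listCost w L := by
  simp [listCost, invList, List.sum_reverse, Function.comp_def, hw]

lemma cost_cons (w : QOp n m → ℕ) (o : QOp n m) (p : QProg n m) :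
    cost w (o.cons p) = w o + cost w p := by
  cases o <;> exact Nat.add_comm _ _

lemma cost_runList (w : QOp n m → ℕ) (L : List (QOp n m)) (p : QProg n m) :
    cost w (runList L p) = listCost w L + cost w p := by
  induction L with
  | nil => simp [runList, listCost]
  | cons o L ih =>
    have : runList (o :: L) p = o.cons (runList L p) := rfl
    rw [this, cost_cons, ih, listCost_cons, add_assoc]

end Circuits

/-! ### Elementary gates -/

/-- The NOT matrix. -/
def notMatrix : Matrix Bool Bool ℂ := fun i j => if i = j then 0 else 1

/-- A square root of the NOT matrix. -/
def sqrtNotMatrix : Matrix Bool Bool ℂ :=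
  fun i j => if i = j then (1 + Complex.I) / 2 else (1 - Complex.I) / 2

/-- The diagonal sign matrix with entry `-1` at `b`. -/
def signMatrix (b : Bool) : Matrix Bool Bool ℂ := Matrix.diagonal fun i => if i = b then -1 else 1

lemma notMatrix_mem : notMatrix ∈ Matrix.unitaryGroup Bool ℂ := by
  rw [Matrix.mem_unitaryGroup_iff']
  ext i j
  rw [Matrix.mul_apply]
  cases i <;> cases j <;> simp [notMatrix]

lemma sqrtNotMatrix_mul_self : sqrtNotMatrix * sqrtNotMatrix = notMatrix := by
  ext i j
  have := Complex.I_mul_I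
  rw [Matrix.mul_apply]
  cases i <;> cases j <;> simp [notMatrix, sqrtNotMatrix] <;> ring_nf <;>
    simp [Complex.I_sq] <;> norm_num

lemma sqrtNotMatrix_mem : sqrtNotMatrix ∈ Matrix.unitaryGroup Bool ℂ := by
  rw [Matrix.mem_unitaryGroup_iff']
  ext i j
  rw [Matrix.mul_apply]
  have h2 : conj (2 : ℂ) = 2 := Complex.conj_ofNat 2
  cases i <;> cases j <;> simp [sqrtNotMatrix, h2] <;> ring_nf <;>
    simp [Complex.I_sq] <;> norm_num

lemma signMatrix_mem (b : Bool) : signMatrix b ∈ Matrix.unitaryGroup Bool ℂ := by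
  rw [Matrix.mem_unitaryGroup_iff']
  ext i j
  rw [Matrix.mul_apply]
  cases b <;> cases i <;> cases j <;> simp [signMatrix, Matrix.diagonal_apply]

/-- The NOT gate. -/
def notGate : Matrix.unitaryGroup Bool ℂ := ⟨notMatrix, notMatrix_mem⟩

/-- The square root of the NOT gate. -/
def sqrtNotGate : Matrix.unitaryGroup Bool ℂ := ⟨sqrtNotMatrix, sqrtNotMatrix_mem⟩

/-- The sign gate. -/
def signGate (b : Bool) : Matrix.unitaryGroup Bool ℂ := ⟨signMatrix b, signMatrix_mem b⟩

/-- The matrix that applies `g` to the second qubit when the first one has value `β`. -/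
def ctrlMatrix (β : Bool) (g : Matrix Bool Bool ℂ) : Matrix (Bool × Bool) (Bool × Bool) ℂ :=
  fun x y => if x.1 = y.1 then
    (if x.1 = β then g x.2 y.2 else (1 : Matrix Bool Bool ℂ) x.2 y.2) else 0

lemma ctrlMatrix_mem (β : Bool) (g : Matrix.unitaryGroup Bool ℂ) :
    ctrlMatrix β g.1 ∈ Matrix.unitaryGroup (Bool × Bool) ℂ := by
  have hg : star g.1 * g.1 = 1 := Matrix.mem_unitaryGroup_iff'.mp g.2
  have hg' : ∀ i j, conj (g.1 true i) * g.1 true j + conj (g.1 false i) * g.1 false j =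
      (1 : Matrix Bool Bool ℂ) i j := by
    intro i j
    rw [← hg, Matrix.mul_apply, Fintype.sum_bool]
    rfl
  rw [Matrix.mem_unitaryGroup_iff']
  ext ⟨i1, i2⟩ ⟨j1, j2⟩
  rw [Matrix.mul_apply, Fintype.sum_prod_type]
  simp only [Fintype.sum_bool, Matrix.star_apply, ctrlMatrix]
  have h1 := hg' i2 j2
  cases β <;> cases i1 <;> cases j1 <;> cases i2 <;> cases j2 <;>
    simp at h1 ⊢ <;> exact h1

/-- The controlled gate. -/
def ctrlGate (β : Bool) (g : Matrix.unitaryGroup Bool ℂ) :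
    Matrix.unitaryGroup (Bool × Bool) ℂ := ⟨ctrlMatrix β g.1, ctrlMatrix_mem β g⟩

/-! ### Classical reversible circuits -/

section Reversible

variable {n m : ℕ}

/-- The gate `g` on `q`, controlled by `p` having the value `β`. -/
def ctl (β : Bool) (p q : Qubit n m) (g : Matrix.unitaryGroup Bool ℂ) : List (QOp n m) :=
  if h : p ≠ q then [.gateTwo p q h (ctrlGate β g)] else []

lemma actList_ctl {U UI : Matrix (SysBasis n) (SysBasis n) ℂ} (β : Bool) {p q : Qubit n m}
    (h : p ≠ q) (g : Matrix.unitaryGroup Bool ℂ) (v : RegState n m) (x : RegBasis n m) :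
    actList U UI (ctl β p q g) v x =
      if x p = β then ∑ c, g.1 (x q) c * v (Function.update x q c) else v x := by
  rw [ctl, dif_pos h]
  change applyMat (liftTwo p q (ctrlMatrix β g.1)) v x = _
  rw [applyMat_liftTwo_apply h, Fintype.sum_prod_type, Finset.sum_eq_single (x p)]
  · simp only [Function.update_eq_self, ctrlMatrix, if_true]
    split_ifs with h'
    · rfl
    · rw [Finset.sum_eq_single (x q)]
      · simp
      · intro c _ hc; rw [Matrix.one_apply_ne hc.symm, zero_mul]
      · simp
  · intro b _ hb
    refine Finset.sum_eq_zero fun c _ => ?_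
    simp [ctrlMatrix, hb.symm]
  · simp

lemma actList_ctl_not {U UI : Matrix (SysBasis n) (SysBasis n) ℂ} (β : Bool) {p q : Qubit n m}
    (h : p ≠ q) (v : RegState n m) (x : RegBasis n m) :
    actList U UI (ctl β p q notGate) v x =
      if x p = β then v (Function.update x q (!x q)) else v x := by
  rw [actList_ctl β h]
  congr 1
  cases hx : x q <;> simp [notGate, notMatrix]

/-- The circuit permutes the computational basis by the map `f`. -/
def Permutes (L : List (QOp n m)) (f : RegBasis n m → RegBasis n m) : Prop :=
  ∀ (U UI : Matrix (SysBasis n) (SysBasis n) ℂ) (v : RegState n m) (x : RegBasis n m),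
    actList U UI L v x = v (f x)

/-- Amplitudes are pulled back along basis maps, so the map of the circuit that runs first ends up
outermost. -/
lemma Permutes.append {L L' : List (QOp n m)} {f f' : RegBasis n m → RegBasis n m}
    (h : Permutes L f) (h' : Permutes L' f') : Permutes (L ++ L') (f ∘ f') := by
  intro U UI v x
  rw [actList_append, h', h]; rfl

/-- Flip qubit `t` if `b` holds. -/
def flipIf (t : Qubit n m) (b : RegBasis n m → Bool) (x : RegBasis n m) : RegBasis n m :=
  Function.update x t (x t ^^ b x)

/-- The Toffoli gate with a negative control `q` and a positive control `e`. -/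
def toffoli (q e t : Qubit n m) : List (QOp n m) :=
  ctl false q t sqrtNotGate ++ ctl false q e notGate ++ ctl true e t (star sqrtNotGate) ++
    ctl false q e notGate ++ ctl true e t sqrtNotGate

lemma sum_mul_sum_gate (g h : Matrix Bool Bool ℂ) (a : Bool) (F : Bool → ℂ) :
    ∑ c, g a c * ∑ d, h c d * F d = ∑ d, (g * h) a d * F d := by
  simp only [Fintype.sum_bool, Matrix.mul_apply]
  ring

lemma sum_one_gate (a : Bool) (F : Bool → ℂ) :
    ∑ c, (1 : Matrix Bool Bool ℂ) a c * F c = F a := by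
  cases a <;> simp [Matrix.one_apply]

/-- With V² = NOT, a = ¬q and b = e, the target undergoes V^a V^(-(a ⊕ b)) V^b = V^(2ab), because a
+ b - (a ⊕ b) = 2ab. The two gates on e compute and then undo a ⊕ b. -/
lemma toffoli_permutes {q e t : Qubit n m} (hqt : q ≠ t) (het : e ≠ t) (hqe : q ≠ e) :
    Permutes (toffoli q e t) (flipIf t fun x => !x q && x e) := by
  intro U UI v x
  have h1 : sqrtNotGate.1 * (star sqrtNotGate).1 = 1 :=
    Matrix.mem_unitaryGroup_iff.mp sqrtNotMatrix_mem
  have h2 : (star sqrtNotGate).1 * sqrtNotGate.1 = 1 :=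
    Matrix.mem_unitaryGroup_iff'.mp sqrtNotMatrix_mem
  have h3 : sqrtNotGate.1 * sqrtNotGate.1 = notMatrix := sqrtNotMatrix_mul_self
  have hu : ∀ c, Function.update (Function.update (Function.update x e (!x e)) t c) e (x e) =
      Function.update x t c := by
    intro c
    ext r
    by_cases hr : r = e
    · subst hr; simp [het]
    · by_cases hr' : r = t
      · subst hr'; simp [hr]
      · simp [hr, hr']
  have hue : Function.update x e (x e) = x := Function.update_eq_self e x
  have hu3 : ∀ c b d, Function.update (Function.update (Function.update x t c) e b) t d =
      Function.update (Function.update x e b) t d := by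
    intro c b d
    ext r
    by_cases hr : r = e
    · subst hr; simp [het]
    · by_cases hr' : r = t
      · subst hr'; simp
      · simp [hr, hr']
  rw [toffoli]
  simp only [actList_append, actList_ctl true het, actList_ctl_not false hqe,
    actList_ctl false hqt]
  cases hq : x q <;> cases he : x e <;>
    simp only [Function.update_of_ne hqt, Function.update_of_ne het,
      Function.update_of_ne hqe, Function.update_of_ne het.symm, Function.update_self, hq, he,
      flipIf, Bool.not_true, Bool.not_false, if_true, if_false, Bool.false_eq_true,
      Bool.true_eq_false, Bool.and_true, Bool.and_false, Bool.xor_false, Bool.xor_true,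
      Function.update_eq_self, Function.update_idem]
  all_goals
    simp only [he, Bool.not_true, Bool.not_false] at hu hue hu3
    simp only [hu, hu3, Function.update_idem, sum_mul_sum_gate, h1, h2, h3, sum_one_gate,
      Function.update_eq_self]
  cases hx : x t <;> simp [notMatrix, hue]

/-! ### Multiply controlled NOT with borrowed qubits -/

/-- All the qubits of `qs` are in state `|0⟩`, and `β` holds. -/
def andNeg (β : RegBasis n m → Bool) (qs : List (Qubit n m)) (x : RegBasis n m) : Bool :=
  β x && qs.all fun q => !x q

/-- A staircase of Toffoli gates. It toggles the target `t`, and also some of the borrowed qubits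
`es`, by partial conjunctions of the negated controls `qs`; `B s` is a circuit that
toggles the qubit `s` by the initial condition. -/
def staircase (B : Qubit n m → List (QOp n m)) :
    List (Qubit n m) → List (Qubit n m) → Qubit n m → List (QOp n m)
  | [], _, t => B t
  | _ :: _, [], _ => []
  | q :: qs, e :: es, t => toffoli q e t ++ staircase B qs es e ++ toffoli q e t

/-- The amount by which `staircase` toggles the qubit `r`. -/
def toggle (β : RegBasis n m → Bool) :
    List (Qubit n m) → List (Qubit n m) → Qubit n m → Qubit n m → RegBasis n m → Bool
  | [], _, t, r, x => decide (r = t) && β x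
  | _ :: _, [], _, _, _ => false
  | q :: qs, e :: es, t, r, x =>
    if r = t then andNeg β (q :: qs) x else toggle β qs es e r x

lemma toggle_eq_false {β : RegBasis n m → Bool} {qs es : List (Qubit n m)} {t r : Qubit n m}
    (hr : r ∉ t :: es) (x : RegBasis n m) : toggle β qs es t r x = false := by
  induction qs generalizing es t with
  | nil => simp at hr; simp [toggle, hr.1]
  | cons q qs ih =>
    cases es with
    | nil => rfl
    | cons e es =>
      rw [toggle, if_neg (by simp at hr; exact hr.1)]
      exact ih (by simp at hr ⊢; exact hr.2)

lemma toggle_self {β : RegBasis n m → Bool} {qs es : List (Qubit n m)} {t : Qubit n m}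
    (h : qs.length ≤ es.length) (x : RegBasis n m) : toggle β qs es t t x = andNeg β qs x := by
  cases qs with
  | nil => simp [toggle, andNeg]
  | cons q qs =>
    cases es with
    | nil => simp at h
    | cons e es => rw [toggle, if_pos rfl]

lemma andNeg_congr {β : RegBasis n m → Bool} {qs : List (Qubit n m)} {x y : RegBasis n m}
    (hβ : β x = β y) (h : ∀ q ∈ qs, x q = y q) : andNeg β qs x = andNeg β qs y := by
  induction qs with
  | nil => simp [andNeg, hβ]
  | cons q qs ih =>
    have h1 := ih fun r hr => h r (by simp [hr])
    have h2 := h q (by simp)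
    simp only [andNeg, List.all_cons, h2] at h1 ⊢
    rw [Bool.and_left_comm, h1, Bool.and_left_comm]

lemma toggle_congr {β : RegBasis n m → Bool} {qs es : List (Qubit n m)} {t r : Qubit n m}
    {x y : RegBasis n m} (hβ : β x = β y) (h : ∀ q ∈ qs, x q = y q) :
    toggle β qs es t r x = toggle β qs es t r y := by
  induction qs generalizing es t with
  | nil => simp [toggle, hβ]
  | cons q qs ih =>
    cases es with
    | nil => rfl
    | cons e es =>
      rw [toggle, toggle, andNeg_congr hβ h, ih fun r hr => h r (by simp [hr])]

/-- The basis permutation performed by `staircase`. -/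
def staircaseMap (β : RegBasis n m → Bool) (qs es : List (Qubit n m)) (t : Qubit n m)
    (x : RegBasis n m) : RegBasis n m := fun r => x r ^^ toggle β qs es t r x

/-- The two outer Toffoli gates toggle t by ¬q ∧ e before and after e is itself toggled. Their
combined effect is ¬q ∧ (change of e), whatever e held, so e may be in an arbitrary unknown state.
Enough borrowed qubits are required so that the empty default circuit is never reached. -/
lemma staircase_permutes {B : Qubit n m → List (QOp n m)} {β : RegBasis n m → Bool}
    {qs es : List (Qubit n m)} {t : Qubit n m} (hB : ∀ s ∈ t :: es, Permutes (B s) (flipIf s β))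
    (hlen : qs.length ≤ es.length) (hnd : (t :: es).Nodup) (hqs : ∀ q ∈ qs, q ∉ t :: es)
    (hβ : ∀ x y : RegBasis n m, (∀ r, r ∉ t :: es → x r = y r) → β x = β y) :
    Permutes (staircase B qs es t) (staircaseMap β qs es t) := by
  induction qs generalizing es t with
  | nil =>
    have h1 : staircaseMap β [] es t = flipIf t β := by
      ext x r
      by_cases hr : r = t
      · subst hr; simp [staircaseMap, toggle, flipIf]
      · simp [staircaseMap, toggle, flipIf, hr]
    rw [h1]
    exact hB t (by simp)
  | cons q qs ih =>
    cases es with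
    | nil => simp at hlen
    | cons e es =>
      have hq := hqs q (by simp)
      simp only [List.mem_cons, not_or] at hq
      obtain ⟨hqt, hqe, hqes⟩ := hq
      have hnd' := List.nodup_cons.mp hnd
      have ht : t ∉ e :: es := hnd'.1
      have het : e ≠ t := by rintro rfl; simp at ht
      have hlen' : qs.length ≤ es.length := by simpa using hlen
      have IH := ih (es := es) (t := e) (fun s hs => hB s (List.mem_cons_of_mem _ hs))
        hlen' hnd'.2
        (fun r hr h' => hqs r (by simp [hr]) (List.mem_cons_of_mem _ h'))
        (fun x y hxy => hβ x y fun r hr => hxy r fun h' => hr (List.mem_cons_of_mem _ h'))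
      have hT := toffoli_permutes (n := n) (m := m) hqt het hqe
      have key : staircaseMap β (q :: qs) (e :: es) t =
          (flipIf t fun x => !x q && x e) ∘ staircaseMap β qs es e ∘
            (flipIf t fun x => !x q && x e) := by
        ext x r
        set x' := flipIf t (fun x => !x q && x e) x with hx'
        have hx'r : ∀ s, s ≠ t → x' s = x s := fun s hs => by simp [hx', flipIf, hs]
        have hβx : β x' = β x := hβ _ _ fun s hs => hx'r s (by
          rintro rfl; exact hs (by simp))
        have hqx : ∀ s ∈ qs, x' s = x s := fun s hs => hx'r s (by
          rintro rfl; exact hqs s (by simp [hs]) (by simp))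
        simp only [Function.comp_apply]
        rw [← hx']
        by_cases hr : r = t
        · subst hr
          have h1 : staircaseMap β qs es e x' r = x' r := by
            rw [staircaseMap, toggle_eq_false ht, Bool.xor_false]
          have h2 : staircaseMap β qs es e x' q = x q := by
            rw [staircaseMap, toggle_eq_false (by simp [hqe, hqes]), Bool.xor_false, hx'r q hqt]
          have h3 : staircaseMap β qs es e x' e = (x e ^^ andNeg β qs x) := by
            rw [staircaseMap, toggle_self hlen', hx'r e het, andNeg_congr hβx hqx]
          rw [flipIf, Function.update_self, h1, h2, h3, staircaseMap, toggle, if_pos rfl]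
          simp only [hx', flipIf, Function.update_self, andNeg, List.all_cons]
          cases x r <;> cases x q <;> cases x e <;> cases β x <;>
            cases (qs.all fun q => !x q) <;> rfl
        · rw [flipIf, Function.update_of_ne hr, staircaseMap, staircaseMap, toggle, if_neg hr,
            hx'r r hr, toggle_congr hβx hqx]
      rw [key]
      exact (hT.append (IH.append hT) |> fun h => by
        rw [staircase, List.append_assoc]; exact h)

/-- Toggle the target `t` by the conjunction of the negated controls `qs` (and of the
initial condition encoded by `B`); the qubits `es` are borrowed and restored. -/
def multiControl (B : Qubit n m → List (QOp n m)) :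
    List (Qubit n m) → List (Qubit n m) → Qubit n m → List (QOp n m)
  | [], _, t => B t
  | _ :: _, [], _ => []
  | q :: qs, e :: es, t => staircase B (q :: qs) (e :: es) t ++ staircase B qs es e

/-- A staircase leaves its borrowed qubits toggled by partial conjunctions. The shorter staircase
starting at e toggles exactly these qubits once more and leaves t alone. -/
lemma multiControl_permutes {B : Qubit n m → List (QOp n m)} {β : RegBasis n m → Bool}
    {qs es : List (Qubit n m)} {t : Qubit n m} (hB : ∀ s ∈ t :: es, Permutes (B s) (flipIf s β))
    (hlen : qs.length ≤ es.length) (hnd : (t :: es).Nodup) (hqs : ∀ q ∈ qs, q ∉ t :: es)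
    (hβ : ∀ x y : RegBasis n m, (∀ r, r ∉ t :: es → x r = y r) → β x = β y) :
    Permutes (multiControl B qs es t) (flipIf t (andNeg β qs)) := by
  cases qs with
  | nil =>
    have : andNeg β [] = β := by ext x; simp [andNeg]
    rw [this]
    exact hB t (by simp)
  | cons q qs =>
    cases es with
    | nil => simp at hlen
    | cons e es =>
      have hnd' := List.nodup_cons.mp hnd
      have ht : t ∉ e :: es := hnd'.1
      have h1 := staircase_permutes hB hlen hnd hqs hβ
      have h2 := staircase_permutes (B := B) (β := β) (qs := qs) (es := es) (t := e)
        (fun s hs => hB s (List.mem_cons_of_mem _ hs))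
        (by simpa using hlen) hnd'.2
        (fun r hr h' => hqs r (by simp [hr]) (List.mem_cons_of_mem _ h'))
        (fun x y hxy => hβ x y fun r hr => hxy r fun h' => hr (List.mem_cons_of_mem _ h'))
      have key : flipIf t (andNeg β (q :: qs)) =
          staircaseMap β (q :: qs) (e :: es) t ∘ staircaseMap β qs es e := by
        ext x r
        set y := staircaseMap β qs es e x with hy
        have hyr : ∀ s, s ∉ e :: es → y s = x s := fun s hs => by
          rw [hy, staircaseMap, toggle_eq_false hs, Bool.xor_false]
        have hβy : β y = β x := hβ _ _ fun s hs => hyr s fun h' =>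
          hs (List.mem_cons_of_mem _ h')
        have hqy : ∀ s ∈ q :: qs, y s = x s := fun s hs => hyr s fun h' =>
          hqs s hs (List.mem_cons_of_mem _ h')
        rw [Function.comp_apply, ← hy, staircaseMap, toggle]
        by_cases hr : r = t
        · subst hr
          rw [if_pos rfl, hyr r ht, andNeg_congr hβy hqy, flipIf, Function.update_self]
        · rw [if_neg hr, flipIf, Function.update_of_ne hr,
            toggle_congr hβy fun s hs => hqy s (List.mem_cons_of_mem _ hs), hy, staircaseMap,
            Bool.xor_assoc, Bool.xor_self, Bool.xor_false]
      rw [key]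
      exact h1.append h2

lemma not_permutes (t : Qubit n m) :
    Permutes [.gateOne t notGate] (flipIf t fun _ => true) := by
  intro U UI v x
  change applyMat (liftOne t notMatrix) v x = _
  rw [applyMat_liftOne_apply, flipIf]
  cases hx : x t <;> simp [notMatrix]

lemma cnot_permutes {a t : Qubit n m} (h : a ≠ t) :
    Permutes (ctl true a t notGate) (flipIf t fun x => x a) := by
  intro U UI v x
  rw [actList_ctl_not true h, flipIf]
  cases hx : x a <;> simp

/-- Toggle `b` by the conjunction of the negated qubits of `S₁` and `S₂`, using the qubit `a`
as workspace. -/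
def conjunction (a b : Qubit n m) (S₁ S₂ : List (Qubit n m)) : List (QOp n m) :=
  let C₁ := multiControl (fun s => [.gateOne s notGate]) S₁ (S₂ ++ [b]) a
  let C₂ := multiControl (fun s => ctl true a s notGate) S₂ S₁ b
  C₁ ++ C₂ ++ C₁ ++ C₂

/-- Toggling a by the conjunction over S₁, and b by a ∧ (conjunction over S₂), twice in alternation
restores a. The two toggles of b differ precisely by the full conjunction, so a need not be clean.
Each half borrows the other, and the first may borrow b as well, which gives the length conditions.
-/
lemma conjunction_permutes {a b : Qubit n m} {S₁ S₂ : List (Qubit n m)}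
    (hnd : (a :: b :: (S₁ ++ S₂)).Nodup) (h1 : S₁.length ≤ S₂.length + 1)
    (h2 : S₂.length ≤ S₁.length) :
    Permutes (conjunction a b S₁ S₂) (flipIf b (andNeg (fun _ => true) (S₁ ++ S₂))) := by
  simp only [List.nodup_cons, List.mem_cons, List.mem_append, not_or, List.nodup_append] at hnd
  obtain ⟨⟨hab, ha1, ha2⟩, ⟨hb1, hb2⟩, hS1, hS2, hdis⟩ := hnd
  have hC1 : Permutes (multiControl (fun s => [.gateOne s notGate]) S₁ (S₂ ++ [b]) a)
      (flipIf a (andNeg (fun _ => true) S₁)) := by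
    refine multiControl_permutes (fun s _ => not_permutes s) (by simpa using h1) ?_ ?_
      (fun _ _ _ => rfl)
    · simp only [List.nodup_cons, List.mem_append, List.mem_singleton, not_or, List.nodup_append]
      refine ⟨⟨ha2, hab⟩, hS2, by simp, fun x hx y hy => ?_⟩
      rw [hy]; rintro rfl; exact hb2 hx
    · intro q hq
      simp only [List.mem_cons, List.mem_append, List.not_mem_nil, or_false, not_or]
      exact ⟨by rintro rfl; exact ha1 hq, fun h => hdis q hq q h rfl,
        by rintro rfl; exact hb1 hq⟩
  have hC2 : Permutes (multiControl (fun s => ctl true a s notGate) S₂ S₁ b)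
      (flipIf b (andNeg (fun x => x a) S₂)) := by
    refine multiControl_permutes (fun s hs => cnot_permutes ?_) h2 ?_ ?_ ?_
    · rintro rfl
      simp only [List.mem_cons] at hs
      exact hs.elim hab ha1
    · exact List.nodup_cons.mpr ⟨hb1, hS1⟩
    · intro q hq
      simp only [List.mem_cons, not_or]
      exact ⟨by rintro rfl; exact hb2 hq, fun h => hdis q h q hq rfl⟩
    · intro x y hxy
      exact hxy a (by simp only [List.mem_cons, not_or]; exact ⟨hab, ha1⟩)
  have key : flipIf b (andNeg (fun _ => true) (S₁ ++ S₂)) =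
      ((flipIf a (andNeg (fun _ => true) S₁) ∘ flipIf b (andNeg (fun x => x a) S₂)) ∘
        flipIf a (andNeg (fun _ => true) S₁)) ∘ flipIf b (andNeg (fun x => x a) S₂) := by
    ext x r
    have e1 : ∀ y : RegBasis n m, (∀ s, s ≠ a → s ≠ b → y s = x s) →
        (S₁.all fun q => !y q) = S₁.all fun q => !x q := fun y hy => by
      have := andNeg_congr (β := fun _ => true) (qs := S₁) (x := y) (y := x) rfl fun q hq =>
        hy q (by rintro rfl; exact ha1 hq) (by rintro rfl; exact hb1 hq)
      simpa [andNeg] using this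
    have e2 : ∀ y : RegBasis n m, (∀ s, s ≠ a → s ≠ b → y s = x s) →
        (S₂.all fun q => !y q) = S₂.all fun q => !x q := fun y hy => by
      have := andNeg_congr (β := fun _ => true) (qs := S₂) (x := y) (y := x) rfl fun q hq =>
        hy q (by rintro rfl; exact ha2 hq) (by rintro rfl; exact hb2 hq)
      simpa [andNeg] using this
    set y1 := flipIf b (andNeg (fun x => x a) S₂) x with hy1
    set y2 := flipIf a (andNeg (fun _ => true) S₁) y1 with hy2
    set y3 := flipIf b (andNeg (fun x => x a) S₂) y2 with hy3
    have f1 : ∀ s, s ≠ a → s ≠ b → y1 s = x s := fun s _ hb => by simp [hy1, flipIf, hb]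
    have f2 : ∀ s, s ≠ a → s ≠ b → y2 s = x s := fun s ha hb => by
      rw [← f1 s ha hb]; simp [hy2, flipIf, ha]
    have f3 : ∀ s, s ≠ a → s ≠ b → y3 s = x s := fun s ha hb => by
      rw [← f2 s ha hb]; simp [hy3, flipIf, hb]
    have ea1 : y1 a = x a := by simp [hy1, flipIf, hab]
    have eb1 : y1 b = (x b ^^ (x a && S₂.all fun q => !x q)) := by
      simp [hy1, flipIf, andNeg]
    have ea2 : y2 a = (x a ^^ S₁.all fun q => !x q) := by
      rw [hy2, flipIf, Function.update_self, ea1, andNeg, e1 _ f1, Bool.true_and]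
    have eb2 : y2 b = y1 b := by simp [hy2, flipIf, Ne.symm hab]
    have ea3 : y3 a = y2 a := by simp [hy3, flipIf, hab]
    have eb3 : y3 b = (y2 b ^^ (y2 a && S₂.all fun q => !x q)) := by
      rw [hy3, flipIf, Function.update_self, andNeg, e2 _ f2]
    simp only [Function.comp_apply]
    rw [← hy1, ← hy2, ← hy3]
    have hall : (S₁ ++ S₂).all (fun q => !x q) =
      ((S₁.all fun q => !x q) && S₂.all fun q => !x q) := List.all_append
    by_cases hra : r = a
    · subst hra
      rw [flipIf, flipIf, Function.update_of_ne hab, Function.update_self, ea3, ea2, andNeg,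
        e1 _ f3, Bool.true_and, Bool.xor_assoc, Bool.xor_self, Bool.xor_false]
    · by_cases hrb : r = b
      · subst hrb
        rw [flipIf, flipIf, Function.update_self, Function.update_of_ne hra, eb3, eb2, eb1, ea2,
          andNeg, hall]
        cases x r <;> cases x a <;> cases (S₁.all fun q => !x q) <;>
          cases (S₂.all fun q => !x q) <;> rfl
      · rw [flipIf, flipIf, Function.update_of_ne hra, Function.update_of_ne hrb, f3 r hra hrb]
  rw [key]
  exact ((hC1.append hC2).append hC1).append hC2

lemma actList_sign {U UI : Matrix (SysBasis n) (SysBasis n) ℂ} (q : Qubit n m) (b : Bool)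
    (v : RegState n m) (x : RegBasis n m) :
    actList U UI [.gateOne q (signGate b)] v x = (if x q = b then -1 else 1) * v x := by
  change applyMat (liftOne q (signMatrix b)) v x = _
  rw [applyMat_liftOne_apply, Finset.sum_eq_single (x q)]
  · simp [signMatrix]
  · intro c _ hc
    simp [signMatrix, hc.symm]
  · simp

/-- Change the sign of the basis states in which all the qubits of `S₁` and `S₂` are `0`. -/
def phaseFlip (a b : Qubit n m) (S₁ S₂ : List (Qubit n m)) : List (QOp n m) :=
  [.gateOne b (signGate true)] ++ conjunction a b S₁ S₂ ++ [.gateOne b (signGate true)] ++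
    conjunction a b S₁ S₂

/-- The sign gate on b acts once before and once after b is toggled by f, giving (-1)^b (-1)^(b ⊕ f)
= (-1)^f. The initial value of b drops out, and the second toggle restores it. -/
lemma actList_phaseFlip {U UI : Matrix (SysBasis n) (SysBasis n) ℂ} {a b : Qubit n m}
    {S₁ S₂ : List (Qubit n m)} (hnd : (a :: b :: (S₁ ++ S₂)).Nodup)
    (h1 : S₁.length ≤ S₂.length + 1) (h2 : S₂.length ≤ S₁.length) (v : RegState n m)
    (x : RegBasis n m) :
    actList U UI (phaseFlip a b S₁ S₂) v x =
      (if ∀ q ∈ S₁ ++ S₂, x q = false then -1 else 1) * v x := by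
  have hC := conjunction_permutes hnd h1 h2
  have hb : b ∉ S₁ ++ S₂ := (List.nodup_cons.mp (List.nodup_cons.mp hnd).2).1
  set f := andNeg (n := n) (m := m) (fun _ => true) (S₁ ++ S₂) with hf
  have hff : flipIf b f (flipIf b f x) = x := by
    have : f (flipIf b f x) = f x := andNeg_congr rfl fun q hq => by
      have : q ≠ b := by rintro rfl; exact hb hq
      simp [flipIf, this]
    ext r
    by_cases hr : r = b
    · subst hr
      rw [flipIf, Function.update_self, this, flipIf, Function.update_self, Bool.xor_assoc,
        Bool.xor_self, Bool.xor_false]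
    · simp [flipIf, hr]
  have hfx : f x = true ↔ ∀ q ∈ S₁ ++ S₂, x q = false := by
    rw [hf, andNeg, Bool.true_and, List.all_eq_true]
    simp only [Bool.not_eq_true']
  rw [phaseFlip, actList_append, hC, actList_append, actList_sign, actList_append, hC, hff,
    actList_sign, ← mul_assoc, ← if_congr hfx rfl rfl]
  congr 1
  rw [flipIf, Function.update_self]
  cases x b <;> cases f x <;> simp

end Reversible

section GateCost

variable {n m : ℕ}

/-- All one- and two-qubit gates have cost at most `g`. -/
def GateCostLE (w : QOp n m → ℕ) (g : ℕ) : Prop :=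
  (∀ q u, w (.gateOne q u) ≤ g) ∧ ∀ p q h u, w (.gateTwo p q h u) ≤ g

variable {w : QOp n m → ℕ} {g : ℕ}

lemma listCost_ctl_le (hw : GateCostLE w g) (β : Bool) (p q : Qubit n m)
    (u : Matrix.unitaryGroup Bool ℂ) : listCost w (ctl β p q u) ≤ g := by
  rw [ctl]
  split_ifs
  · rw [listCost_cons, listCost_nil]
    exact hw.2 _ _ _ _
  · exact Nat.zero_le _

lemma listCost_toffoli_le (hw : GateCostLE w g) (q e t : Qubit n m) :
    listCost w (toffoli q e t) ≤ 5 * g := by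
  simp only [toffoli, listCost_append]
  have h1 := listCost_ctl_le hw false q t sqrtNotGate
  have h2 := listCost_ctl_le hw false q e notGate
  have h3 := listCost_ctl_le hw true e t (star sqrtNotGate)
  have h4 := listCost_ctl_le hw true e t sqrtNotGate
  omega

lemma listCost_staircase_le (hw : GateCostLE w g) {B : Qubit n m → List (QOp n m)}
    (hB : ∀ s, listCost w (B s) ≤ g) (qs es : List (Qubit n m)) (t : Qubit n m) :
    listCost w (staircase B qs es t) ≤ (10 * qs.length + 1) * g := by
  induction qs generalizing es t with
  | nil => simpa [staircase] using hB t
  | cons q qs ih =>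
    cases es with
    | nil => simp [staircase, listCost_nil]
    | cons e es =>
      simp only [staircase, listCost_append, List.length_cons]
      have h1 := listCost_toffoli_le hw q e t
      have h2 := ih es e
      calc _ ≤ 5 * g + (10 * qs.length + 1) * g + 5 * g := by omega
        _ = _ := by ring

lemma listCost_multiControl_le (hw : GateCostLE w g) {B : Qubit n m → List (QOp n m)}
    (hB : ∀ s, listCost w (B s) ≤ g) (qs es : List (Qubit n m)) (t : Qubit n m) :
    listCost w (multiControl B qs es t) ≤ (20 * qs.length + 2) * g := by
  cases qs with
  | nil => have := hB t; simp only [multiControl, List.length_nil]; omega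
  | cons q qs =>
    cases es with
    | nil => simp [multiControl, listCost_nil]
    | cons e es =>
      simp only [multiControl, listCost_append]
      have h1 := listCost_staircase_le hw hB (q :: qs) (e :: es) t
      have h2 := listCost_staircase_le hw hB qs es e
      simp only [List.length_cons] at h1 ⊢
      calc _ ≤ (10 * (qs.length + 1) + 1) * g + (10 * qs.length + 1) * g := add_le_add h1 h2
        _ ≤ _ := by rw [← add_mul]; exact Nat.mul_le_mul_right _ (by omega)

lemma listCost_phaseFlip_le (hw : GateCostLE w g) (a b : Qubit n m) (S₁ S₂ : List (Qubit n m)) :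
    listCost w (phaseFlip a b S₁ S₂) ≤ (80 * (S₁ ++ S₂).length + 18) * g := by
  have h1 := listCost_multiControl_le hw (B := fun s => [.gateOne s notGate])
    (fun s => by rw [listCost_cons, listCost_nil]; exact hw.1 _ _) S₁ (S₂ ++ [b]) a
  have h2 := listCost_multiControl_le hw (B := fun s => ctl true a s notGate)
    (fun s => listCost_ctl_le hw _ _ _ _) S₂ S₁ b
  have h3 := hw.1 b (signGate true)
  simp only [phaseFlip, conjunction, listCost_append, listCost_cons, listCost_nil,
    List.length_append]
  calc _ ≤ 2 * g + 4 * ((20 * S₁.length + 2) * g) + 4 * ((20 * S₂.length + 2) * g) := by omega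
    _ = _ := by ring

end GateCost

/-! ### The reflection about the all-zero state -/

/-- The system qubits and the first ancilla. -/
def controlQubits (n : ℕ) : List (Qubit n 3) := (List.finRange n).map Sum.inl ++ [Sum.inr 0]

/-- Change the sign of the basis states in which the system and the first ancilla are zero. -/
def zeroReflection (n : ℕ) : List (QOp n 3) :=
  phaseFlip (Sum.inr 1) (Sum.inr 2) ((controlQubits n).take ((n + 2) / 2))
    ((controlQubits n).drop ((n + 2) / 2))

lemma length_controlQubits (n : ℕ) : (controlQubits n).length = n + 1 := by simp [controlQubits]

lemma nodup_controlQubits (n : ℕ) : (Sum.inr 1 :: Sum.inr 2 :: controlQubits n).Nodup := by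
  simp only [controlQubits, List.nodup_cons, List.mem_cons, List.mem_append, List.mem_map,
    List.nodup_append, List.not_mem_nil]
  refine ⟨by simp, by simp, (List.nodup_finRange n).map Sum.inl_injective, by simp, ?_⟩
  simp

lemma actList_zeroReflection {n : ℕ} {U UI : Matrix (SysBasis n) (SysBasis n) ℂ}
    (v : RegState n 3) (x : RegBasis n 3) :
    actList U UI (zeroReflection n) v x =
      (if sysPart x = (fun _ => false) ∧ ancPart x 0 = false then -1 else 1) * v x := by
  rw [zeroReflection, actList_phaseFlip]
  · rw [List.take_append_drop]
    congr 1
    refine if_congr ?_ rfl rfl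
    simp [controlQubits, sysPart, ancPart, funext_iff]
  · rw [List.take_append_drop]
    exact nodup_controlQubits n
  -- The split point is n + 1 halved and rounded up, so the first half exceeds the second by at most
  -- one, which the borrowed target makes up for.
  · simp only [List.length_take, List.length_drop, length_controlQubits]; omega
  · simp only [List.length_take, List.length_drop, length_controlQubits]; omega

lemma listCost_zeroReflection_le {n g : ℕ} {w : QOp n 3 → ℕ} (hw : GateCostLE w g) :
    listCost w (zeroReflection n) ≤ 98 * (n + 1) * g := by
  refine (listCost_phaseFlip_le hw _ _ _ _).trans (Nat.mul_le_mul_right _ ?_)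
  rw [List.take_append_drop, length_controlQubits]
  omega

/-! ### Register states supported on one ancilla -/

section PairState

variable {n : ℕ}

/-- The ancilla configuration in which only the first ancilla can be nonzero. -/
def ancBits (b : Bool) : Fin 3 → Bool := Function.update (fun _ => false) 0 b

/-- The state `|0⟩ u₀ + |1⟩ u₁` of the first ancilla and the system, with the other ancillas
in `|0⟩`. -/
def pairState (u₀ u₁ : SysState n) : RegState n 3 :=
  WithLp.toLp 2 fun x => if ancPart x = ancBits false then u₀ (sysPart x)
    else if ancPart x = ancBits true then u₁ (sysPart x) else 0

lemma ancBits_ne : ancBits true ≠ ancBits false := fun h => by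
  have := congrFun h 0; simp [ancBits] at this

lemma ancBits_false : ancBits false = fun _ => false := by simp [ancBits]

lemma slice_pairState (u₀ u₁ : SysState n) (a : Fin 3 → Bool) :
    slice (pairState u₀ u₁) a =
      if a = ancBits false then u₀ else if a = ancBits true then u₁ else 0 := by
  ext s
  have h1 : slice (pairState u₀ u₁) a s = if a = ancBits false then u₀ s
    else if a = ancBits true then u₁ s else 0 := rfl
  rw [h1]
  split_ifs <;> rfl

lemma slice_pairState_false (u₀ u₁ : SysState n) : slice (pairState u₀ u₁) (ancBits false) = u₀ := by
  rw [slice_pairState, if_pos rfl]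

lemma slice_pairState_true (u₀ u₁ : SysState n) : slice (pairState u₀ u₁) (ancBits true) = u₁ := by
  rw [slice_pairState, if_neg ancBits_ne, if_pos rfl]

lemma slice_pairState_other (u₀ u₁ : SysState n) {a : Fin 3 → Bool} (h0 : a ≠ ancBits false)
    (h1 : a ≠ ancBits true) : slice (pairState u₀ u₁) a = 0 := by
  rw [slice_pairState, if_neg h0, if_neg h1]

lemma eq_pairState {v : RegState n 3} {u₀ u₁ : SysState n} (h0 : slice v (ancBits false) = u₀)
    (h1 : slice v (ancBits true) = u₁)
    (h2 : ∀ a, a ≠ ancBits false → a ≠ ancBits true → slice v a = 0) : v = pairState u₀ u₁ := by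
  refine ext_slice fun a => ?_
  by_cases ha0 : a = ancBits false
  · rw [ha0, h0, slice_pairState_false]
  · by_cases ha1 : a = ancBits true
    · rw [ha1, h1, slice_pairState_true]
    · rw [h2 a ha0 ha1, slice_pairState_other _ _ ha0 ha1]

lemma withZeroAncillas_eq (w : SysState n) : withZeroAncillas 3 w = pairState w 0 := by
  ext x
  simp only [withZeroAncillas, pairState, ancBits_false]
  split_ifs <;> simp

lemma slice_sub (v w : RegState n 3) (a : Fin 3 → Bool) :
    slice (v - w) a = slice v a - slice w a := rfl

lemma slice_smul (c : ℂ) (v : RegState n 3) (a : Fin 3 → Bool) :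
    slice (c • v) a = c • slice v a := rfl

lemma pairState_sub (u₀ u₁ v₀ v₁ : SysState n) :
    pairState u₀ u₁ - pairState v₀ v₁ = pairState (u₀ - v₀) (u₁ - v₁) :=
  eq_pairState (by simp only [slice_sub, slice_pairState_false])
    (by simp only [slice_sub, slice_pairState_true])
    fun a h0 h1 => by simp only [slice_sub, slice_pairState_other _ _ h0 h1, sub_zero]

lemma smul_pairState (c : ℂ) (u₀ u₁ : SysState n) :
    c • pairState u₀ u₁ = pairState (c • u₀) (c • u₁) :=
  eq_pairState (by simp only [slice_smul, slice_pairState_false])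
    (by simp only [slice_smul, slice_pairState_true])
    fun a h0 h1 => by simp only [slice_smul, slice_pairState_other _ _ h0 h1, smul_zero]

lemma inner_eq_sum_slice (v w : RegState n 3) :
    inner ℂ v w = ∑ a, inner ℂ (slice v a) (slice w a) := by
  simp only [PiLp.inner_apply]
  rw [← (Equiv.sumArrowEquivProdArrow (Fin n) (Fin 3) Bool).symm.sum_comp,
    Fintype.sum_prod_type_right]
  rfl

lemma inner_pairState (u₀ u₁ v₀ v₁ : SysState n) :
    inner ℂ (pairState u₀ u₁) (pairState v₀ v₁) = inner ℂ u₀ v₀ + inner ℂ u₁ v₁ := by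
  rw [inner_eq_sum_slice, ← Finset.sum_subset (Finset.subset_univ {ancBits false, ancBits true}),
    Finset.sum_pair ancBits_ne.symm]
  · simp only [slice_pairState_false, slice_pairState_true]
  · intro a _ ha
    simp only [Finset.mem_insert, Finset.mem_singleton, not_or] at ha
    rw [slice_pairState_other _ _ ha.1 ha.2, inner_zero_left]

lemma norm_pairState_sq (u₀ u₁ : SysState n) :
    ‖pairState u₀ u₁‖ ^ 2 = ‖u₀‖ ^ 2 + ‖u₁‖ ^ 2 := by
  have := inner_pairState u₀ u₁ u₀ u₁
  simp only [inner_self_eq_norm_sq_to_K] at this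
  exact_mod_cast this

lemma norm_pairState_zero (u : SysState n) : ‖pairState u 0‖ = ‖u‖ := by
  have := norm_pairState_sq u 0
  simp only [norm_zero] at this
  rw [← sq_eq_sq₀ (norm_nonneg _) (norm_nonneg _), this]
  ring

lemma ketZero_eq : ketZero n 3 = pairState (ketZeroSys n) 0 := by
  rw [← withZeroAncillas_eq]
  ext x
  simp only [ketZero, withZeroAncillas, ketZeroSys, PiLp.single_apply]
  have : x = (fun _ => false) ↔ ancPart x = (fun _ => false) ∧ sysPart x = fun _ => false := by
    simp [funext_iff, ancPart, sysPart, and_comm]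
  simp only [this]
  split_ifs <;> simp_all

lemma norm_ketZeroSys : ‖ketZeroSys n‖ = 1 := by simp [ketZeroSys]

lemma slice_liftOne_inr (c : Fin 3) (g : Matrix Bool Bool ℂ) (v : RegState n 3)
    (a : Fin 3 → Bool) :
    slice (applyMat (liftOne (Sum.inr c) g) v) a =
      g (a c) false • slice v (Function.update a c false) +
        g (a c) true • slice v (Function.update a c true) := by
  have hu : ∀ (s : SysBasis n) (b : Bool), Function.update (Sum.elim s a : RegBasis n 3)
      (Sum.inr c) b = Sum.elim s (Function.update a c b) := by
    intro s b
    ext r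
    rcases r with i | j
    · simp
    · by_cases h : j = c
      · subst h; simp
      · simp [h]
  ext s
  rw [slice_apply, applyMat_liftOne_apply, Fintype.sum_bool, add_comm, hu, hu]
  rfl

lemma update_ancBits (b k : Bool) : Function.update (ancBits b) 0 k = ancBits k := by
  simp [ancBits]

lemma applyMat_liftOne_pairState (g : Matrix Bool Bool ℂ) (u₀ u₁ : SysState n) :
    applyMat (liftOne (Sum.inr 0) g) (pairState u₀ u₁) =
      pairState (g false false • u₀ + g false true • u₁) (g true false • u₀ + g true true • u₁) := by
  refine eq_pairState ?_ ?_ fun a h0 h1 => ?_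
  · rw [slice_liftOne_inr, update_ancBits, update_ancBits, slice_pairState_false,
      slice_pairState_true]
    simp [ancBits]
  · rw [slice_liftOne_inr, update_ancBits, update_ancBits, slice_pairState_false,
      slice_pairState_true]
    simp [ancBits]
  · have key : ∀ k b, Function.update a 0 k ≠ ancBits b := by
      intro k b h
      have h2 : a = ancBits (a 0) := by
        have := congrArg (fun f => Function.update f 0 (a 0)) h
        simpa [update_ancBits] using this
      cases ha : a 0 <;> rw [ha] at h2
      · exact h0 h2
      · exact h1 h2
    rw [slice_liftOne_inr, slice_pairState_other _ _ (key _ _) (key _ _),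
      slice_pairState_other _ _ (key _ _) (key _ _)]
    simp

lemma applyMat_liftSys_pairState (A : Matrix (SysBasis n) (SysBasis n) ℂ) (u₀ u₁ : SysState n) :
    applyMat (liftSys 3 A) (pairState u₀ u₁) = pairState (applyMat A u₀) (applyMat A u₁) := by
  refine eq_pairState ?_ ?_ fun a h0 h1 => ?_
  · rw [slice_liftSys, slice_pairState_false]
  · rw [slice_liftSys, slice_pairState_true]
  · rw [slice_liftSys, slice_pairState_other _ _ h0 h1, applyMat_zero]

lemma applyMat_controlledSys_pairState (A : Matrix (SysBasis n) (SysBasis n) ℂ)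
    (u₀ u₁ : SysState n) :
    applyMat (controlledSys 0 A) (pairState u₀ u₁) = pairState u₀ (applyMat A u₁) := by
  refine eq_pairState ?_ ?_ fun a h0 h1 => ?_
  · rw [slice_controlledSys, slice_pairState_false, if_neg (by simp [ancBits])]
  · rw [slice_controlledSys, slice_pairState_true, if_pos (by simp [ancBits])]
  · rw [slice_controlledSys, slice_pairState_other _ _ h0 h1, applyMat_zero, ite_self]

lemma slice_projQubit (c : Fin 3) (b : Bool) (v : RegState n 3) (a : Fin 3 → Bool) :
    slice (applyMat (projQubit (Sum.inr c) b) v) a = if a c = b then slice v a else 0 := by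
  ext s
  rw [slice_apply, applyMat_projQubit_apply]
  simp only [Sum.elim_inr]
  by_cases h : a c = b
  · rw [if_pos h]; exact if_pos h
  · rw [if_neg h]; exact if_neg h

lemma applyMat_projQubit_false (u₀ u₁ : SysState n) :
    applyMat (projQubit (Sum.inr 0) false) (pairState u₀ u₁) = pairState u₀ 0 := by
  refine eq_pairState ?_ ?_ fun a h0 h1 => ?_
  · rw [slice_projQubit, slice_pairState_false, if_pos (by simp [ancBits])]
  · rw [slice_projQubit, if_neg (by simp [ancBits])]
  · rw [slice_projQubit, slice_pairState_other _ _ h0 h1, ite_self]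

lemma applyMat_projQubit_true (u₀ u₁ : SysState n) :
    applyMat (projQubit (Sum.inr 0) true) (pairState u₀ u₁) = pairState 0 u₁ := by
  refine eq_pairState ?_ ?_ fun a h0 h1 => ?_
  · rw [slice_projQubit, if_neg (by simp [ancBits])]
  · rw [slice_projQubit, slice_pairState_true, if_pos (by simp [ancBits])]
  · rw [slice_projQubit, slice_pairState_other _ _ h0 h1, ite_self]

/-- The sign flip ignores the two workspace ancillas. When they are in |0⟩, it coincides with the
reflection 1 - 2|0⟩⟨0| of the whole register. -/
lemma actList_zeroReflection_pairState {U UI : Matrix (SysBasis n) (SysBasis n) ℂ}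
    (u₀ u₁ : SysState n) :
    actList U UI (zeroReflection n) (pairState u₀ u₁) =
      pairState u₀ u₁ - (2 * inner ℂ (ketZero n 3) (pairState u₀ u₁)) • ketZero n 3 := by
  rw [ketZero_eq, inner_pairState, inner_zero_left, add_zero, smul_pairState, pairState_sub,
    smul_zero, sub_zero]
  have hin : inner ℂ (ketZeroSys n) u₀ = u₀ fun _ => false := by
    simp [ketZeroSys, EuclideanSpace.inner_single_left]
  have hs : ∀ (a : Fin 3 → Bool) (s : SysBasis n),
      slice (actList U UI (zeroReflection n) (pairState u₀ u₁)) a s =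
        (if s = (fun _ => false) ∧ a 0 = false then -1 else 1) *
          slice (pairState u₀ u₁) a s := fun a s => actList_zeroReflection _ _
  refine eq_pairState ?_ ?_ fun a h0 h1 => ?_
  · ext s
    rw [hs, slice_pairState_false, hin]
    by_cases h : s = fun _ => false
    · subst h
      simp [ancBits, ketZeroSys]
      ring
    · simp [h, ketZeroSys]
  · ext s
    rw [hs, slice_pairState_true]
    simp [ancBits]
  · ext s
    rw [hs, slice_pairState_other _ _ h0 h1]
    simp

end PairState

/-! ### Filter circuits -/

section FilterCircuit

variable {n : ℕ}

/-- Operations that involve only the system and the first ancilla. -/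
inductive IsSignalOp : QOp n 3 → Prop
  | gate (g : Matrix.unitaryGroup Bool ℂ) : IsSignalOp (.gateOne (Sum.inr 0) g)
  | queryU (i : Bool) : IsSignalOp (.queryU (some 0) i)
  | queryInit (i : Bool) : IsSignalOp (.queryInit i)

lemma IsSignalOp.inv {o : QOp n 3} (h : IsSignalOp o) : IsSignalOp o.inv := by
  cases h with
  | gate g => exact .gate _
  | queryU i => exact .queryU _
  | queryInit i => exact .queryInit _

lemma isSignalOp_of_mem_invList {L : List (QOp n 3)} (h : ∀ o ∈ L, IsSignalOp o) :
    ∀ o ∈ invList L, IsSignalOp o := by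
  intro o ho
  simp only [invList, List.mem_reverse, List.mem_map] at ho
  obtain ⟨o', ho', rfl⟩ := ho
  exact (h o' ho').inv

/-- The circuit maps states with clean workspace ancillas to such states. -/
def PreservesPairs (U UI : Matrix (SysBasis n) (SysBasis n) ℂ) (L : List (QOp n 3)) : Prop :=
  ∀ u₀ u₁, ∃ v₀ v₁, actList U UI L (pairState u₀ u₁) = pairState v₀ v₁

variable {U UI : Matrix (SysBasis n) (SysBasis n) ℂ}

lemma PreservesPairs.append {L L' : List (QOp n 3)} (h : PreservesPairs U UI L)
    (h' : PreservesPairs U UI L') : PreservesPairs U UI (L ++ L') := by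
  intro u₀ u₁
  obtain ⟨v₀, v₁, hv⟩ := h u₀ u₁
  rw [actList_append, hv]
  exact h' v₀ v₁

lemma preservesPairs_of_isSignalOp {L : List (QOp n 3)} (h : ∀ o ∈ L, IsSignalOp o) :
    PreservesPairs U UI L := by
  induction L with
  | nil => exact fun u₀ u₁ => ⟨u₀, u₁, rfl⟩
  | cons o L ih =>
    have ih' := ih fun o' ho' => h o' (List.mem_cons_of_mem _ ho')
    intro u₀ u₁
    rw [actList]
    cases h o (by simp) with
    | gate g =>
      exact (applyMat_liftOne_pairState g.1 u₀ u₁) ▸ ih' _ _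
    | queryU i =>
      exact (applyMat_controlledSys_pairState (if i then U.conjTranspose else U) u₀ u₁) ▸ ih' _ _
    | queryInit i =>
      exact (applyMat_liftSys_pairState (if i then UI.conjTranspose else UI) u₀ u₁) ▸ ih' _ _

lemma preservesPairs_zeroReflection : PreservesPairs U UI (zeroReflection n) := by
  intro u₀ u₁
  rw [actList_zeroReflection_pairState, ketZero_eq, smul_pairState, pairState_sub]
  exact ⟨_, _, rfl⟩

lemma actList_zeroReflection_self (v : RegState n 3) :
    actList U UI (zeroReflection n) (actList U UI (zeroReflection n) v) = v := by
  ext x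
  rw [actList_zeroReflection, actList_zeroReflection, ← mul_assoc]
  split_ifs <;> simp

lemma actList_invList_zeroReflection (hU : U ∈ Matrix.unitaryGroup (SysBasis n) ℂ)
    (hUI : UI ∈ Matrix.unitaryGroup (SysBasis n) ℂ) (v : RegState n 3) :
    actList U UI (invList (zeroReflection n)) v = actList U UI (zeroReflection n) v := by
  conv_lhs => rw [← actList_zeroReflection_self (U := U) (UI := UI) v]
  rw [actList_invList hU hUI]

/-- All operations have costs bounded by `g` (gates), `u` (queries to the time
evolution) and `t` (queries to the state preparation oracle). -/
structure CostLE (w : QOp n 3 → ℕ) (g u t : ℕ) : Prop where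
  gate : GateCostLE w g
  queryU : ∀ c i, w (.queryU c i) ≤ u
  queryInit : ∀ i, w (.queryInit i) ≤ t
  inv : ∀ o : QOp n 3, w o.inv = w o

/-- Every pair of complementary polynomials is realized by a circuit on one ancilla. -/
theorem exists_filter_circuit (n d : ℕ) : ∀ {P Q : ℂ[X]}, P.natDegree ≤ d → Q.natDegree ≤ d →
    (∀ z : ℂ, ‖z‖ = 1 → ‖P.eval z‖ ^ 2 + ‖Q.eval z‖ ^ 2 = 1) →
    ∃ L : List (QOp n 3), (∀ o ∈ L, IsSignalOp o) ∧
      (∀ w g u t, CostLE w g u t → listCost w L ≤ d * u + (d + 1) * g) ∧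
      ∀ (U UI : Matrix (SysBasis n) (SysBasis n) ℂ) (w : SysState n),
        actList U UI L (pairState w 0) =
          pairState (applyMat (aeval U P) w) (applyMat (aeval U Q) w) := by
  induction d with
  | zero =>
    intro P Q hP hQ hPQ
    obtain ⟨g, rfl, rfl⟩ := exists_base_gate hP hQ hPQ
    refine ⟨[.gateOne (Sum.inr 0) g], ?_, ?_, ?_⟩
    · intro o ho
      rw [List.mem_singleton.mp ho]
      exact .gate g
    · intro w k u t hw
      have := hw.gate.1 (Sum.inr 0) g
      simp only [listCost_cons, listCost_nil]
      omega
    · intro U UI w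
      refine (applyMat_liftOne_pairState g.1 w 0).trans ?_
      simp only [smul_zero, add_zero, aeval_C, Algebra.algebraMap_eq_smul_one, smul_applyMat,
        one_applyMat]
  | succ d ih =>
    intro P Q hP hQ hPQ
    obtain ⟨g, P', Q', hP', hQ', hPQ', rfl, rfl⟩ := exists_layer hP hQ hPQ
    obtain ⟨L, hL, hcost, hact⟩ := ih hP' hQ' hPQ'
    -- The head of a list acts first, so the peeled layer goes at the end. The query controlled by
    -- the flag supplies the factor X in front of Q', and the gate then mixes the two components.
    refine ⟨L ++ [.queryU (some 0) false, .gateOne (Sum.inr 0) g], ?_, ?_, ?_⟩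
    · intro o ho
      simp only [List.mem_append, List.mem_cons, List.not_mem_nil, or_false] at ho
      rcases ho with ho | rfl | rfl
      · exact hL o ho
      · exact .queryU _
      · exact .gate g
    · intro w k u t hw
      have h1 := hcost w k u t hw
      have h2 := hw.gate.1 (Sum.inr 0) g
      have h3 := hw.queryU (some 0) false
      simp only [listCost_append, listCost_cons, listCost_nil]
      calc _ ≤ d * u + (d + 1) * k + (u + k) := by omega
        _ = _ := by ring
    · intro U UI w
      rw [actList_append, hact]
      refine (congrArg (applyMat (liftOne (Sum.inr 0) g.1))
        (applyMat_controlledSys_pairState U _ _)).trans ?_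
      rw [applyMat_liftOne_pairState]
      simp only [map_add, map_mul, aeval_C, aeval_X, add_applyMat, mul_applyMat,
        Algebra.algebraMap_eq_smul_one, smul_applyMat, one_applyMat]

end FilterCircuit

/-! ### Amplitude amplification -/

section Amplify

variable {n : ℕ} {U UI : Matrix (SysBasis n) (SysBasis n) ℂ}

/-- Recursive tripling of the amplitude of the first ancilla being in state `|0⟩`. -/
def amplify (A : List (QOp n 3)) : ℕ → List (QOp n 3)
  | 0 => A
  | i + 1 => amplify A i ++ [.gateOne (Sum.inr 0) (signGate false)] ++ invList (amplify A i) ++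
      zeroReflection n ++ amplify A i

/-- The zero reflection acts as the reflection about the all-zero register only while the workspace
is clean. The inverse circuit, which precedes it in each amplification round, must therefore
preserve this too. -/
lemma preservesPairs_amplify (hU : U ∈ Matrix.unitaryGroup (SysBasis n) ℂ)
    (hUI : UI ∈ Matrix.unitaryGroup (SysBasis n) ℂ) {A : List (QOp n 3)}
    (hA : ∀ o ∈ A, IsSignalOp o) (i : ℕ) :
    PreservesPairs U UI (amplify A i) ∧ PreservesPairs U UI (invList (amplify A i)) := by
  induction i with
  | zero =>
    exact ⟨preservesPairs_of_isSignalOp hA,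
      preservesPairs_of_isSignalOp (isSignalOp_of_mem_invList hA)⟩
  | succ i ih =>
    have hs : ∀ o ∈ [QOp.gateOne (Sum.inr 0) (signGate false)], IsSignalOp (n := n) o := by
      intro o ho
      rw [List.mem_singleton.mp ho]
      exact .gate _
    have h1 := preservesPairs_of_isSignalOp (U := U) (UI := UI) hs
    have h2 := preservesPairs_of_isSignalOp (U := U) (UI := UI) (isSignalOp_of_mem_invList hs)
    have h3 : PreservesPairs U UI (zeroReflection n) := preservesPairs_zeroReflection
    have h4 : PreservesPairs U UI (invList (zeroReflection n)) := by
      intro u₀ u₁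
      rw [actList_invList_zeroReflection hU hUI]
      exact h3 u₀ u₁
    refine ⟨(((ih.1.append h1).append ih.2).append h3).append ih.1, ?_⟩
    rw [amplify]
    simp only [invList_append, invList_invList]
    exact ih.2.append (h4.append (ih.1.append (h2.append ih.2)))

/-- The amplitudes produced by `amplify` follow the sine tripling formula. -/
theorem actList_amplify (hU : U ∈ Matrix.unitaryGroup (SysBasis n) ℂ)
    (hUI : UI ∈ Matrix.unitaryGroup (SysBasis n) ℂ) {A : List (QOp n 3)}
    (hA : ∀ o ∈ A, IsSignalOp o) {x y : SysState n}
    (hx : actList U UI A (ketZero n 3) = pairState x y) (i : ℕ) :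
    ∃ (c : ℝ) (y' : SysState n),
      actList U UI (amplify A i) (ketZero n 3) = pairState ((c : ℂ) • x) y' ∧
      c * ‖x‖ = (-1) ^ i * Real.sin (3 ^ i * Real.arcsin ‖x‖) := by
  induction i with
  | zero =>
    refine ⟨1, y, by rw [amplify, hx]; simp, ?_⟩
    have h1 : ‖x‖ ≤ 1 := by
      have h2 := norm_pairState_sq x y
      rw [← hx, norm_actList hU hUI, norm_ketZero] at h2
      nlinarith [norm_nonneg x, sq_nonneg ‖y‖]
    simp only [pow_zero, one_mul]
    rw [Real.sin_arcsin (by linarith [norm_nonneg x]) h1]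
  | succ i ih =>
    obtain ⟨c, y', hc, hs⟩ := ih
    set L := amplify A i with hL
    set ψ := pairState ((c : ℂ) • x) y' with hψ
    have hnorm : ‖(c : ℂ) • x‖ ^ 2 + ‖y'‖ ^ 2 = 1 := by
      rw [← norm_pairState_sq, ← hψ, ← hc, norm_actList hU hUI, norm_ketZero, one_pow]
    have hcx : ‖(c : ℂ) • x‖ ^ 2 = (c * ‖x‖) ^ 2 := by
      rw [norm_smul, Complex.norm_real, Real.norm_eq_abs, mul_pow, sq_abs, mul_pow]
    set χ := pairState (-((c : ℂ) • x)) y' with hχ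
    have hsign : actList U UI [.gateOne (Sum.inr 0) (signGate false)] ψ = χ := by
      refine (applyMat_liftOne_pairState (signMatrix false) _ _).trans ?_
      simp [signMatrix, hχ]
    obtain ⟨v₀, v₁, hv⟩ := (preservesPairs_amplify hU hUI hA i).2 (-((c : ℂ) • x)) y'
    rw [← hL, ← hχ] at hv
    -- The overlap of L⁻¹χ with the initial state is that of χ with ψ, namely the flag-1 weight
    -- minus the flag-0 weight, 1 - 2s² for s = c‖x‖.
    have hinner : inner ℂ (ketZero n 3) (pairState v₀ v₁) = ((1 - 2 * (c * ‖x‖) ^ 2 : ℝ) : ℂ) := by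
      rw [← inner_actList hU hUI L, ← hv, actList_actList_inv hU hUI, hc, hψ, hχ, inner_pairState,
        inner_neg_right, inner_self_eq_norm_sq_to_K, inner_self_eq_norm_sq_to_K]
      have h1 : ‖y'‖ ^ 2 = 1 - (c * ‖x‖) ^ 2 := by rw [← hcx]; linarith
      have h2 : ((‖(c : ℂ) • x‖ : ℝ) : ℂ) ^ 2 = (((c * ‖x‖) ^ 2 : ℝ) : ℂ) := by
        rw [← hcx]; push_cast; rfl
      have h3 : ((‖y'‖ : ℝ) : ℂ) ^ 2 = ((1 - (c * ‖x‖) ^ 2 : ℝ) : ℂ) := by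
        rw [← h1]; push_cast; rfl
      change -(((‖(c : ℂ) • x‖ : ℝ) : ℂ) ^ 2) + ((‖y'‖ : ℝ) : ℂ) ^ 2 = _
      rw [h2, h3]
      push_cast; ring
    -- The coefficient is read off χ - 2(1 - 2s²)ψ, whose flag-0 part is (-3 + 4s²) times the old
    -- one. This is the tripling formula for the sine up to sign. The flag-0 vector stays
    -- proportional to x, so success at any level yields the same state.
    refine ⟨(-3 + 4 * (c * ‖x‖) ^ 2) * c,
      y' - ((2 * (1 - 2 * (c * ‖x‖) ^ 2) : ℝ) : ℂ) • y', ?_, ?_⟩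
    · rw [amplify]
      simp only [actList_append]
      rw [← hL, hc, hsign, hv, actList_zeroReflection_pairState, hinner, actList_sub, actList_smul,
        hc, ← hv, actList_actList_inv hU hUI, hχ, hψ, smul_pairState, pairState_sub]
      congr 1
      · rw [smul_smul, ← neg_smul, ← sub_smul]
        congr 1
        push_cast; ring
      · congr 2
        push_cast; ring
    · have h3 := Real.sin_three_mul (3 ^ i * Real.arcsin ‖x‖)
      have h4 : (3 : ℝ) ^ (i + 1) * Real.arcsin ‖x‖ = 3 * (3 ^ i * Real.arcsin ‖x‖) := by ring
      rw [h4, h3]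
      set s := Real.sin (3 ^ i * Real.arcsin ‖x‖)
      have h5 : ((-1 : ℝ) ^ i) ^ 2 = 1 := by rw [← pow_mul, mul_comm, pow_mul]; simp
      have h6 : (c * ‖x‖) ^ 2 = s ^ 2 := by rw [hs, mul_pow, h5, one_mul]
      rw [h6, mul_assoc, hs]
      ring

lemma listCost_amplify_le {w : QOp n 3 → ℕ} {g u t : ℕ} (hw : CostLE w g u t)
    {A : List (QOp n 3)} {a : ℕ} (ha : listCost w A ≤ a) (i : ℕ) :
    listCost w (amplify A i) ≤ 3 ^ i * (a + 99 * (n + 1) * g) := by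
  -- One round triples the cost and adds at most 98(n + 1)g + g. Adding this offset makes the
  -- recursion a pure tripling.
  suffices h : listCost w (amplify A i) + 49 * (n + 1) * g + g ≤
      3 ^ i * (a + 99 * (n + 1) * g) by omega
  induction i with
  | zero =>
    simp only [amplify, pow_zero, one_mul]
    have : g ≤ (n + 1) * g := Nat.le_mul_of_pos_left g (by omega)
    nlinarith
  | succ i ih =>
    simp only [amplify, listCost_append, listCost_invList hw.inv, listCost_cons, listCost_nil]
    have h1 := listCost_zeroReflection_le (n := n) hw.gate
    have h2 := hw.gate.1 (Sum.inr 0) (signGate false)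
    rw [pow_succ]
    nlinarith

end Amplify

/-! ### The amplification schedule -/

/-- The numbers of tripling steps that are tried in one attempt. -/
def schedule (r : ℕ) : List ℕ := (List.replicate 8 (List.range (r + 1))).flatten

/-- The probability that all the amplified measurements fail, for the initial amplitude
`sin θ`. -/
def missProb (θ : ℝ) (levels : List ℕ) : ℝ :=
  (levels.map fun i => 1 - Real.sin (3 ^ i * θ) ^ 2).prod

lemma missProb_cons (θ : ℝ) (i : ℕ) (l : List ℕ) :
    missProb θ (i :: l) = (1 - Real.sin (3 ^ i * θ) ^ 2) * missProb θ l := by simp [missProb]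

lemma missProb_append (θ : ℝ) (l l' : List ℕ) :
    missProb θ (l ++ l') = missProb θ l * missProb θ l' := by simp [missProb]

lemma missProb_schedule (θ : ℝ) (r : ℕ) :
    missProb θ (schedule r) = missProb θ (List.range (r + 1)) ^ 8 := by
  simp [missProb, schedule]
  ring

lemma missProb_mem (θ : ℝ) (l : List ℕ) : 0 ≤ missProb θ l ∧ missProb θ l ≤ 1 := by
  induction l with
  | nil => simp [missProb]
  | cons i l ih =>
    rw [missProb_cons]
    have h1 := Real.sin_sq_le_one (3 ^ i * θ)
    have h2 := sq_nonneg (Real.sin (3 ^ i * θ))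
    constructor
    · exact mul_nonneg (by linarith) ih.1
    · exact mul_le_one₀ (by linarith) ih.1 ih.2

lemma missProb_le_of_mem {θ : ℝ} {l : List ℕ} {i : ℕ} (hi : i ∈ l) :
    missProb θ l ≤ 1 - Real.sin (3 ^ i * θ) ^ 2 := by
  induction l with
  | nil => simp at hi
  | cons j l ih =>
    rw [missProb_cons]
    have h1 := Real.sin_sq_le_one (3 ^ j * θ)
    have h2 := sq_nonneg (Real.sin (3 ^ j * θ))
    have h3 := missProb_mem θ l
    rcases List.mem_cons.mp hi with rfl | hi
    · nlinarith
    · have := ih hi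
      nlinarith

/-- The window [π/6, π/2] has ratio 3, so repeated tripling cannot jump over it. The first level to
reach π/6 lies inside it. -/
lemma exists_sin_ge {θ : ℝ} (h1 : θ ≤ Real.pi / 2) {r : ℕ}
    (h : Real.pi / 6 ≤ 3 ^ r * θ) : ∃ i ≤ r, 1 / 2 ≤ Real.sin (3 ^ i * θ) := by
  have hpi := Real.pi_pos
  classical
  have hex : ∃ i, Real.pi / 6 ≤ 3 ^ i * θ := ⟨r, h⟩
  refine ⟨Nat.find hex, Nat.find_min' hex h, ?_⟩
  have h2 := Nat.find_spec hex
  have h3 : 3 ^ Nat.find hex * θ ≤ Real.pi / 2 := by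
    rcases Nat.eq_zero_or_pos (Nat.find hex) with h' | h'
    · rw [h']; simpa using h1
    · have := Nat.find_min hex (m := Nat.find hex - 1) (by omega)
      push Not at this
      have e : (3 : ℝ) ^ Nat.find hex = 3 * 3 ^ (Nat.find hex - 1) := by
        rw [← pow_succ']; congr 1; omega
      rw [e]
      nlinarith
  rw [← Real.sin_pi_div_six]
  exact Real.sin_le_sin_of_le_of_le_pi_div_two (by linarith) h3 h2

/-- An amplitude of at least 2γ/3 has 3^r θ ≥ 2/3 ≥ π/6, so some level hits with probability at
least 1/4. Eight rounds leave at most (3/4)^8 < 1/4. -/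
lemma missProb_schedule_le {a γ : ℝ} {r : ℕ} (hγ : 0 < γ) (ha : 3 / 4 * γ ^ 2 ≤ a ^ 2)
    (ha0 : 0 ≤ a) (ha1 : a ≤ 1) (hr : 1 ≤ 3 ^ r * γ) :
    missProb (Real.arcsin a) (schedule r) ≤ 1 / 4 := by
  have h1 : a ≤ Real.arcsin a := by
    have := Real.sin_le (Real.arcsin_nonneg.mpr ha0)
    rwa [Real.sin_arcsin (by linarith) ha1] at this
  have h2 : 2 / 3 * γ ≤ a := by
    rw [← abs_of_nonneg ha0, ← abs_of_nonneg (by positivity : 0 ≤ 2 / 3 * γ)]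
    apply sq_le_sq.mp
    nlinarith [sq_nonneg γ]
  have hpi := Real.pi_le_four
  have h3 : Real.pi / 6 ≤ 3 ^ r * Real.arcsin a := by
    have h4 : 3 ^ r * (2 / 3 * γ) ≤ 3 ^ r * Real.arcsin a := by gcongr; linarith
    nlinarith
  obtain ⟨i, hi, hs⟩ := exists_sin_ge (Real.arcsin_le_pi_div_two a) h3
  have h4 : missProb (Real.arcsin a) (List.range (r + 1)) ≤ 3 / 4 := by
    refine (missProb_le_of_mem (i := i) (by simpa using Nat.lt_succ_of_le hi)).trans ?_
    nlinarith
  rw [missProb_schedule]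
  refine (pow_le_pow_left₀ (missProb_mem _ _).1 h4 8).trans ?_
  norm_num

/-- A union bound with |sin t| ≤ |t|. The geometric sum of the 9^i for i < r is at most 9^r / 8. -/
lemma one_sub_missProb_range_le (θ : ℝ) (r : ℕ) :
    1 - missProb θ (List.range r) ≤ 9 ^ r / 8 * θ ^ 2 := by
  induction r with
  | zero => simp [missProb]; positivity
  | succ r ih =>
    rw [List.range_succ, missProb_append]
    have h0 := missProb_mem θ (List.range r)
    have h1 : missProb θ [r] = 1 - Real.sin (3 ^ r * θ) ^ 2 := by simp [missProb]
    have h2 : Real.sin (3 ^ r * θ) ^ 2 ≤ (3 ^ r * θ) ^ 2 :=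
      Real.sin_sq_le_sq
    have h3 : (3 ^ r * θ) ^ 2 = 9 ^ r * θ ^ 2 := by
      rw [mul_pow, ← pow_mul, mul_comm r 2, pow_mul]; norm_num
    have h4 := sq_nonneg (Real.sin (3 ^ r * θ))
    rw [h1, pow_succ (9 : ℝ)]
    nlinarith

lemma le_missProb_schedule {a γ : ℝ} {r : ℕ} (hγ : 0 < γ) (ha : a ^ 2 ≤ γ ^ 2 / 1000)
    (ha0 : 0 ≤ a) (ha1 : a ≤ 1) (hr : 3 ^ r * γ ≤ 3) :
    3 / 4 ≤ missProb (Real.arcsin a) (schedule r) := by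
  have hpi := Real.pi_pos
  have hpi2 := Real.pi_lt_d2
  set θ := Real.arcsin a with hθ
  have hθ0 : 0 ≤ θ := Real.arcsin_nonneg.mpr ha0
  have h1 : θ ≤ 1.6 * a := by
    have := Real.mul_le_sin hθ0 (Real.arcsin_le_pi_div_two a)
    rw [hθ, Real.sin_arcsin (by linarith) ha1, ← hθ, div_mul_eq_mul_div, div_le_iff₀ hpi] at this
    nlinarith
  have h2 := one_sub_missProb_range_le θ (r + 1)
  -- Here 3^r γ ≤ 3 and θ ≤ 1.6 a, where 1.6 exceeds π/2 and 2.56 is its square. One round then hits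
  -- with probability at most 1/32, and Bernoulli's inequality over eight rounds leaves 1 - 8/32.
  have h3 : (9 : ℝ) ^ (r + 1) / 8 * θ ^ 2 ≤ 1 / 32 := by
    have e1 : (9 : ℝ) ^ (r + 1) = 9 * (3 ^ r) ^ 2 := by
      rw [pow_succ', ← pow_mul, mul_comm r 2, pow_mul]; norm_num
    have e2 : θ ^ 2 ≤ 2.56 * (γ ^ 2 / 1000) := by nlinarith
    have e3 : (3 ^ r * γ) ^ 2 ≤ 9 := by
      have : 0 ≤ 3 ^ r * γ := by positivity
      nlinarith
    calc (9 : ℝ) ^ (r + 1) / 8 * θ ^ 2 ≤ (9 * (3 ^ r) ^ 2) / 8 * (2.56 * (γ ^ 2 / 1000)) := by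
          rw [e1]; gcongr
      _ = (9 / 8 * 2.56 / 1000) * (3 ^ r * γ) ^ 2 := by ring
      _ ≤ (9 / 8 * 2.56 / 1000) * 9 := by gcongr
      _ ≤ 1 / 32 := by norm_num
  rw [missProb_schedule]
  have h4 := one_add_mul_le_pow (a := missProb θ (List.range (r + 1)) - 1)
    (by linarith [(missProb_mem θ (List.range (r + 1))).1]) 8
  rw [add_sub_cancel] at h4
  refine le_trans ?_ h4
  norm_num
  linarith

/-! ### Programs -/

section Programs

variable {n : ℕ}

/-- Run the amplified circuits of the schedule until one of them succeeds. -/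
def attempt (A : List (QOp n 3)) (ky kn : QProg n 3) : List ℕ → QProg n 3
  | [] => .restart kn
  | i :: is => .restart (runList (amplify A i)
      (.measure (Sum.inr 0) fun b => if b then attempt A ky kn is else ky))

/-- Decide by the majority of `j` attempts whether the amplitude is large. -/
def majorityTest (A : List (QOp n 3)) (r : ℕ) (ky kn : QProg n 3) : ℕ → ℤ → QProg n 3
  | 0, s => .restart (if 0 ≤ s then ky else kn)
  | j + 1, s => attempt A (majorityTest A r ky kn j (s + 1)) (majorityTest A r ky kn j (s - 1))
      (schedule r)

/-- Binary search for the ground state energy. -/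
def energySearch (A : ℝ → List (QOp n 3)) (r R : ℕ) (h : ℝ) (fin : ℝ → QProg n 3) :
    ℕ → ℝ → QProg n 3
  | 0, l => fin l
  | m + 1, l => majorityTest (A (l + h + 2 ^ m * h)) r (energySearch A r R h fin m l)
      (energySearch A r R h fin m (l + 2 ^ m * h)) R 0

/-- The circuit that applies the filter to the initial guess. -/
def guessFilter (W : List (QOp n 3)) : List (QOp n 3) := .queryInit false :: W

/-- A walk of `j` steps: from height `0` a state is prepared by an attempt, and at positive
heights the filter is measured, which increases or decreases the height. -/
def filterWalk (W : List (QOp n 3)) (r : ℕ) : ℕ → ℕ → QProg n 3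
  | 0, _ => .done
  | j + 1, 0 => attempt (guessFilter W) (filterWalk W r j 1) (filterWalk W r j 0) (schedule r)
  | j + 1, h + 1 => runList W (.measure (Sum.inr 0) fun b =>
      if b then .gateOne (Sum.inr 0) notGate (filterWalk W r j h) else filterWalk W r j (h + 2))

/-! ### Costs of the programs -/

section ProgramCost

variable {w : QOp n 3 → ℕ} {g u t a : ℕ}

/-- A bound for the cost of one attempt. -/
def attemptCost (n r a g : ℕ) : ℕ := 12 * 3 ^ r * (a + 99 * (n + 1) * g)

lemma cost_attempt_le {A : List (QOp n 3)} {f : ℕ → ℕ}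
    (hf : ∀ i, listCost w (amplify A i) ≤ f i) (ky kn : QProg n 3) {b : ℕ}
    (hy : cost w ky ≤ b) (hn : cost w kn ≤ b) (l : List ℕ) :
    cost w (attempt A ky kn l) ≤ (l.map f).sum + b := by
  induction l with
  | nil => simpa [attempt, cost] using hn
  | cons i l ih =>
    have h1 := hf i
    have h2 : cost w (attempt A ky kn (i :: l)) = listCost w (amplify A i) +
        max (cost w ky) (cost w (attempt A ky kn l)) := by
      rw [attempt, cost, cost_runList]
      rfl
    rw [h2, List.map_cons, List.sum_cons]
    have : max (cost w ky) (cost w (attempt A ky kn l)) ≤ (l.map f).sum + b :=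
      max_le (hy.trans (Nat.le_add_left _ _)) ih
    omega

/-- Trying every level costs no more than a constant times the top level, so not knowing the
amplitude brings no extra logarithm: 8 · 3^(r+1)/2 = 12 · 3^r. -/
lemma sum_map_schedule_le (r c : ℕ) :
    ((schedule r).map fun i => 3 ^ i * c).sum ≤ 12 * 3 ^ r * c := by
  have h1 : ((schedule r).map fun i => 3 ^ i * c).sum =
      8 * ((List.range (r + 1)).map fun i => 3 ^ i * c).sum := by
    simp [schedule]
    ring
  have h2 : ∀ k, 2 * ((List.range k).map fun i => 3 ^ i * c).sum ≤ 3 ^ k * c := by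
    intro k
    induction k with
    | zero => simp
    | succ k ih =>
      rw [List.range_succ, List.map_append, List.sum_append, pow_succ]
      simp only [List.map_cons, List.map_nil, List.sum_cons, List.sum_nil]
      nlinarith
  have := h2 (r + 1)
  rw [pow_succ] at this
  rw [h1]
  nlinarith

lemma cost_attempt_schedule_le (hw : CostLE w g u t) {A : List (QOp n 3)}
    (ha : listCost w A ≤ a) (ky kn : QProg n 3) {b : ℕ} (hy : cost w ky ≤ b) (hn : cost w kn ≤ b)
    (r : ℕ) : cost w (attempt A ky kn (schedule r)) ≤ attemptCost n r a g + b :=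
  (cost_attempt_le (fun i => listCost_amplify_le hw ha i) ky kn hy hn _).trans
    (Nat.add_le_add_right (sum_map_schedule_le _ _) _)

lemma cost_majorityTest_le (hw : CostLE w g u t) {A : List (QOp n 3)}
    (ha : listCost w A ≤ a) (ky kn : QProg n 3) {b : ℕ} (hy : cost w ky ≤ b) (hn : cost w kn ≤ b)
    (r j : ℕ) (s : ℤ) :
    cost w (majorityTest A r ky kn j s) ≤ j * attemptCost n r a g + b := by
  induction j generalizing s with
  | zero => rw [majorityTest, cost]; split_ifs <;> omega
  | succ j ih =>
    refine (cost_attempt_schedule_le hw ha _ _ (ih _) (ih _) r).trans ?_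
    rw [add_mul]; omega

lemma cost_energySearch_le (hw : CostLE w g u t) {A : ℝ → List (QOp n 3)}
    (ha : ∀ x, listCost w (A x) ≤ a) {fin : ℝ → QProg n 3} {b : ℕ} (hb : ∀ l, cost w (fin l) ≤ b)
    (r R : ℕ) (h : ℝ) (m : ℕ) (l : ℝ) :
    cost w (energySearch A r R h fin m l) ≤ m * (R * attemptCost n r a g) + b := by
  induction m generalizing l with
  | zero => simpa [energySearch] using hb l
  | succ m ih =>
    refine (cost_majorityTest_le hw (ha _) _ _ (ih _) (ih _) r R 0).trans ?_
    rw [add_mul]; omega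

lemma cost_filterWalk_le (hw : CostLE w g u t) {W : List (QOp n 3)}
    (ha : t + listCost w W ≤ a) (r j h : ℕ) :
    cost w (filterWalk W r j h) ≤ j * attemptCost n r a g := by
  have hA : listCost w (guessFilter W) ≤ a := by
    rw [guessFilter, listCost_cons]
    have := hw.queryInit false
    omega
  induction j generalizing h with
  | zero => simp [filterWalk, cost]
  | succ j ih =>
    cases h with
    | zero =>
      refine (cost_attempt_schedule_le hw hA _ _ (ih _) (ih _) r).trans ?_
      rw [add_mul]; omega
    | succ h =>
      have h1 : cost w (filterWalk W r (j + 1) (h + 1)) = listCost w W +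
          max (cost w (filterWalk W r j (h + 2)))
            (cost w (filterWalk W r j h) + w (.gateOne (Sum.inr 0) notGate)) := by
        rw [filterWalk, cost_runList]
        rfl
      have h2 := hw.gate.1 (Sum.inr 0) notGate
      have h3 := ih h
      have h4 := ih (h + 2)
      have h5 : a + g ≤ attemptCost n r a g := by
        rw [attemptCost]
        have h6 : 1 ≤ 12 * 3 ^ r := Nat.mul_pos (by norm_num) (by positivity)
        have h7 : g ≤ 99 * (n + 1) * g := Nat.le_mul_of_pos_left g (by omega)
        calc a + g ≤ 1 * (a + 99 * (n + 1) * g) := by omega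
          _ ≤ _ := Nat.mul_le_mul_right _ h6
      rw [h1, add_mul, one_mul]
      have : max (cost w (filterWalk W r j (h + 2)))
            (cost w (filterWalk W r j h) + w (.gateOne (Sum.inr 0) notGate)) ≤
          j * attemptCost n r a g + g := max_le (by omega) (by omega)
      omega

end ProgramCost

/-! ### Failure probabilities of the programs -/

open QProg

variable {U UI : Matrix (SysBasis n) (SysBasis n) ℂ} {bad : RegState n 3 → Prop}

lemma attempt_eq_restart (A : List (QOp n 3)) (ky kn : QProg n 3) (l : List ℕ) :
    ∃ q, attempt A ky kn l = .restart q := by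
  cases l <;> exact ⟨_, rfl⟩

lemma majorityTest_eq_restart (A : List (QOp n 3)) (r : ℕ) (ky kn : QProg n 3) (j : ℕ) (s : ℤ) :
    ∃ q, majorityTest A r ky kn j s = .restart q := by
  cases j
  · exact ⟨_, rfl⟩
  · exact attempt_eq_restart _ _ _ _

/-- A program that begins with a restart sees only the norm of its input, so the branches of a
decision can be treated as independent classical events. -/
lemma probFrom_of_eq_restart (hU : U ∈ Matrix.unitaryGroup (SysBasis n) ℂ)
    (hUI : UI ∈ Matrix.unitaryGroup (SysBasis n) ℂ) (hbad : ScaleInvariant bad) {p : QProg n 3}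
    (hp : ∃ q, p = .restart q) (v : RegState n 3) :
    probFrom U UI bad p v = ‖v‖ ^ 2 * probFrom U UI bad p (ketZero n 3) := by
  obtain ⟨q, rfl⟩ := hp
  rw [probFrom_restart hU hUI hbad, probFrom_restart hU hUI hbad q (ketZero n 3), norm_ketZero]
  ring

/-- The failure probability of an attempt, in terms of those of its continuations. -/
theorem exists_probFrom_attempt (hU : U ∈ Matrix.unitaryGroup (SysBasis n) ℂ)
    (hUI : UI ∈ Matrix.unitaryGroup (SysBasis n) ℂ) (hbad : ScaleInvariant bad)
    {A : List (QOp n 3)} (hA : ∀ o ∈ A, IsSignalOp o) {x y : SysState n}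
    (hx : actList U UI A (ketZero n 3) = pairState x y) (l : List ℕ) :
    ∃ α : ℝ, 0 ≤ α ∧ α * ‖x‖ ^ 2 = 1 - missProb (Real.arcsin ‖x‖) l ∧
      ∀ (ky kn : QProg n 3) (v : RegState n 3), probFrom U UI bad (attempt A ky kn l) v =
        ‖v‖ ^ 2 * (α * probFrom U UI bad ky (pairState x 0) +
          missProb (Real.arcsin ‖x‖) l * probFrom U UI bad kn (ketZero n 3)) := by
  induction l with
  | nil =>
    refine ⟨0, le_rfl, by simp [missProb], fun ky kn v => ?_⟩
    rw [attempt, probFrom_restart hU hUI hbad]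
    simp [missProb]
  | cons i l ih =>
    obtain ⟨α, hα, hαx, hform⟩ := ih
    obtain ⟨c, y', hc, hs⟩ := actList_amplify hU hUI hA hx i
    have hs2 : c ^ 2 * ‖x‖ ^ 2 = Real.sin (3 ^ i * Real.arcsin ‖x‖) ^ 2 := by
      rw [← mul_pow, hs, mul_pow, ← pow_mul, mul_comm i 2, pow_mul]; simp
    have hy' : ‖pairState 0 y'‖ ^ 2 = 1 - Real.sin (3 ^ i * Real.arcsin ‖x‖) ^ 2 := by
      have h1 := norm_pairState_sq ((c : ℂ) • x) y'
      rw [← hc, norm_actList hU hUI, norm_ketZero, norm_smul, Complex.norm_real, Real.norm_eq_abs,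
        mul_pow, sq_abs, hs2] at h1
      rw [norm_pairState_sq, norm_zero]
      linarith
    have hle := Real.sin_sq_le_one (3 ^ i * Real.arcsin ‖x‖)
    -- α collects the weights c² of the levels, each multiplied by the probability that the earlier
    -- levels missed. All hits can be merged because they produce multiples of the same x.
    refine ⟨c ^ 2 + (1 - Real.sin (3 ^ i * Real.arcsin ‖x‖) ^ 2) * α, ?_, ?_, fun ky kn v => ?_⟩
    · have : 0 ≤ (1 - Real.sin (3 ^ i * Real.arcsin ‖x‖) ^ 2) * α :=
        mul_nonneg (by linarith) hα
      positivity
    · rw [missProb_cons, add_mul, hs2, mul_assoc, hαx]; ring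
    · have h0 : pairState ((c : ℂ) • x) 0 = (c : ℂ) • pairState x 0 := by
        rw [smul_pairState, smul_zero]
      rw [attempt, probFrom_restart hU hUI hbad, probFrom_runList, hc, probFrom]
      rw [applyMat_projQubit_false, applyMat_projQubit_true, h0]
      simp only [Bool.false_eq_true, if_false, if_true]
      rw [probFrom_smul hU hUI hbad, hform, hy', missProb_cons, Complex.norm_real,
        Real.norm_eq_abs, sq_abs]
      ring

lemma probFrom_majorityTest_succ (hU : U ∈ Matrix.unitaryGroup (SysBasis n) ℂ)
    (hUI : UI ∈ Matrix.unitaryGroup (SysBasis n) ℂ) (hbad : ScaleInvariant bad)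
    {A : List (QOp n 3)} (hA : ∀ o ∈ A, IsSignalOp o) {x y : SysState n}
    (hx : actList U UI A (ketZero n 3) = pairState x y) (r : ℕ) (ky kn : QProg n 3) (j : ℕ)
    (s : ℤ) :
    probFrom U UI bad (majorityTest A r ky kn (j + 1) s) (ketZero n 3) =
      (1 - missProb (Real.arcsin ‖x‖) (schedule r)) *
          probFrom U UI bad (majorityTest A r ky kn j (s + 1)) (ketZero n 3) +
        missProb (Real.arcsin ‖x‖) (schedule r) *
          probFrom U UI bad (majorityTest A r ky kn j (s - 1)) (ketZero n 3) := by
  obtain ⟨α, -, hαx, hform⟩ := exists_probFrom_attempt hU hUI hbad hA hx (schedule r)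
  rw [majorityTest, hform, probFrom_of_eq_restart hU hUI hbad
    (majorityTest_eq_restart A r ky kn j (s + 1)) (pairState x 0), norm_pairState_zero,
    ← mul_assoc α, hαx, norm_ketZero]
  ring

lemma probFrom_ketZero_le_one (hU : U ∈ Matrix.unitaryGroup (SysBasis n) ℂ)
    (hUI : UI ∈ Matrix.unitaryGroup (SysBasis n) ℂ) (p : QProg n 3) :
    probFrom U UI bad p (ketZero n 3) ≤ 1 := by
  have := probFrom_le hU hUI bad p (ketZero n 3)
  rwa [norm_ketZero, one_pow] at this

lemma probFrom_majorityTest_zero (hU : U ∈ Matrix.unitaryGroup (SysBasis n) ℂ)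
    (hUI : UI ∈ Matrix.unitaryGroup (SysBasis n) ℂ) (hbad : ScaleInvariant bad)
    (A : List (QOp n 3)) (r : ℕ) (ky kn : QProg n 3) (s : ℤ) :
    probFrom U UI bad (majorityTest A r ky kn 0 s) (ketZero n 3) =
      probFrom U UI bad (if 0 ≤ s then ky else kn) (ketZero n 3) := by
  rw [majorityTest, probFrom_restart hU hUI hbad, norm_ketZero]
  ring

/-- Exponential moment bound for a biased walk. Per step the weight 2^(-s) is multiplied on average
by (1 - p)/2 + 2p, at most 7/8 when p ≤ 1/4, and it is at least 1 wherever the vote ends negative.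
-/
lemma probFrom_majorityTest_le_yes (hU : U ∈ Matrix.unitaryGroup (SysBasis n) ℂ)
    (hUI : UI ∈ Matrix.unitaryGroup (SysBasis n) ℂ) (hbad : ScaleInvariant bad)
    {A : List (QOp n 3)} (hA : ∀ o ∈ A, IsSignalOp o) {x y : SysState n}
    (hx : actList U UI A (ketZero n 3) = pairState x y) {r : ℕ}
    (hp : missProb (Real.arcsin ‖x‖) (schedule r) ≤ 1 / 4) (ky kn : QProg n 3) (j : ℕ) (s : ℤ) :
    probFrom U UI bad (majorityTest A r ky kn j s) (ketZero n 3) ≤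
      probFrom U UI bad ky (ketZero n 3) + (2 : ℝ) ^ (-s) * (7 / 8) ^ j := by
  induction j generalizing s with
  | zero =>
    rw [probFrom_majorityTest_zero hU hUI hbad, pow_zero, mul_one]
    split_ifs with h
    · have : (0 : ℝ) < (2 : ℝ) ^ (-s) := by positivity
      linarith
    · have h1 : (1 : ℝ) ≤ (2 : ℝ) ^ (-s) := one_le_zpow₀ (by norm_num) (by omega)
      have h2 := probFrom_ketZero_le_one (bad := bad) hU hUI kn
      have h3 := probFrom_nonneg (U := U) (UI := UI) bad ky (ketZero n 3)
      linarith
  | succ j ih =>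
    rw [probFrom_majorityTest_succ hU hUI hbad hA hx]
    set p := missProb (Real.arcsin ‖x‖) (schedule r)
    have hp0 : 0 ≤ p := (missProb_mem _ _).1
    have e1 : (2 : ℝ) ^ (-(s + 1)) = 2 ^ (-s) / 2 := by
      rw [neg_add, zpow_add₀ (by norm_num)]; norm_num; ring
    have e2 : (2 : ℝ) ^ (-(s - 1)) = 2 ^ (-s) * 2 := by
      rw [neg_sub, sub_eq_neg_add, zpow_add₀ (by norm_num)]; norm_num
    have h1 := ih (s + 1)
    have h2 := ih (s - 1)
    rw [e1] at h1
    rw [e2] at h2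
    have hq : 0 < (2 : ℝ) ^ (-s) * (7 / 8) ^ j := by positivity
    set z := (2 : ℝ) ^ (-s)
    set ρ := (7 / 8 : ℝ) ^ j
    have h3 := mul_le_mul_of_nonneg_left h1 (by linarith : 0 ≤ 1 - p)
    have h4 := mul_le_mul_of_nonneg_left h2 hp0
    rw [pow_succ]
    nlinarith

/-- The mirror image, with factor 2(1 - p) + p/2 ≤ 7/8 for p ≥ 3/4. The weight is 2^(s+1) and not
2^s, although 2^s would also be at least 1 at the tie s = 0, which counts as yes; the extra factor
is harmless. -/
lemma probFrom_majorityTest_le_no (hU : U ∈ Matrix.unitaryGroup (SysBasis n) ℂ)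
    (hUI : UI ∈ Matrix.unitaryGroup (SysBasis n) ℂ) (hbad : ScaleInvariant bad)
    {A : List (QOp n 3)} (hA : ∀ o ∈ A, IsSignalOp o) {x y : SysState n}
    (hx : actList U UI A (ketZero n 3) = pairState x y) {r : ℕ}
    (hp : 3 / 4 ≤ missProb (Real.arcsin ‖x‖) (schedule r)) (ky kn : QProg n 3) (j : ℕ) (s : ℤ) :
    probFrom U UI bad (majorityTest A r ky kn j s) (ketZero n 3) ≤
      probFrom U UI bad kn (ketZero n 3) + (2 : ℝ) ^ (s + 1) * (7 / 8) ^ j := by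
  induction j generalizing s with
  | zero =>
    rw [probFrom_majorityTest_zero hU hUI hbad, pow_zero, mul_one]
    split_ifs with h
    · have h1 : (1 : ℝ) ≤ (2 : ℝ) ^ (s + 1) := one_le_zpow₀ (by norm_num) (by omega)
      have h2 := probFrom_ketZero_le_one (bad := bad) hU hUI ky
      have h3 := probFrom_nonneg (U := U) (UI := UI) bad kn (ketZero n 3)
      linarith
    · have : (0 : ℝ) < (2 : ℝ) ^ (s + 1) := by positivity
      linarith
  | succ j ih =>
    rw [probFrom_majorityTest_succ hU hUI hbad hA hx]
    set p := missProb (Real.arcsin ‖x‖) (schedule r)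
    have hp0 : p ≤ 1 := (missProb_mem _ _).2
    have e1 : (2 : ℝ) ^ (s + 1 + 1) = 2 ^ (s + 1) * 2 := by
      rw [zpow_add₀ (by norm_num) (s + 1)]; norm_num
    have e2 : (2 : ℝ) ^ (s - 1 + 1) = 2 ^ (s + 1) / 2 := by
      rw [sub_add_cancel, zpow_add₀ (by norm_num)]; norm_num
    have h1 := ih (s + 1)
    have h2 := ih (s - 1)
    rw [e1] at h1
    rw [e2] at h2
    have hq : 0 < (2 : ℝ) ^ (s + 1) * (7 / 8) ^ j := by positivity
    set z := (2 : ℝ) ^ (s + 1)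
    set ρ := (7 / 8 : ℝ) ^ j
    have h3 := mul_le_mul_of_nonneg_left h1 (by linarith : 0 ≤ 1 - p)
    have h4 := mul_le_mul_of_nonneg_left h2 (by linarith : 0 ≤ p)
    rw [pow_succ]
    nlinarith

/-- Near the threshold nothing is known about the hit probability. This covers that case, in which
both continuations are acceptable. -/
lemma probFrom_majorityTest_le_max (hU : U ∈ Matrix.unitaryGroup (SysBasis n) ℂ)
    (hUI : UI ∈ Matrix.unitaryGroup (SysBasis n) ℂ) (hbad : ScaleInvariant bad)
    {A : List (QOp n 3)} (hA : ∀ o ∈ A, IsSignalOp o) {x y : SysState n}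
    (hx : actList U UI A (ketZero n 3) = pairState x y) {r : ℕ} {ky kn : QProg n 3} {b : ℝ}
    (hy : probFrom U UI bad ky (ketZero n 3) ≤ b) (hn : probFrom U UI bad kn (ketZero n 3) ≤ b)
    (j : ℕ) (s : ℤ) :
    probFrom U UI bad (majorityTest A r ky kn j s) (ketZero n 3) ≤ b := by
  induction j generalizing s with
  | zero =>
    rw [probFrom_majorityTest_zero hU hUI hbad]
    split_ifs
    · exact hy
    · exact hn
  | succ j ih =>
    rw [probFrom_majorityTest_succ hU hUI hbad hA hx]
    have hp := missProb_mem (Real.arcsin ‖x‖) (schedule r)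
    have h1 := mul_le_mul_of_nonneg_left (ih (s + 1)) (sub_nonneg.mpr hp.2)
    have h2 := mul_le_mul_of_nonneg_left (ih (s - 1)) hp.1
    linarith

/-- The binary search narrows the ground state energy down to an interval of length `3 * h`. -/
theorem probFrom_energySearch_le (hU : U ∈ Matrix.unitaryGroup (SysBasis n) ℂ)
    (hUI : UI ∈ Matrix.unitaryGroup (SysBasis n) ℂ) (hbad : ScaleInvariant bad)
    {A : ℝ → List (QOp n 3)} (hA : ∀ μ, ∀ o ∈ A μ, IsSignalOp o) {x y : ℝ → SysState n}
    (hx : ∀ μ, actList U UI (A μ) (ketZero n 3) = pairState (x μ) (y μ)) {r : ℕ} {h E : ℝ}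
    (hh : 0 < h)
    (hyes : ∀ μ, 0 ≤ μ → E ≤ μ - h → missProb (Real.arcsin ‖x μ‖) (schedule r) ≤ 1 / 4)
    (hno : ∀ μ, 0 ≤ μ → μ + h ≤ E → 3 / 4 ≤ missProb (Real.arcsin ‖x μ‖) (schedule r))
    {fin : ℝ → QProg n 3} {b : ℝ}
    (hfin : ∀ l, 0 ≤ l → l ≤ E → E ≤ l + 3 * h → probFrom U UI bad (fin l) (ketZero n 3) ≤ b)
    (R m : ℕ) (l : ℝ) (hl : 0 ≤ l) (hlE : l ≤ E) (hE : E ≤ l + 2 * h + 2 ^ m * h) :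
    probFrom U UI bad (energySearch A r R h fin m l) (ketZero n 3) ≤
      m * (2 * (7 / 8) ^ R) + b := by
  induction m generalizing l with
  | zero =>
    rw [energySearch]
    have := hfin l hl hlE (by rw [pow_zero] at hE; linarith)
    simpa using this
  | succ m ih =>
    have hm : 0 < (2 : ℝ) ^ m * h := by positivity
    have hm2 : (2 : ℝ) ^ (m + 1) * h = 2 * (2 ^ m * h) := by rw [pow_succ]; ring
    rw [hm2] at hE
    have hρ : 0 < (7 / 8 : ℝ) ^ R := by positivity
    -- With threshold μ = l + h + 2^m h, "yes" is harmless up to E = μ + h and "no" from E = μ - h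
    -- on. The two resulting intervals overlap in length 2h, exactly the zone where the test is
    -- unreliable; this overlap is the 2h in the invariant.
    have hyes' : E ≤ l + 2 * h + 2 ^ m * h → probFrom U UI bad (energySearch A r R h fin m l)
        (ketZero n 3) ≤ m * (2 * (7 / 8) ^ R) + b := fun h' => ih l hl hlE h'
    have hno' : l + 2 ^ m * h ≤ E → probFrom U UI bad
        (energySearch A r R h fin m (l + 2 ^ m * h)) (ketZero n 3) ≤
          m * (2 * (7 / 8) ^ R) + b := fun h' =>
      ih _ (by positivity) h' (by linarith)
    rw [energySearch]
    push_cast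
    rcases le_total E (l + h + 2 ^ m * h - h) with h1 | h1
    · have h2 := probFrom_majorityTest_le_yes hU hUI hbad (hA _) (hx (l + h + 2 ^ m * h))
        (hyes _ (by positivity) h1) (energySearch A r R h fin m l)
        (energySearch A r R h fin m (l + 2 ^ m * h)) R 0
      have h3 := hyes' (by linarith)
      norm_num at h2
      linarith
    · rcases le_total (l + h + 2 ^ m * h + h) E with h4 | h4
      · have h2 := probFrom_majorityTest_le_no hU hUI hbad (hA _) (hx (l + h + 2 ^ m * h))
          (hno _ (by positivity) h4) (energySearch A r R h fin m l)
          (energySearch A r R h fin m (l + 2 ^ m * h)) R 0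
        have h3 := hno' (by linarith)
        norm_num at h2
        linarith
      · have h2 := probFrom_majorityTest_le_max (r := r) hU hUI hbad (hA _)
          (hx (l + h + 2 ^ m * h)) (hyes' (by linarith)) (hno' (by linarith)) R 0
        linarith

end Programs

/-! ### The filter walk -/

section Walk

open QProg

variable {n : ℕ}

lemma isGoodOutput_smul {ψ : SysState n} {ε : ℝ} {v : RegState n 3} (c : ℂ)
    (h : IsGoodOutput 3 ψ ε v) : IsGoodOutput 3 ψ ε (c • v) := by
  obtain ⟨w, rfl, hw⟩ := h
  refine ⟨c • w, ?_, ?_⟩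
  · rw [withZeroAncillas_eq, withZeroAncillas_eq, smul_pairState, smul_zero]
  · rw [inner_smul_right, norm_smul, norm_mul, mul_left_comm]
    gcongr

lemma scaleInvariant_not_isGoodOutput (ψ : SysState n) (ε : ℝ) :
    ScaleInvariant fun v => ¬ IsGoodOutput 3 ψ ε v := by
  intro c v hc
  refine not_congr ⟨fun h => ?_, isGoodOutput_smul c⟩
  have := isGoodOutput_smul c⁻¹ h
  rwa [smul_smul, inv_mul_cancel₀ hc, one_smul] at this

/-- The potential of the state `w` at height `h` of the walk. -/
def walkPotential (ψ : SysState n) (h : ℕ) (w : SysState n) : ℝ :=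
  (2 ^ h)⁻¹ * ‖inner ℂ ψ w‖ ^ 2 + 2 ^ h * ‖orthPart ψ w‖ ^ 2

lemma walkPotential_zero {ψ : SysState n} (hψ : ‖ψ‖ = 1) (w : SysState n) :
    walkPotential ψ 0 w = ‖w‖ ^ 2 := by
  rw [walkPotential, norm_sq_eq_inner_add_orthPart hψ w]; simp

/-- For a bad state the orthogonal part carries at least the fraction ε of the weight, so the
potential V is at least both 2^(-k)‖w‖² and 2^k ε‖w‖². Their geometric mean √ε‖w‖² does not depend
on the height, so the walk may stop anywhere. -/
lemma norm_sq_le_walkPotential {ψ : SysState n} (hψ : ‖ψ‖ = 1) {ε : ℝ} (hε : 0 < ε) (hε' : ε < 1)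
    {w : SysState n} (h : ¬ IsGoodOutput 3 ψ ε (pairState w 0)) (k : ℕ) :
    ‖w‖ ^ 2 ≤ (Real.sqrt ε)⁻¹ * walkPotential ψ k w := by
  have h1 : ‖inner ℂ ψ w‖ < (1 - ε) * ‖w‖ := by
    by_contra! h'
    exact h ⟨w, (withZeroAncillas_eq w).symm, h'⟩
  have h2 := norm_sq_eq_inner_add_orthPart hψ w
  have hH : (1 : ℝ) ≤ 2 ^ k := one_le_pow₀ (by norm_num)
  rw [walkPotential]
  set a := ‖inner ℂ ψ w‖
  set s := ‖w‖
  set b := ‖orthPart ψ w‖ ^ 2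
  set G : ℝ := 2 ^ k
  have ha : 0 ≤ a := norm_nonneg _
  have hs : 0 ≤ s := norm_nonneg _
  have hb0 : 0 ≤ b := by positivity
  have hb : ε * s ^ 2 ≤ b := by
    have : a ^ 2 ≤ ((1 - ε) * s) ^ 2 := pow_le_pow_left₀ ha h1.le 2
    nlinarith [mul_nonneg (mul_nonneg hε.le (sub_nonneg.mpr hε'.le)) (sq_nonneg s)]
  set V := G⁻¹ * a ^ 2 + G * b
  have hG : 0 < G := by linarith
  have hGinv : G⁻¹ ≤ 1 := inv_le_one_of_one_le₀ hH
  have hV1 : G⁻¹ * s ^ 2 ≤ V := by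
    have : G⁻¹ * b ≤ G * b := by gcongr; linarith
    rw [h2, mul_add]
    exact add_le_add_right this _
  have hV2 : G * (ε * s ^ 2) ≤ V := by
    have h3 : G * (ε * s ^ 2) ≤ G * b := by gcongr
    have h4 : 0 ≤ G⁻¹ * a ^ 2 := by positivity
    linarith
  have hV0 : 0 ≤ V := le_trans (by positivity) hV1
  have hsq : (Real.sqrt ε * s ^ 2) ^ 2 ≤ V ^ 2 := by
    rw [mul_pow, Real.sq_sqrt hε.le]
    calc ε * (s ^ 2) ^ 2 = (G⁻¹ * s ^ 2) * (G * (ε * s ^ 2)) := by field_simp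
      _ ≤ V * V := mul_le_mul hV1 hV2 (by positivity) hV0
      _ = V ^ 2 := by ring
  have h5 : Real.sqrt ε * s ^ 2 ≤ V := by
    exact (le_abs_self _).trans (abs_le_of_sq_le_sq hsq hV0)
  have hsε : 0 < Real.sqrt ε := Real.sqrt_pos.mpr hε
  rw [inv_mul_eq_div, le_div_iff₀ hsε]
  linarith

variable {η γ Δ E₀ : ℝ} {H : Matrix (SysBasis n) (SysBasis n) ℂ} {ψ₀ : SysState n}
  {UI : Matrix (SysBasis n) (SysBasis n) ℂ}

/-- The circuit `W` applies the complementary functions `P`, `Q` of the time evolution `U`. -/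
def RealizesFilter (U UI : Matrix (SysBasis n) (SysBasis n) ℂ) (W : List (QOp n 3))
    (P Q : ℂ[X]) : Prop :=
  ∀ w, actList U UI W (pairState w 0) = pairState (applyMat (aeval U P) w) (applyMat (aeval U Q) w)

lemma RealizesFilter.guessFilter {U : Matrix (SysBasis n) (SysBasis n) ℂ} {W : List (QOp n 3)}
    {P Q : ℂ[X]} (hW : RealizesFilter U UI W P Q) :
    actList U UI (guessFilter W) (ketZero n 3) =
      pairState (applyMat (aeval U P) (applyMat UI (ketZeroSys n)))
        (applyMat (aeval U Q) (applyMat UI (ketZeroSys n))) := by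
  rw [_root_.guessFilter, actList, ← hW, ketZero_eq]
  congr 1
  refine (applyMat_liftSys_pairState UI _ _).trans ?_
  rw [applyMat_zero]

namespace IsGroundStateInstance

lemma norm_guess (hI : IsGroundStateInstance η γ Δ H E₀ ψ₀ UI) :
    ‖applyMat UI (ketZeroSys n)‖ = 1 := by
  rw [norm_applyMat_unitary hI.unitary, norm_ketZeroSys]

lemma overlap_sq (hI : IsGroundStateInstance η γ Δ H E₀ ψ₀ UI) (hγ : 0 < γ) :
    γ ^ 2 ≤ ‖inner ℂ ψ₀ (applyMat UI (ketZeroSys n))‖ ^ 2 := by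
  rw [norm_inner_symm]
  exact pow_le_pow_left₀ hγ.le hI.overlap 2

lemma norm_aeval_guess_le (hI : IsGroundStateInstance η γ Δ H E₀ ψ₀ UI) {P Q : ℂ[X]}
    (hPQ : ∀ z : ℂ, ‖z‖ = 1 → ‖P.eval z‖ ^ 2 + ‖Q.eval z‖ ^ 2 = 1) :
    ‖applyMat (aeval (evolution H) P) (applyMat UI (ketZeroSys n))‖ ≤ 1 := by
  have h := hI.norm_aeval_add_norm_aeval hPQ (applyMat UI (ketZeroSys n))
  rw [hI.norm_guess] at h
  nlinarith [sq_nonneg ‖applyMat (aeval (evolution H) Q) (applyMat UI (ketZeroSys n))‖,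
    norm_nonneg (applyMat (aeval (evolution H) P) (applyMat UI (ketZeroSys n)))]

lemma le_norm_aeval_guess_sq (hI : IsGroundStateInstance η γ Δ H E₀ ψ₀ UI) (hγ : 0 < γ)
    {P : ℂ[X]} (hP : 3 / 4 ≤ ‖P.eval (phasePoint E₀)‖ ^ 2) :
    3 / 4 * γ ^ 2 ≤ ‖applyMat (aeval (evolution H) P) (applyMat UI (ketZeroSys n))‖ ^ 2 := by
  rw [hI.norm_aeval_sq]
  have h1 := mul_le_mul hP (hI.overlap_sq hγ) (sq_nonneg _) (sq_nonneg _)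
  have h2 := sq_nonneg
    ‖orthPart ψ₀ (applyMat (aeval (evolution H) P) (applyMat UI (ketZeroSys n)))‖
  linarith

lemma norm_aeval_guess_sq_le (hI : IsGroundStateInstance η γ Δ H E₀ ψ₀ UI) (hη : 0 < η)
    (hΔ : 0 < Δ) {P : ℂ[X]} {κ : ℝ}
    (hP : ∀ x : ℝ, E₀ ≤ x → x ≤ Real.pi → ‖P.eval (phasePoint x)‖ ^ 2 ≤ κ) :
    ‖applyMat (aeval (evolution H) P) (applyMat UI (ketZeroSys n))‖ ^ 2 ≤ κ := by
  rw [hI.norm_aeval_sq]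
  have h1 := hI.norm_orthPart_aeval_le hη (P := P) (κ := κ)
    (fun x hx hx' => hP x (by linarith) hx') (applyMat UI (ketZeroSys n))
  have h2 := hP E₀ le_rfl (hI.energy_mem hη).2
  have h3 := norm_sq_eq_inner_add_orthPart hI.ground.norm_eq (applyMat UI (ketZeroSys n))
  rw [hI.norm_guess] at h3
  have h4 := mul_le_mul_of_nonneg_right h2
    (sq_nonneg ‖inner ℂ ψ₀ (applyMat UI (ketZeroSys n))‖)
  have h5 : κ * ‖inner ℂ ψ₀ (applyMat UI (ketZeroSys n))‖ ^ 2 +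
      κ * ‖orthPart ψ₀ (applyMat UI (ketZeroSys n))‖ ^ 2 = κ := by
    rw [← mul_add, ← h3]; ring
  linarith

end IsGroundStateInstance

/-- The failure probability of the filter walk decays exponentially. -/
theorem probFrom_filterWalk_le (hI : IsGroundStateInstance η γ Δ H E₀ ψ₀ UI) (hη : 0 < η)
    (hγ : 0 < γ) (hγ' : γ ≤ 1) {ε : ℝ} (hε : 0 < ε) (hε' : ε < 1) {W : List (QOp n 3)}
    (hWs : ∀ o ∈ W, IsSignalOp o) {P Q : ℂ[X]} (hW : RealizesFilter (evolution H) UI W P Q)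
    (hPQ : ∀ z : ℂ, ‖z‖ = 1 → ‖P.eval z‖ ^ 2 + ‖Q.eval z‖ ^ 2 = 1)
    (hP : 3 / 4 ≤ ‖P.eval (phasePoint E₀)‖ ^ 2)
    (hP' : ∀ x : ℝ, E₀ + Δ ≤ x → x ≤ Real.pi → ‖P.eval (phasePoint x)‖ ^ 2 ≤ γ ^ 2 / 1000)
    {r : ℕ} (hr : 1 ≤ 3 ^ r * γ) (j k : ℕ) (w : SysState n) :
    probFrom (evolution H) UI (fun v => ¬ IsGoodOutput 3 ψ₀ ε v) (filterWalk W r j k)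
      (pairState w 0) ≤ (Real.sqrt ε)⁻¹ * (7 / 8) ^ j * walkPotential ψ₀ k w := by
  have hU := evolution_mem_unitaryGroup hI.hermitian
  have hUI := hI.unitary
  have hψ := hI.ground.norm_eq
  have hbad := scaleInvariant_not_isGoodOutput ψ₀ ε
  have hsε : 0 < (Real.sqrt ε)⁻¹ := inv_pos.mpr (Real.sqrt_pos.mpr hε)
  set K := (Real.sqrt ε)⁻¹ with hK
  induction j generalizing k w with
  | zero =>
    rw [filterWalk, probFrom, pow_zero, mul_one]
    split_ifs with h
    · rw [walkPotential]; positivity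
    · rw [norm_pairState_zero]
      exact norm_sq_le_walkPotential hψ hε hε' h k
  | succ j ih =>
    have hρ : 0 < (7 / 8 : ℝ) ^ j := by positivity
    cases k with
    | zero =>
      have hguess : ∀ o ∈ guessFilter W, IsSignalOp o := by
        intro o ho
        rcases List.mem_cons.mp ho with rfl | ho
        · exact .queryInit _
        · exact hWs o ho
      obtain ⟨α, hα, hαx, hform⟩ := exists_probFrom_attempt hU hUI hbad hguess hW.guessFilter
        (schedule r)
      have hx1 := hI.norm_aeval_guess_le hPQ
      have hx2 := hI.le_norm_aeval_guess_sq hγ hP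
      have hp := missProb_schedule_le hγ hx2 (norm_nonneg _) hx1 hr
      have hp0 := (missProb_mem (Real.arcsin ‖applyMat (aeval (evolution H) P)
        (applyMat UI (ketZeroSys n))‖) (schedule r)).1
      have horth := hI.norm_orthPart_aeval_le hη hP' (applyMat UI (ketZeroSys n))
      have hnorm := norm_sq_eq_inner_add_orthPart hψ (applyMat UI (ketZeroSys n))
      rw [hI.norm_guess] at hnorm
      rw [filterWalk, hform, norm_pairState_zero, walkPotential_zero hψ]
      have h1 := ih 1 (applyMat (aeval (evolution H) P) (applyMat UI (ketZeroSys n)))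
      have h0 := ih 0 (ketZeroSys n)
      rw [walkPotential_zero hψ, norm_ketZeroSys, ← ketZero_eq] at h0
      set x := applyMat (aeval (evolution H) P) (applyMat UI (ketZeroSys n)) with hx
      have hsplit := norm_sq_eq_inner_add_orthPart hψ x
      have hin : 3 / 4 * γ ^ 2 ≤ ‖inner ℂ ψ₀ x‖ ^ 2 := by
        rw [hx, hI.inner_ground_aeval, norm_mul, mul_pow]
        exact mul_le_mul hP (hI.overlap_sq hγ) (sq_nonneg _) (sq_nonneg _)
      rw [walkPotential] at h1
      set a := ‖inner ℂ ψ₀ x‖ ^ 2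
      set b := ‖orthPart ψ₀ x‖ ^ 2 with hb
      set p := missProb (Real.arcsin ‖x‖) (schedule r)
      -- The excited weight is at most γ²/1000, against a ground weight of at least 3γ²/4.
      have hb' : b ≤ a / 750 := by
        have : γ ^ 2 / 1000 * ‖orthPart ψ₀ (applyMat UI (ketZeroSys n))‖ ^ 2 ≤ γ ^ 2 / 1000 := by
          have : ‖orthPart ψ₀ (applyMat UI (ketZeroSys n))‖ ^ 2 ≤ 1 := by
            nlinarith [sq_nonneg ‖inner ℂ ψ₀ (applyMat UI (ketZeroSys n))‖]
          nlinarith [sq_nonneg γ]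
        linarith
      -- A hit brings the state to height 1 with potential a/2 + 2b, a miss starts again with
      -- potential 1. Up to the tiny b the mean is (1 - p)/2 + p, at most 5/8 for p ≤ 1/4.
      have key : α * (2⁻¹ * a + 2 * b) + p ≤ 7 / 8 := by
        have h2 : α * a + α * b = 1 - p := by rw [← mul_add, ← hsplit]; exact hαx
        have h3 : α * b ≤ α * a / 750 := by
          rw [mul_div_assoc]; exact mul_le_mul_of_nonneg_left hb' hα
        have h4 : 0 ≤ α * b := mul_nonneg hα (by positivity)
        calc α * (2⁻¹ * a + 2 * b) + p = 2⁻¹ * (α * a) + 2 * (α * b) + p := by ring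
          _ ≤ 7 / 8 := by linarith
      rw [pow_one] at h1
      have h2 := mul_le_mul_of_nonneg_left h1 hα
      have h3 := mul_le_mul_of_nonneg_left h0 hp0
      have hw0 : 0 ≤ ‖w‖ ^ 2 := sq_nonneg _
      calc ‖w‖ ^ 2 * _ ≤ ‖w‖ ^ 2 * (α * (K * (7 / 8) ^ j * (2⁻¹ * a + 2 * b)) +
            p * (K * (7 / 8) ^ j * 1 ^ 2)) := by
            refine mul_le_mul_of_nonneg_left (add_le_add h2 h3) hw0
        _ = ‖w‖ ^ 2 * (K * (7 / 8) ^ j) * (α * (2⁻¹ * a + 2 * b) + p) := by ring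
        _ ≤ ‖w‖ ^ 2 * (K * (7 / 8) ^ j) * (7 / 8) := by gcongr
        _ = K * (7 / 8) ^ (j + 1) * ‖w‖ ^ 2 := by rw [pow_succ]; ring
    | succ k =>
      rw [filterWalk, probFrom_runList, hW, probFrom, applyMat_projQubit_false,
        applyMat_projQubit_true]
      simp only [Bool.false_eq_true, if_false, if_true]
      rw [probFrom]
      have hnot : applyMat (liftOne (Sum.inr 0) (notGate : Matrix Bool Bool ℂ))
          (pairState 0 (applyMat (aeval (evolution H) Q) w)) =
          pairState (applyMat (aeval (evolution H) Q) w) 0 := by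
        refine (applyMat_liftOne_pairState notMatrix _ _).trans ?_
        simp [notMatrix]
      rw [hnot]
      have h1 := ih (k + 2) (applyMat (aeval (evolution H) P) w)
      have h2 := ih k (applyMat (aeval (evolution H) Q) w)
      have hz := hPQ _ (norm_phasePoint E₀)
      have horth := hI.norm_aeval_add_norm_aeval hPQ (orthPart ψ₀ w)
      rw [← hI.orthPart_aeval, ← hI.orthPart_aeval] at horth
      have hsmall := hI.norm_orthPart_aeval_le hη hP' w
      -- For the ground component the factor is p/2 + 2q with p + q = 1 and p ≥ 3/4, hence at most
      -- 7/8. For the excited component the roles are exchanged: 2 bp + bq/2 ≤ 7b/8 as soon as bp ≤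
      -- b/4.
      have key : walkPotential ψ₀ (k + 2) (applyMat (aeval (evolution H) P) w) +
          walkPotential ψ₀ k (applyMat (aeval (evolution H) Q) w) ≤
          7 / 8 * walkPotential ψ₀ (k + 1) w := by
        simp only [walkPotential, hI.inner_ground_aeval, norm_mul, mul_pow]
        set a := ‖inner ℂ ψ₀ w‖ ^ 2
        set b := ‖orthPart ψ₀ w‖ ^ 2
        set bp := ‖orthPart ψ₀ (applyMat (aeval (evolution H) P) w)‖ ^ 2
        set bq := ‖orthPart ψ₀ (applyMat (aeval (evolution H) Q) w)‖ ^ 2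
        set p := ‖P.eval (phasePoint E₀)‖ ^ 2
        set q := ‖Q.eval (phasePoint E₀)‖ ^ 2
        have ha : 0 ≤ a := sq_nonneg _
        have hb : 0 ≤ b := sq_nonneg _
        have hbp : bp ≤ b / 4 := by
          have : γ ^ 2 ≤ 1 := pow_le_one₀ hγ.le hγ'
          nlinarith
        have e1 : ((2 : ℝ) ^ (k + 2))⁻¹ = (2 ^ (k + 1))⁻¹ * (1 / 2) := by
          rw [pow_succ _ (k + 1), mul_inv]; norm_num
        have e2 : ((2 : ℝ) ^ k)⁻¹ = (2 ^ (k + 1))⁻¹ * 2 := by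
          rw [pow_succ, mul_inv]; ring
        have e3 : (2 : ℝ) ^ (k + 2) = 2 ^ (k + 1) * 2 := pow_succ _ _
        have e4 : (2 : ℝ) ^ k = 2 ^ (k + 1) * (1 / 2) := by rw [pow_succ]; ring
        rw [e1, e2, e3, e4]
        have hG : 0 < (2 : ℝ) ^ (k + 1) := by positivity
        have hG' : 0 < ((2 : ℝ) ^ (k + 1))⁻¹ := by positivity
        set G := (2 : ℝ) ^ (k + 1)
        have i1 : G⁻¹ * (1 / 2) * (p * a) + G⁻¹ * 2 * (q * a) ≤ 7 / 8 * (G⁻¹ * a) := by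
          have : 1 / 2 * p + 2 * q ≤ 7 / 8 := by linarith
          have := mul_le_mul_of_nonneg_right this (mul_nonneg hG'.le ha)
          linarith
        have i2 : G * 2 * bp + G * (1 / 2) * bq ≤ 7 / 8 * (G * b) := by
          have : 2 * bp + 1 / 2 * bq ≤ 7 / 8 * b := by linarith
          have := mul_le_mul_of_nonneg_left this hG.le
          linarith
        linarith
      calc _ ≤ K * (7 / 8) ^ j * walkPotential ψ₀ (k + 2) (applyMat (aeval (evolution H) P) w) +
            K * (7 / 8) ^ j * walkPotential ψ₀ k (applyMat (aeval (evolution H) Q) w) :=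
            add_le_add h1 h2
        _ ≤ K * (7 / 8) ^ j * (7 / 8 * walkPotential ψ₀ (k + 1) w) := by
            rw [← mul_add]; gcongr
        _ = _ := by rw [pow_succ]; ring

end Walk

/-! ### The complete algorithm -/

/-- The complete algorithm, with its cost in terms of the integer parameters. -/
theorem exists_preparation_program {n : ℕ} {η γ Δ ε ϑ : ℝ} (hη : 0 < η) (hγ : 0 < γ) (hγ' : γ ≤ 1)
    (hΔ : 0 < Δ) (hΔ' : Δ ≤ Real.pi) (hε : 0 < ε) (hε' : ε < 1) {r R T m M s : ℕ} (hs : 1 ≤ s)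
    (hM : 2 * Real.pi ≤ Δ / 5 * M) (hMs : (M : ℝ) ≤ γ ^ 2 / 2000 * 2 ^ s)
    (hr : 1 ≤ 3 ^ r * γ) (hr' : 3 ^ r * γ ≤ 3) (hm : Real.pi ≤ 2 ^ m * (Δ / 5))
    (herr : m * (2 * (7 / 8) ^ R) + (Real.sqrt ε)⁻¹ * (7 / 8) ^ T ≤ ϑ) :
    ∃ P : QProg n 3,
      (∀ (H : Matrix (SysBasis n) (SysBasis n) ℂ) (E₀ : ℝ) (ψ₀ : SysState n)
        (UI : Matrix (SysBasis n) (SysBasis n) ℂ), IsGroundStateInstance η γ Δ H E₀ ψ₀ UI →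
          1 - ϑ ≤ P.prepProb (evolution H) UI ψ₀ ε) ∧
      ∀ w g u t, CostLE w g u t → cost w P ≤
        (m * R + T) * attemptCost n r (t + (s * (M - 1) * u + (s * (M - 1) + 1) * g)) g := by
  have hpi := Real.pi_pos
  have hγ2 : 0 < γ ^ 2 := by positivity
  have hγ21 : γ ^ 2 ≤ 1 := pow_le_one₀ hγ.le hγ'
  -- The search leaves an uncertainty 3h, and the final filter needs a margin h on each side of its
  -- threshold; together they fill the gap Δ = 5h.
  set h := Δ / 5 with hh
  have hh0 : 0 < h := by positivity
  set d := s * (M - 1) with hd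
  have hfilter : ∀ μ : ℝ, ∃ (P Q : ℂ[X]) (W : List (QOp n 3)),
      (∀ z : ℂ, ‖z‖ = 1 → ‖P.eval z‖ ^ 2 + ‖Q.eval z‖ ^ 2 = 1) ∧
      (0 ≤ μ → ∀ x : ℝ, 0 ≤ x → x ≤ μ - h → 3 / 4 ≤ ‖P.eval (phasePoint x)‖ ^ 2) ∧
      (0 ≤ μ → ∀ x : ℝ, μ + h ≤ x → x ≤ Real.pi → ‖P.eval (phasePoint x)‖ ^ 2 ≤ γ ^ 2 / 1000) ∧
      (∀ o ∈ W, IsSignalOp o) ∧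
      (∀ w g u t, CostLE w g u t → listCost w W ≤ d * u + (d + 1) * g) ∧
      ∀ U UI, RealizesFilter U UI W P Q := by
    intro μ
    -- Replacing μ by max μ 0 makes the choice total with uniform cost. The value κ = γ²/2000 gives
    -- 2κ = γ²/1000 above the threshold and at least 1 - 2κ ≥ 3/4 below it.
    obtain ⟨P, Q, hPd, hQd, hPQ, hnear, hfar⟩ := exists_step_filter (h := h) (μ := max μ 0)
      (κ := γ ^ 2 / 2000) hh0 (by rw [hh]; linarith) (le_max_right _ _) (by positivity)
      (by linarith) hs hM hMs
    obtain ⟨W, hWs, hWc, hWact⟩ := exists_filter_circuit n d hPd hQd hPQ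
    refine ⟨P, Q, W, hPQ, fun hμ x hx hx' => ?_, fun hμ x hx hx' => ?_, hWs, hWc,
      fun U UI w => hWact U UI w⟩
    · rw [max_eq_left hμ] at hnear
      have := hnear x hx hx'
      linarith
    · rw [max_eq_left hμ] at hfar
      have := hfar x hx hx'
      linarith
  choose P Q W hPQ hnear hfar hWs hWc hWr using hfilter
  refine ⟨energySearch (fun μ => guessFilter (W μ)) r R h
    (fun l => filterWalk (W (l + 4 * h)) r T 0) m 0, ?_, ?_⟩
  · intro H E₀ ψ₀ UI hI
    have hU := evolution_mem_unitaryGroup hI.hermitian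
    have hbad := scaleInvariant_not_isGoodOutput ψ₀ ε
    obtain ⟨hE0, hEpi⟩ := hI.energy_mem hη
    have hguess : ∀ μ, ∀ o ∈ guessFilter (W μ), IsSignalOp o := by
      intro μ o ho
      rcases List.mem_cons.mp ho with rfl | ho
      · exact .queryInit _
      · exact hWs μ o ho
    have hfail := probFrom_energySearch_le (E := E₀) (r := r)
      (fin := fun l => filterWalk (W (l + 4 * h)) r T 0) (b := (Real.sqrt ε)⁻¹ * (7 / 8) ^ T)
      hU hI.unitary hbad hguess (fun μ => (hWr μ (evolution H) UI).guessFilter) hh0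
      (fun μ hμ hEμ => missProb_schedule_le hγ
        (hI.le_norm_aeval_guess_sq hγ (hnear μ hμ E₀ hE0 hEμ)) (norm_nonneg _)
        (hI.norm_aeval_guess_le (hPQ μ)) hr)
      (fun μ hμ hEμ => le_missProb_schedule hγ
        (hI.norm_aeval_guess_sq_le hη hΔ fun x hx hx' => hfar μ hμ x (hEμ.trans hx) hx')
        (norm_nonneg _) (hI.norm_aeval_guess_le (hPQ μ)) hr')
      (fun l hl hlE hEl => by
        -- At the threshold l + 4h the ground energy is at most l + 3h, one margin below, and the
        -- excited energies are at least E₀ + 5h ≥ l + 5h, one margin above.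
        have hμ : 0 ≤ l + 4 * h := by positivity
        have h1 := probFrom_filterWalk_le hI hη hγ hγ' hε hε' (hWs (l + 4 * h))
          (hWr (l + 4 * h) (evolution H) UI) (hPQ _)
          (hnear _ hμ E₀ hE0 (by linarith))
          (fun x hx hx' => hfar _ hμ x (by rw [hh] at *; linarith) hx') hr T 0 (ketZeroSys n)
        rwa [walkPotential_zero hI.ground.norm_eq, norm_ketZeroSys, ← ketZero_eq, one_pow,
          mul_one] at h1)
      R m 0 le_rfl hE0 (by linarith)
    have htot := probFrom_add_not hU hI.unitary (QProg.IsGoodOutput 3 ψ₀ ε)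
      (energySearch (fun μ => guessFilter (W μ)) r R h
        (fun l => filterWalk (W (l + 4 * h)) r T 0) m 0) (ketZero n 3)
    rw [norm_ketZero, one_pow] at htot
    rw [QProg.prepProb]
    linarith
  · intro w g u t hw
    have hb : ∀ l : ℝ, cost w (filterWalk (W (l + 4 * h)) r T 0) ≤
        T * attemptCost n r (t + (d * u + (d + 1) * g)) g := fun l =>
      cost_filterWalk_le hw (Nat.add_le_add_left (hWc _ w g u t hw) t) r T 0
    refine (cost_energySearch_le hw (a := t + (d * u + (d + 1) * g)) (fun x => ?_) hb r R h m
      0).trans (le_of_eq (by ring))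
    rw [guessFilter, listCost_cons]
    exact add_le_add (hw.queryInit false) (hWc _ w g u t hw)

/-- Without room for a spectral gap below `π`, every state is proportional to the ground state. -/
theorem done_prepProb {n : ℕ} {η γ Δ E₀ ε : ℝ} (hη : 0 < η) (hΔ : Real.pi < Δ) (hε : 0 < ε)
    {H : Matrix (SysBasis n) (SysBasis n) ℂ} {ψ₀ : SysState n}
    {UI : Matrix (SysBasis n) (SysBasis n) ℂ} (hI : IsGroundStateInstance η γ Δ H E₀ ψ₀ UI) :
    QProg.prepProb (QProg.done : QProg n 3) (evolution H) UI ψ₀ ε = 1 := by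
  have hE := hI.energy_mem hη
  -- The bound with κ = 0 is vacuously available, since E₀ + Δ exceeds π. It shows that the
  -- orthogonal part of any vector vanishes.
  have h1 := hI.norm_orthPart_aeval_le hη (P := 1) (κ := 0)
    (fun x hx hx' => by linarith) (ketZeroSys n)
  rw [map_one, one_applyMat, zero_mul] at h1
  have h2 := norm_sq_eq_inner_add_orthPart hI.ground.norm_eq (ketZeroSys n)
  rw [norm_ketZeroSys] at h2
  have h3 : 1 ≤ ‖inner ℂ ψ₀ (ketZeroSys n)‖ := by
    nlinarith [norm_nonneg (inner ℂ ψ₀ (ketZeroSys n))]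
  have hgood : QProg.IsGoodOutput 3 ψ₀ ε (ketZero n 3) :=
    ⟨ketZeroSys n, by rw [withZeroAncillas_eq, ketZero_eq], by rw [norm_ketZeroSys]; linarith⟩
  rw [QProg.prepProb, QProg.probFrom, if_pos hgood, norm_ketZero, one_pow]

/-! ### Asymptotic bounds -/

section Cost

variable {n : ℕ}

lemma costLE_costU : CostLE (QOp.costU : QOp n 3 → ℕ) 0 1 0 where
  gate := ⟨fun _ _ => le_rfl, fun _ _ _ _ => le_rfl⟩
  queryU _ _ := le_rfl
  queryInit _ := le_rfl
  inv o := by cases o <;> rfl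

lemma costLE_costInit : CostLE (QOp.costInit : QOp n 3 → ℕ) 0 0 1 where
  gate := ⟨fun _ _ => le_rfl, fun _ _ _ _ => le_rfl⟩
  queryU _ _ := le_rfl
  queryInit _ := le_rfl
  inv o := by cases o <;> rfl

lemma costLE_costGate : CostLE (QOp.costGate : QOp n 3 → ℕ) 1 0 0 where
  gate := ⟨fun _ _ => le_rfl, fun _ _ _ _ => le_rfl⟩
  queryU _ _ := le_rfl
  queryInit _ := le_rfl
  inv o := by cases o <;> rfl

end Cost

lemma slog_mono {x y : ℝ} (hx : 0 ≤ x) (h : x ≤ y) : slog x ≤ slog y :=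
  Real.log_le_log (by linarith) (by linarith)

lemma one_le_two_mul_slog {x : ℝ} (hx : 0 ≤ x) : 1 ≤ 2 * slog x := by
  have h1 : Real.log 2 ≤ slog x := Real.log_le_log (by norm_num) (by linarith)
  linarith [Real.log_two_gt_d9]

lemma slog_pos {x : ℝ} (hx : 0 ≤ x) : 0 < slog x := by linarith [one_le_two_mul_slog hx]

lemma one_le_slog {x : ℝ} (hx : 1 ≤ x) : 1 ≤ slog x := by
  rw [slog, Real.le_log_iff_exp_le (by linarith)]
  linarith [Real.exp_one_lt_d9]

lemma log_le_slog {x : ℝ} (hx : 0 < x) : Real.log x ≤ slog x :=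
  Real.log_le_log hx (by linarith)

lemma log_four_le : Real.log 4 ≤ 2 := by
  rw [show (4 : ℝ) = 2 ^ 2 by norm_num, Real.log_pow]
  push_cast
  linarith [Real.log_two_lt_d9]

/-- A gap Δ ≤ π only guarantees 4Δ⁻¹ ≥ 1, so inserting a factor Δ⁻¹ under a logarithm may cost a
factor 4 in its argument. -/
lemma slog_le_of_le_four_mul {x y : ℝ} (hx : 0 ≤ x) (h : x ≤ 4 * y) : slog x ≤ 5 * slog y := by
  have hy : 0 ≤ y := by linarith
  have h1 : slog x ≤ Real.log (4 * (2 + y)) := Real.log_le_log (by linarith) (by linarith)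
  rw [Real.log_mul (by norm_num) (by linarith)] at h1
  have h2 := one_le_two_mul_slog hy
  have h3 := log_four_le
  have h4 : slog y = Real.log (2 + y) := rfl
  linarith

lemma exists_nat_exp_ge {c y : ℝ} (hc : 0 < c) (hy : 1 ≤ y) :
    ∃ N : ℕ, 1 ≤ N ∧ (N : ℝ) ≤ c * Real.log y + 2 ∧ y ≤ Real.exp (N / c) := by
  have hlog := Real.log_nonneg hy
  refine ⟨⌈c * Real.log y⌉₊ + 1, by omega, ?_, ?_⟩
  · have := Nat.ceil_lt_add_one (mul_nonneg hc.le hlog)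
    push_cast
    linarith
  · rw [← Real.log_le_iff_le_exp (by linarith), le_div_iff₀ hc]
    have := Nat.le_ceil (c * Real.log y)
    push_cast
    linarith

lemma exists_two_pow_ge {y : ℝ} (hy : 1 ≤ y) :
    ∃ N : ℕ, 1 ≤ N ∧ (N : ℝ) ≤ 2 * Real.log y + 2 ∧ y ≤ 2 ^ N := by
  obtain ⟨N, h1, h2, h3⟩ := exists_nat_exp_ge two_pos hy
  refine ⟨N, h1, h2, h3.trans ?_⟩
  rw [← Real.rpow_natCast, Real.rpow_def_of_pos two_pos, Real.exp_le_exp]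
  have : (0 : ℝ) ≤ N := by positivity
  nlinarith [Real.log_two_gt_d9]

lemma exists_mul_pow_le_one {y : ℝ} (hy : 1 ≤ y) :
    ∃ N : ℕ, (N : ℝ) ≤ 8 * Real.log y + 2 ∧ y * (7 / 8) ^ N ≤ 1 := by
  obtain ⟨N, -, h2, h3⟩ := exists_nat_exp_ge (c := 8) (by norm_num) hy
  refine ⟨N, h2, ?_⟩
  have h4 : (7 / 8 : ℝ) ^ N ≤ Real.exp (-(N / 8)) := by
    have : (7 / 8 : ℝ) ≤ Real.exp (-(1 / 8)) := by
      linarith [Real.add_one_le_exp (-(1 / 8) : ℝ)]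
    calc (7 / 8 : ℝ) ^ N ≤ Real.exp (-(1 / 8)) ^ N := by gcongr
      _ = Real.exp (-(N / 8)) := by rw [← Real.exp_nat_mul]; congr 1; ring
  calc y * (7 / 8) ^ N ≤ Real.exp (N / 8) * Real.exp (-(N / 8)) := by gcongr
    _ = 1 := by rw [← Real.exp_add, add_neg_cancel, Real.exp_zero]

lemma log_le_half {x : ℝ} (hx : 0 ≤ x) : Real.log x ≤ x / 2 := by
  rcases hx.eq_or_lt with rfl | hx
  · simp
  have h4 := Real.log_le_sub_one_of_pos (x := x / 2) (by positivity)
  rw [Real.log_div hx.ne' two_ne_zero] at h4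
  linarith [Real.log_two_lt_d9]

/-! ### Choice of the integer parameters -/

lemma exists_filter_parameters {γ Δ : ℝ} (hγ : 0 < γ) (hγ' : γ ≤ 1) (hΔ : 0 < Δ)
    (hΔ' : Δ ≤ Real.pi) : ∃ M s : ℕ, 1 ≤ s ∧ 2 * Real.pi ≤ Δ / 5 * M ∧
      (M : ℝ) ≤ γ ^ 2 / 2000 * 2 ^ s ∧
      ((s * (M - 1) : ℕ) : ℝ) ≤ 4060 * (Δ⁻¹ * slog Δ⁻¹ * slog γ⁻¹) := by
  have hpi := Real.pi_gt_three
  have hpi' := Real.pi_lt_d2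
  have hΔi : 0 < Δ⁻¹ := inv_pos.mpr hΔ
  have hγi : 1 ≤ γ⁻¹ := (one_le_inv₀ hγ).mpr hγ'
  have hΔπ : 1 ≤ Real.pi * Δ⁻¹ := by rwa [← div_eq_mul_inv, one_le_div hΔ]
  have hA := one_le_two_mul_slog hΔi.le
  have hB := one_le_slog hγi
  have hlΔ := log_le_slog hΔi
  have hlγ := log_le_slog (x := γ⁻¹) (by linarith)
  set A := slog Δ⁻¹
  set B := slog γ⁻¹
  set M := ⌈10 * Real.pi * Δ⁻¹⌉₊ with hMdef
  have hM1 : 10 * Real.pi * Δ⁻¹ ≤ M := Nat.le_ceil _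
  have hM2 : (M : ℝ) ≤ 35 * Δ⁻¹ := by
    have h1 : (M : ℝ) < 10 * Real.pi * Δ⁻¹ + 1 := Nat.ceil_lt_add_one (by positivity)
    have h2 : Real.pi * Δ⁻¹ ≤ 3.15 * Δ⁻¹ := by gcongr
    linarith
  have hM10 : (10 : ℝ) ≤ M := by linarith
  have hγ2 : 1 ≤ γ⁻¹ ^ 2 := one_le_pow₀ hγi
  -- The exponent is the logarithm of 2000 M γ⁻², so the tail bound M ≤ κ 2^s holds with κ =
  -- γ²/2000. Its size is logarithmic in Δ⁻¹ and γ⁻¹ and free of ε.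
  obtain ⟨s, hs1, hs2, hs3⟩ := exists_two_pow_ge (y := 2000 * M * γ⁻¹ ^ 2) (by nlinarith)
  have hs4 : Real.log (2000 * M * γ⁻¹ ^ 2) ≤ 12 + A + 2 * B := by
    have h1 : Real.log (2000 * M * γ⁻¹ ^ 2) ≤ Real.log (70000 * Δ⁻¹ * γ⁻¹ ^ 2) := by
      apply Real.log_le_log (by positivity)
      have : 2000 * (M : ℝ) ≤ 70000 * Δ⁻¹ := by linarith
      gcongr
    rw [Real.log_mul (x := 70000 * Δ⁻¹) (by positivity) (by positivity),
      Real.log_mul (x := 70000) (by norm_num) hΔi.ne', Real.log_pow] at h1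
    have h2 : Real.log 70000 ≤ 12 := by
      rw [Real.log_le_iff_le_exp (by norm_num)]
      calc (70000 : ℝ) ≤ 2.7 ^ 12 := by norm_num
        _ ≤ Real.exp 1 ^ 12 := by
          gcongr
          linarith [Real.exp_one_gt_d9]
        _ = Real.exp 12 := by rw [← Real.exp_nat_mul]; norm_num
    push_cast at h1
    linarith
  have hs5 : (s : ℝ) ≤ 116 * (A * B) := by
    have h1 : A ≤ A * B := le_mul_of_one_le_right (by linarith) hB
    have h2 : 1 * B ≤ 2 * A * B := by gcongr
    linarith
  refine ⟨M, s, hs1, ?_, ?_, ?_⟩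
  · calc 2 * Real.pi = Δ / 5 * (10 * Real.pi * Δ⁻¹) := by field_simp; ring
      _ ≤ Δ / 5 * M := by gcongr
  · calc (M : ℝ) = γ ^ 2 / 2000 * (2000 * M * γ⁻¹ ^ 2) := by field_simp
      _ ≤ γ ^ 2 / 2000 * 2 ^ s := by gcongr
  · have hM' : ((M - 1 : ℕ) : ℝ) ≤ 35 * Δ⁻¹ := le_trans (by exact_mod_cast Nat.sub_le _ _) hM2
    rw [Nat.cast_mul]
    calc (s : ℝ) * ((M - 1 : ℕ) : ℝ) ≤ 116 * (A * B) * (35 * Δ⁻¹) := by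
          have : 0 < A := by linarith
          gcongr
      _ = 4060 * (Δ⁻¹ * A * B) := by ring

lemma exists_bisection_steps {Δ : ℝ} (hΔ : 0 < Δ) (hΔ' : Δ ≤ Real.pi) :
    ∃ m : ℕ, 1 ≤ m ∧ Real.pi ≤ 2 ^ m * (Δ / 5) ∧ (m : ℝ) ≤ 22 * slog Δ⁻¹ := by
  have hpi := Real.pi_gt_three
  have hpi' := Real.pi_lt_d2
  have hΔi : 0 < Δ⁻¹ := inv_pos.mpr hΔ
  have hΔπ : 1 ≤ Real.pi * Δ⁻¹ := by rwa [← div_eq_mul_inv, one_le_div hΔ]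
  have hA := one_le_two_mul_slog hΔi.le
  have hlΔ := log_le_slog hΔi
  obtain ⟨m, hm1, hm2, hm3⟩ := exists_two_pow_ge (y := 5 * Real.pi * Δ⁻¹) (by linarith)
  refine ⟨m, hm1, ?_, ?_⟩
  · calc Real.pi = 5 * Real.pi * Δ⁻¹ * (Δ / 5) := by field_simp
      _ ≤ 2 ^ m * (Δ / 5) := by gcongr
  · rw [Real.log_mul (by positivity) hΔi.ne'] at hm2
    have h : Real.log (5 * Real.pi) ≤ Real.log (4 * 4) :=
      Real.log_le_log (by positivity) (by linarith)
    rw [Real.log_mul (x := 4) (by norm_num) (by norm_num)] at h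
    linarith [log_four_le]

lemma exists_repetitions {ε ϑ A : ℝ} (hε : 0 < ε) (hε' : ε < 1) (hϑ : 0 < ϑ) (hϑ' : ϑ < 1)
    (hA : 1 ≤ 2 * A) {m : ℕ} (hm : 1 ≤ m) (hmA : (m : ℝ) ≤ 22 * A) :
    ∃ R : ℕ, m * (2 * (7 / 8) ^ R) ≤ ϑ / 2 ∧ (R : ℝ) ≤ 156 * (A * slog (ε⁻¹ * ϑ⁻¹)) := by
  have hεi : 1 ≤ ε⁻¹ := (one_le_inv₀ hε).mpr hε'.le
  have hϑi : 1 ≤ ϑ⁻¹ := (one_le_inv₀ hϑ).mpr hϑ'.le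
  have hεϑ : 1 ≤ ε⁻¹ * ϑ⁻¹ := one_le_mul_of_one_le_of_one_le hεi hϑi
  have hE := one_le_slog hεϑ
  have hlε := log_le_slog (x := ε⁻¹ * ϑ⁻¹) (by linarith)
  set E := slog (ε⁻¹ * ϑ⁻¹)
  have hm1 : (1 : ℝ) ≤ m := by exact_mod_cast hm
  obtain ⟨R, hR1, hR2⟩ := exists_mul_pow_le_one (y := 4 * m * ϑ⁻¹) (by nlinarith)
  refine ⟨R, ?_, ?_⟩
  · calc (m : ℝ) * (2 * (7 / 8) ^ R) = ϑ / 2 * (4 * m * ϑ⁻¹ * (7 / 8) ^ R) := by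
          field_simp; ring
      _ ≤ ϑ / 2 * 1 := by gcongr
      _ = ϑ / 2 := mul_one _
  · rw [Real.log_mul (by positivity) (by positivity),
      Real.log_mul (by norm_num) (by positivity)] at hR1
    have h1 : Real.log ϑ⁻¹ ≤ Real.log (ε⁻¹ * ϑ⁻¹) :=
      Real.log_le_log (by positivity) (le_mul_of_one_le_left (by positivity) hεi)
    -- The union bound over the m decisions costs log m. Bounding it by m/2, hence by a multiple of
    -- A, is crude but harmless, as powers of log Δ⁻¹ are available.
    have h2 := log_le_half m.cast_nonneg
    have h3 : A ≤ A * E := le_mul_of_one_le_right (by linarith) hE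
    have h4 : 1 * E ≤ 2 * A * E := by gcongr
    linarith [log_four_le]

lemma exists_walk_length {ε ϑ : ℝ} (hε : 0 < ε) (hε' : ε < 1) (hϑ : 0 < ϑ) (hϑ' : ϑ < 1) :
    ∃ T : ℕ, (Real.sqrt ε)⁻¹ * (7 / 8) ^ T ≤ ϑ / 2 ∧ (T : ℝ) ≤ 18 * slog (ε⁻¹ * ϑ⁻¹) := by
  have hεi : 1 ≤ ε⁻¹ := (one_le_inv₀ hε).mpr hε'.le
  have hϑi : 1 ≤ ϑ⁻¹ := (one_le_inv₀ hϑ).mpr hϑ'.le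
  have hεϑ : 1 ≤ ε⁻¹ * ϑ⁻¹ := one_le_mul_of_one_le_of_one_le hεi hϑi
  have hE := one_le_slog hεϑ
  have hlε := log_le_slog (x := ε⁻¹ * ϑ⁻¹) (by linarith)
  have hsε : Real.sqrt ε ≤ 1 := Real.sqrt_le_one.mpr hε'.le
  have hsε0 : 0 < Real.sqrt ε := Real.sqrt_pos.mpr hε
  have hsεi : 1 ≤ (Real.sqrt ε)⁻¹ := (one_le_inv₀ hsε0).mpr hsε
  obtain ⟨T, hT1, hT2⟩ := exists_mul_pow_le_one (y := 2 * (Real.sqrt ε)⁻¹ * ϑ⁻¹) (by nlinarith)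
  refine ⟨T, ?_, ?_⟩
  · calc (Real.sqrt ε)⁻¹ * (7 / 8) ^ T =
          ϑ / 2 * (2 * (Real.sqrt ε)⁻¹ * ϑ⁻¹ * (7 / 8) ^ T) := by field_simp
      _ ≤ ϑ / 2 * 1 := by gcongr
      _ = ϑ / 2 := mul_one _
  · have h1 : (Real.sqrt ε)⁻¹ ≤ ε⁻¹ := by
      apply inv_anti₀ hε
      calc ε = Real.sqrt ε * Real.sqrt ε := (Real.mul_self_sqrt hε.le).symm
        _ ≤ Real.sqrt ε * 1 := by gcongr
        _ = Real.sqrt ε := mul_one _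
    have h2 : Real.log (2 * (Real.sqrt ε)⁻¹ * ϑ⁻¹) ≤ Real.log (2 * (ε⁻¹ * ϑ⁻¹)) := by
      apply Real.log_le_log (by positivity)
      rw [mul_assoc]
      gcongr
    rw [Real.log_mul two_ne_zero (y := ε⁻¹ * ϑ⁻¹) (by positivity)] at h2
    linarith [Real.log_two_lt_d9]

lemma exists_tripling_count {γ : ℝ} (hγ : 0 < γ) (hγ' : γ ≤ 1) :
    ∃ r : ℕ, 1 ≤ 3 ^ r * γ ∧ 3 ^ r * γ ≤ 3 := by
  obtain ⟨r, hr1, hr2⟩ := exists_nat_pow_near ((one_le_inv₀ hγ).mpr hγ')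
    (by norm_num : (1 : ℝ) < 3)
  refine ⟨r + 1, ?_, ?_⟩
  · calc (1 : ℝ) = γ⁻¹ * γ := (inv_mul_cancel₀ hγ.ne').symm
      _ ≤ 3 ^ (r + 1) * γ := by gcongr
  · calc (3 : ℝ) ^ (r + 1) * γ = 3 * (3 ^ r * γ) := by ring
      _ ≤ 3 * (γ⁻¹ * γ) := by gcongr
      _ = 3 := by rw [inv_mul_cancel₀ hγ.ne', mul_one]

/-- The complete algorithm, with its cost in terms of the problem parameters: `N` bounds the
number of runs of a circuit that makes `d` queries to the time evolution. -/
theorem exists_preparation_program_cost_le {n : ℕ} {η γ Δ ε ϑ : ℝ} (hη : 0 < η) (hγ : 0 < γ)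
    (hγ' : γ ≤ 1) (hΔ : 0 < Δ) (hΔ' : Δ ≤ Real.pi) (hε : 0 < ε) (hε' : ε < 1) (hϑ : 0 < ϑ)
    (hϑ' : ϑ < 1) :
    ∃ (P : QProg n 3) (N d : ℕ),
      (∀ (H : Matrix (SysBasis n) (SysBasis n) ℂ) (E₀ : ℝ) (ψ₀ : SysState n)
        (UI : Matrix (SysBasis n) (SysBasis n) ℂ), IsGroundStateInstance η γ Δ H E₀ ψ₀ UI →
          1 - ϑ ≤ P.prepProb (evolution H) UI ψ₀ ε) ∧
      (N : ℝ) ≤ 129600 * (γ⁻¹ * slog Δ⁻¹ ^ 2 * slog (ε⁻¹ * ϑ⁻¹)) ∧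
      (d : ℝ) ≤ 4060 * (Δ⁻¹ * slog Δ⁻¹ * slog γ⁻¹) ∧
      ∀ w g u t, CostLE w g u t → cost w P ≤
        N * (t + (d * u + (d + 1) * g) + 99 * (n + 1) * g) := by
  have hΔi : 0 < Δ⁻¹ := inv_pos.mpr hΔ
  have hγi : 0 < γ⁻¹ := inv_pos.mpr hγ
  have hA := one_le_two_mul_slog hΔi.le
  have hE := slog_pos (x := ε⁻¹ * ϑ⁻¹) (by positivity)
  obtain ⟨r, hr, hr'⟩ := exists_tripling_count hγ hγ'
  obtain ⟨M, s, hs, hM, hMs, hd⟩ := exists_filter_parameters hγ hγ' hΔ hΔ'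
  obtain ⟨m, hm1, hm, hmA⟩ := exists_bisection_steps hΔ hΔ'
  obtain ⟨R, hR, hRE⟩ := exists_repetitions hε hε' hϑ hϑ' hA hm1 hmA
  obtain ⟨T, hT, hTE⟩ := exists_walk_length hε hε' hϑ hϑ'
  obtain ⟨P, hP, hcost⟩ := exists_preparation_program (n := n) (ϑ := ϑ) hη hγ hγ' hΔ hΔ' hε hε' hs
    hM hMs hr hr' hm (R := R) (T := T) (by linarith)
  refine ⟨P, (m * R + T) * (12 * 3 ^ r), s * (M - 1), hP, ?_, hd, fun w g u t hw =>
    (hcost w g u t hw).trans (le_of_eq ?_)⟩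
  · set A := slog Δ⁻¹
    set E := slog (ε⁻¹ * ϑ⁻¹)
    have hA0 : 0 < A := by linarith
    have h1 : (m : ℝ) * R ≤ 22 * A * (156 * (A * E)) := by gcongr
    have h2 : 1 ≤ 4 * A ^ 2 := by nlinarith
    have h3 : E ≤ 4 * A ^ 2 * E := le_mul_of_one_le_left hE.le h2
    have h4 : (m : ℝ) * R + T ≤ 3600 * (A ^ 2 * E) := by
      have : 0 ≤ A ^ 2 * E := by positivity
      linarith
    have h5 : (3 : ℝ) ^ r ≤ 3 * γ⁻¹ := by rwa [← div_eq_mul_inv, le_div_iff₀ hγ]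
    push_cast
    calc ((m : ℝ) * R + T) * (12 * 3 ^ r) ≤ 3600 * (A ^ 2 * E) * (12 * (3 * γ⁻¹)) := by gcongr
      _ = _ := by ring
  · rw [attemptCost]; ring

lemma softO_nonneg {C g : ℝ} (k : ℕ) (hC : 0 ≤ C) (hg : 0 ≤ g) : 0 ≤ softO C k g := by
  have := slog_pos hg
  rw [softO]
  positivity

/-- A product of logarithms is bounded by a power of one logarithm. -/
lemma pow_three_mul_le_pow_four {A B S : ℝ} (hA : 0 ≤ A) (hB : 0 ≤ B) (hAS : A ≤ S)
    (hBS : B ≤ 5 * S) : A ^ 3 * B ≤ 5 * S ^ 4 := by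
  have hS : 0 ≤ S := hA.trans hAS
  calc A ^ 3 * B ≤ S ^ 3 * (5 * S) := by gcongr
    _ = 5 * S ^ 4 := by ring

lemma sq_le_four_mul_pow_four {A S : ℝ} (hA : 0 ≤ A) (hAS : A ≤ S) (hS : 1 ≤ 2 * S) :
    A ^ 2 ≤ 4 * S ^ 4 := by
  have h1 : 1 ≤ 4 * S ^ 2 := by nlinarith
  calc A ^ 2 ≤ S ^ 2 * 1 := by rw [mul_one]; gcongr
    _ ≤ S ^ 2 * (4 * S ^ 2) := by gcongr
    _ = 4 * S ^ 4 := by ring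

end

/-! ### Assembling the final bounds -/

theorem theorem6 :
    ∃ (C : ℝ) (k : ℕ), 0 < C ∧
      ∀ (n : ℕ) (η γ Δ ε ϑ : ℝ), 0 < η → 0 < γ → γ ≤ 1 → 0 < Δ → 0 < ε → ε < 1 →
        0 < ϑ → ϑ < 1 →
        ∃ P : QProg n 3,
          (∀ (H : Matrix (SysBasis n) (SysBasis n) ℂ) (E₀ : ℝ) (ψ₀ : SysState n)
              (UI : Matrix (SysBasis n) (SysBasis n) ℂ),
              IsGroundStateInstance η γ Δ H E₀ ψ₀ UI →
              1 - ϑ ≤ P.prepProb (evolution H) UI ψ₀ ε) ∧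
          (P.queriesU : ℝ) ≤ softO C k (Δ⁻¹ * γ⁻¹ * slog (ε⁻¹ * ϑ⁻¹) ^ k) ∧
          (P.queriesInit : ℝ) ≤ C * (γ⁻¹ * slog (Δ⁻¹ * ε⁻¹ * ϑ⁻¹) ^ k) ∧
          (P.gateCount : ℝ) ≤ softO C k
            (n * γ⁻¹ * slog (Δ⁻¹ * ε⁻¹ * ϑ⁻¹) + Δ⁻¹ * γ⁻¹ * slog (ε⁻¹ * ϑ⁻¹)) ∧
          (P.queryDepth : ℝ) ≤ softO C k (Δ⁻¹ * γ⁻¹ * slog (ε⁻¹ * ϑ⁻¹) ^ k) := by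
  -- Four logarithms have to be absorbed in the query bound: A² from the number of runs and A · B
  -- from the filter degree.
  refine ⟨10 ^ 10, 4, by norm_num, fun n η γ Δ ε ϑ hη hγ hγ' hΔ hε hε' hϑ hϑ' => ?_⟩
  have hΔi : 0 < Δ⁻¹ := inv_pos.mpr hΔ
  have hγi : 0 < γ⁻¹ := inv_pos.mpr hγ
  have hγi1 : 1 ≤ γ⁻¹ := (one_le_inv₀ hγ).mpr hγ'
  have hεϑ : 1 ≤ ε⁻¹ * ϑ⁻¹ :=
    one_le_mul_of_one_le_of_one_le ((one_le_inv₀ hε).mpr hε'.le) ((one_le_inv₀ hϑ).mpr hϑ'.le)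
  have hE := one_le_slog hεϑ
  have hzD : 0 ≤ Δ⁻¹ * ε⁻¹ * ϑ⁻¹ := by positivity
  have hD := one_le_two_mul_slog hzD
  have hD0 := slog_pos hzD
  set E := slog (ε⁻¹ * ϑ⁻¹)
  set D := slog (Δ⁻¹ * ε⁻¹ * ϑ⁻¹)
  -- If Δ > π there is no room for an excited level, so the initial state is already the ground
  -- state up to phase. Otherwise Δ⁻¹ is bounded below, which the estimates use.
  rcases lt_or_ge Real.pi Δ with hΔπ | hΔπ
  · refine ⟨.done, fun H E₀ ψ₀ UI hI => ?_, ?_, ?_, ?_, ?_⟩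
    · rw [done_prepProb hη hΔπ hε hI]; linarith
    · exact (le_of_eq Nat.cast_zero).trans (softO_nonneg _ (by positivity) (by positivity))
    · exact (le_of_eq Nat.cast_zero).trans (by positivity)
    · exact (le_of_eq Nat.cast_zero).trans (softO_nonneg _ (by positivity) (by positivity))
    · exact (le_of_eq Nat.cast_zero).trans (softO_nonneg _ (by positivity) (by positivity))
  have hΔ4 : 1 ≤ 4 * Δ⁻¹ := by
    rw [← div_eq_mul_inv, one_le_div hΔ]
    linarith [Real.pi_lt_d2]
  have hA := one_le_two_mul_slog hΔi.le
  have hA0 := slog_pos hΔi.le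
  have hB := one_le_slog hγi1
  have hAD : slog Δ⁻¹ ≤ D :=
    slog_mono hΔi.le (by rw [mul_assoc]; exact le_mul_of_one_le_right hΔi.le hεϑ)
  have hED : E ≤ 5 * D := slog_le_of_le_four_mul (by positivity) (by
    rw [mul_assoc, ← mul_assoc 4]; exact le_mul_of_one_le_left (by positivity) hΔ4)
  have hAX : ∀ X, Δ⁻¹ * γ⁻¹ ≤ X → slog Δ⁻¹ ≤ slog X := fun X hX =>
    slog_mono hΔi.le ((le_mul_of_one_le_right hΔi.le hγi1).trans hX)
  have hBX : ∀ X, Δ⁻¹ * γ⁻¹ ≤ X → slog γ⁻¹ ≤ 5 * slog X := fun X hX =>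
    slog_le_of_le_four_mul hγi.le (by
      have := le_mul_of_one_le_left hγi.le hΔ4
      linarith)
  obtain ⟨P, N, d, hP, hN, hd, hcost⟩ :=
    exists_preparation_program_cost_le (n := n) hη hγ hγ' hΔ hΔπ hε hε' hϑ hϑ'
  set A := slog Δ⁻¹
  set B := slog γ⁻¹
  have hU : (P.queriesU : ℝ) ≤ softO (10 ^ 10) 4 (Δ⁻¹ * γ⁻¹ * E ^ 4) := by
    have h1 : P.queriesU ≤ N * d := by
      rw [queriesU_eq_cost]
      exact (hcost _ _ _ _ costLE_costU).trans (le_of_eq (by ring))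
    have hX : Δ⁻¹ * γ⁻¹ ≤ Δ⁻¹ * γ⁻¹ * E ^ 4 :=
      le_mul_of_one_le_right (by positivity) (one_le_pow₀ hE)
    have hE4 : E ≤ E ^ 4 := le_self_pow₀ hE (by norm_num)
    have h2 := pow_three_mul_le_pow_four hA0.le (by linarith) (hAX _ hX) (hBX _ hX)
    rw [softO]
    calc (P.queriesU : ℝ) ≤ N * d := by exact_mod_cast h1
      _ ≤ 129600 * (γ⁻¹ * A ^ 2 * E) * (4060 * (Δ⁻¹ * A * B)) := by gcongr
      _ = 526176000 * (Δ⁻¹ * γ⁻¹ * E * (A ^ 3 * B)) := by ring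
      _ ≤ 526176000 * (Δ⁻¹ * γ⁻¹ * E ^ 4 * (5 * slog (Δ⁻¹ * γ⁻¹ * E ^ 4) ^ 4)) := by gcongr
      _ = 2630880000 * (Δ⁻¹ * γ⁻¹ * E ^ 4 * slog (Δ⁻¹ * γ⁻¹ * E ^ 4) ^ 4) := by ring
      _ ≤ _ := by
        have := slog_pos (x := Δ⁻¹ * γ⁻¹ * E ^ 4) (by positivity)
        gcongr
        norm_num
  refine ⟨P, hP, hU, ?_, ?_, le_trans (by exact_mod_cast queryDepth_le_queriesU P) hU⟩
  · have h1 : P.queriesInit ≤ N := by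
      rw [queriesInit_eq_cost]
      exact (hcost _ _ _ _ costLE_costInit).trans (le_of_eq (by ring))
    calc (P.queriesInit : ℝ) ≤ N := by exact_mod_cast h1
      _ ≤ 129600 * (γ⁻¹ * A ^ 2 * E) := hN
      _ ≤ 129600 * (γ⁻¹ * D ^ 2 * (5 * D)) := by gcongr
      _ = 648000 * (γ⁻¹ * D ^ 3 * 1) := by ring
      _ ≤ 648000 * (γ⁻¹ * D ^ 3 * (2 * D)) := by gcongr
      _ = 1296000 * (γ⁻¹ * D ^ 4) := by ring
      _ ≤ _ := by gcongr; norm_num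
  · have h1 : P.gateCount ≤ N * (d + 1 + 99 * (n + 1)) := by
      rw [gateCount_eq_cost]
      exact (hcost _ _ _ _ costLE_costGate).trans (le_of_eq (by ring))
    set G := n * γ⁻¹ * D + Δ⁻¹ * γ⁻¹ * E with hG
    have hG1 : 0 ≤ n * γ⁻¹ * D := by positivity
    have hX : Δ⁻¹ * γ⁻¹ ≤ G := by
      have : Δ⁻¹ * γ⁻¹ ≤ Δ⁻¹ * γ⁻¹ * E := le_mul_of_one_le_right (by positivity) hE
      linarith
    have hG0 : 0 ≤ G := le_trans (by positivity) hX
    have hS := one_le_two_mul_slog hG0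
    have h2 := pow_three_mul_le_pow_four hA0.le (by linarith) (hAX _ hX) (hBX _ hX)
    have h3 := sq_le_four_mul_pow_four hA0.le (hAX _ hX) hS
    -- S⁴ absorbs the logarithms A and B, but E can be far larger than any power of S would cover
    -- through Δ⁻¹γ⁻¹ alone. It must stay to the first power, which is why the filter degree d has
    -- to be independent of ε.
    set S := slog G
    -- Lets the additive constant 100 of the gate count per run be charged to the filter degree:
    -- 4860 = 4060 + 100 · 8.
    have h4 : (1 : ℝ) ≤ 8 * (Δ⁻¹ * A * B) := by
      calc (1 : ℝ) = 1 * 1 * 1 := by norm_num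
        _ ≤ 4 * Δ⁻¹ * (2 * A) * B := by gcongr
        _ = 8 * (Δ⁻¹ * A * B) := by ring
    rw [softO]
    calc (P.gateCount : ℝ) ≤ N * (d + 1 + 99 * (n + 1)) := by exact_mod_cast h1
      _ ≤ N * (4860 * (Δ⁻¹ * A * B) + 99 * n) :=
        mul_le_mul_of_nonneg_left (by linarith) N.cast_nonneg
      _ ≤ 129600 * (γ⁻¹ * A ^ 2 * E) * (4860 * (Δ⁻¹ * A * B) + 99 * n) := by gcongr
      _ = 629856000 * (Δ⁻¹ * γ⁻¹ * E * (A ^ 3 * B)) + 12830400 * (n * γ⁻¹ * E * A ^ 2) := by ring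
      _ ≤ 629856000 * (Δ⁻¹ * γ⁻¹ * E * (5 * S ^ 4)) +
          12830400 * (n * γ⁻¹ * (5 * D) * (4 * S ^ 4)) := by gcongr
      _ = 3149280000 * (Δ⁻¹ * γ⁻¹ * E * S ^ 4) + 256608000 * (n * γ⁻¹ * D * S ^ 4) := by ring
      _ ≤ 10 ^ 10 * (Δ⁻¹ * γ⁻¹ * E * S ^ 4) + 10 ^ 10 * (n * γ⁻¹ * D * S ^ 4) := by
        gcongr <;> norm_num
      _ = 10 ^ 10 * (G * S ^ 4) := by rw [hG]; ring
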